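/- **Submodular Knapsack Secretary Problem (SKS).** An instance consists of a ground set $A=[n]$, a submodular function $v:2^A\to\mathbb{R}_{\ge 0}$ with $v(\emptyset)=0$ (not necessarily monotone), costs $c_i\ge 0$ and a budget $B>0$. The elements arrive in a uniformly random order and each must be accepted or rejected irrevocably upon arrival. An online algorithm knows $n$ and $B$, learns the cost of an element when it arrives, and may query $v(S)$ for sets $S$ of elements that have already arrived. Let $\mathrm{opt}(A,B)=\max\{v(S): S\subseteq A,\ \sum_{i\in S}c_i\le B\}$. A randomized procedure is a *$C$-approximation* if, on every instance, the accepted set $X$ always satisfies $\sum_{i\in X}c_i\le B$ and $\mathrm{opt}(A,B)\le C\cdot\mathbb{E}[v(X)]$, the expectation being over the arrival order and the random choices of the procedure. **GenSm-Online** (run with the true costs, with an offline subroutine $\mathrm{ALG}_1$ for submodular maximization under a knapsack constraint, and $\beta=8.725$). With probability $2/5$ run Dynkin's algorithm: after the first $\lfloor n/e\rfloor$ arrivals, accept only the first element $i$ whose value $v(\{i\})$ is at least that of every element among these first arrivals (ties are broken by the names of the elements; elements with $c_i>B$ are disregarded). With probability $3/5$: draw $\xi$ from the binomial distribution $\mathcal{B}(n,1/2)$,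 reject the first $\xi$ arrivals, let $A_1$ be their set and $x=v(\mathrm{ALG}_1(A_1))$, and start with $S_1=S_2=T_1=T_2=\emptyset$, $B_1=B_2=B$. For each later arrival $i$, let $j\in\{1,2\}$ maximize $v(S_j\cup\{i\})-v(S_j)$ (with $j=1$ in case of a tie) and let $\pi=\frac{\beta B}{x}\left(v(S_j\cup\{i\})-v(S_j)\right)$; if $x>0$ and $c_i\le\pi\le B_j$, then add $i$ to $S_j$, decrease $B_j$ by $\pi$, and add $i$ to $T_j$ with probability $1/2$. The accepted set is one of $S_1,S_2,T_1,T_2$, chosen in advance with probabilities $\frac1{10},\frac1{10},\frac25,\frac25$. **Statement.** (1) There are a universal constant $C$ and a randomized online algorithm for the non-monotone SKS that is a $C$-approximation and runs in polynomial time in the value query model: the number of steps (value queries, arithmetic operations and comparisons) is bounded by a polynomial in $n$ in every run. (2) GenSm-Online is an $O(1)$-approximation: for every $\alpha\ge 1$ there is a constant $C$ such that, for every (possibly randomized) $\mathrm{ALG}_1$ that on every offline instance always returns a set within the budget, of expected value at least $1/\alpha$ times the optimum, GenSm-Online with subroutine $\mathrm{ALG}_1$ and the true costs is a $C$-approximation.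 -/

import Mathlib

noncomputable section

/-! ### Instances, optimal value, approximation -/

/-- An instance of the Submodular Knapsack Secretary Problem (without its arrival order): a
normalized, non-negative, not necessarily monotone submodular objective `v` on the subsets of the
ground set `Fin n`, non-negative costs `c` and a budget `B > 0`. -/
structure SKSInstance (n : ℕ) where
  v : Finset (Fin n) → ℝ
  c : Fin n → ℝ
  B : ℝ
  v_empty : v ∅ = 0
  v_nonneg : ∀ S, 0 ≤ v S
  submodular : ∀ S T, v (S ∪ T) + v (S ∩ T) ≤ v S + v T
  c_nonneg : ∀ i, 0 ≤ c i
  B_pos : 0 < B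

namespace SKSInstance

variable {n : ℕ} (I : SKSInstance n)

def Feasible (S : Finset (Fin n)) : Prop := ∑ i ∈ S, I.c i ≤ I.B

theorem feasible_empty : I.Feasible ∅ := by
  simpa [Feasible] using I.B_pos.le

open Classical in
/-- The offline optimum: the largest value of a set whose total cost is at most the budget. -/
def opt : ℝ :=
  (Finset.univ.filter I.Feasible).sup' ⟨∅, by simpa using I.feasible_empty⟩ I.v

/-- The expected value of a random set. -/
def expect (μ : PMF (Finset (Fin n))) : ℝ := ∑ S, (μ S).toReal * I.v S

/-- The marginal value `v(i | S) = v(S ∪ {i}) - v(S)`. -/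
def marg (S : Finset (Fin n)) (i : Fin n) : ℝ := I.v (insert i S) - I.v S

/-- If the elements arrive in the order `σ 0, σ 1, …`, this is the part of the instance that
consists of the first `k` arrivals; its element `j : Fin k` is the arrival number `j`. -/
def firstArrivals (σ : Equiv.Perm (Fin n)) {k : ℕ} (hk : k ≤ n) : SKSInstance k where
  v T := I.v (T.map ((Fin.castLEEmb hk).trans σ.toEmbedding))
  c j := I.c (σ (Fin.castLE hk j))
  B := I.B
  v_empty := by simpa using I.v_empty
  v_nonneg _ := I.v_nonneg _
  submodular S T := by
    rw [Finset.map_union, Finset.map_inter]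
    exact I.submodular _ _
  c_nonneg _ := I.c_nonneg _
  B_pos := I.B_pos

end SKSInstance

/-- What a (randomized) procedure accepts: the distribution, over its own random choices, of the
accepted set, for each instance and each arrival order (`σ t` is the element that arrives at
time `t`). -/
abbrev SecretaryOutcome : Type :=
  ∀ n : ℕ, SKSInstance n → Equiv.Perm (Fin n) → PMF (Finset (Fin n))

/-- `C`-approximation in the secretary model: the accepted set never exceeds the budget, and its
expected value, over a uniformly random arrival order and the random choices of the procedure,
is at least `opt / C`. -/
def IsSecretaryApprox (C : ℝ) (F : SecretaryOutcome) : Prop :=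
  ∀ (n : ℕ) (I : SKSInstance n),
    (∀ σ, ∀ S ∈ (F n I σ).support, I.Feasible S) ∧
    I.opt ≤ C * I.expect ((PMF.uniformOfFintype (Equiv.Perm (Fin n))).bind (F n I))

/-! ### A machine model with a value oracle

Programs of a fixed finite text work on named arrays of natural numbers and of real numbers.
Natural numbers can only be added and subtracted; real numbers can be added, subtracted, scaled by
constants of the program, and compared, also through products `a * b ≤ c * d`.  (So on rational
data every stored number has a bit length polynomial in the number of steps and the input.) -/

/-- Expressions for natural numbers; `get k e` is the entry at index `e` of the array `k`. -/
inductive NExp where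
  | lit (m : ℕ)
  | get (k : ℕ) (e : NExp)
  | add (a b : NExp)
  | sub (a b : NExp)

/-- Expressions for real numbers. -/
inductive RExp where
  | lit (q : ℚ)
  | get (k : ℕ) (e : NExp)
  | add (a b : RExp)
  | sub (a b : RExp)
  | smul (q : ℚ) (a : RExp)

/-- Tests. -/
inductive Test where
  | nle (a b : NExp)
  | rle (a b c d : RExp)

/-- Programs.  `query k i j` asks for the value of the set of arrivals whose indicator function is
the array `j` and stores the answer in the array `k` at index `i`; `rand k i e` stores a uniformly
random number from `{0, …, e}`; `loop e p` executes `p` as often as the value of `e` says. -/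
inductive Prog where
  | skip
  | nset (k : ℕ) (i e : NExp)
  | rset (k : ℕ) (i : NExp) (e : RExp)
  | query (k : ℕ) (i : NExp) (j : ℕ)
  | rand (k : ℕ) (i e : NExp)
  | seq (p q : Prog)
  | ite (t : Test) (p q : Prog)
  | loop (e : NExp) (p : Prog)

/-- The memory of the machine, with a counter for the executed steps. -/
structure Mem where
  nat : ℕ → ℕ → ℕ
  real : ℕ → ℕ → ℝ
  steps : ℕ

namespace Mem

def setNat (m : Mem) (k i x : ℕ) : Mem :=
  { m with nat := Function.update m.nat k (Function.update (m.nat k) i x) }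

def setReal (m : Mem) (k i : ℕ) (x : ℝ) : Mem :=
  { m with real := Function.update m.real k (Function.update (m.real k) i x) }

def tick (m : Mem) (t : ℕ) : Mem := { m with steps := m.steps + t }

end Mem

namespace NExp

def eval (m : Mem) : NExp → ℕ
  | lit x => x
  | get k e => m.nat k (e.eval m)
  | add a b => a.eval m + b.eval m
  | sub a b => a.eval m - b.eval m

/-- The number of operations in an expression; evaluating it takes that many steps. -/
def size : NExp → ℕ
  | lit _ => 1
  | get _ e => e.size + 1
  | add a b => a.size + b.size + 1
  | sub a b => a.size + b.size + 1

end NExp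

namespace RExp

def eval (m : Mem) : RExp → ℝ
  | lit q => (q : ℝ)
  | get k e => m.real k (e.eval m)
  | add a b => a.eval m + b.eval m
  | sub a b => a.eval m - b.eval m
  | smul q a => (q : ℝ) * a.eval m

def size : RExp → ℕ
  | lit _ => 1
  | get _ e => e.size + 1
  | add a b => a.size + b.size + 1
  | sub a b => a.size + b.size + 1
  | smul _ a => a.size + 1

end RExp

namespace Test

def Holds (m : Mem) : Test → Prop
  | nle a b => a.eval m ≤ b.eval m
  | rle a b c d => a.eval m * b.eval m ≤ c.eval m * d.eval m

def size : Test → ℕ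
  | nle a b => a.size + b.size + 1
  | rle a b c d => a.size + b.size + c.size + d.size + 3

end Test

/-- Executes the randomized operation `f` exactly `k` times. -/
def iterM (f : Mem → PMF Mem) : ℕ → Mem → PMF Mem
  | 0, m => PMF.pure m
  | k + 1, m => (f m).bind (iterM f k)

open Classical in
/-- The distribution of the memory after the execution of a program, started in a given memory, if
the value oracle answers `orc f` on the set with indicator function `f`. -/
def Prog.exec (orc : (ℕ → ℕ) → ℝ) : Prog → Mem → PMF Mem
  | .skip, m => PMF.pure (m.tick 1)
  | .nset k i e, m =>
      PMF.pure ((m.setNat k (i.eval m) (e.eval m)).tick (i.size + e.size + 1))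
  | .rset k i e, m =>
      PMF.pure ((m.setReal k (i.eval m) (e.eval m)).tick (i.size + e.size + 1))
  | .query k i j, m =>
      PMF.pure ((m.setReal k (i.eval m) (orc (m.nat j))).tick (i.size + 1))
  | .rand k i e, m =>
      (PMF.uniformOfFintype (Fin (e.eval m + 1))).bind fun r =>
        PMF.pure ((m.setNat k (i.eval m) r).tick (i.size + e.size + 1))
  | .seq p q, m => (p.exec orc m).bind (q.exec orc)
  | .ite t p q, m =>
      if t.Holds m then p.exec orc (m.tick t.size) else q.exec orc (m.tick t.size)
  | .loop e p, m => iterM (p.exec orc) (e.eval m) (m.tick (e.size + 1))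

/-! ### Online algorithms -/

/-- An online algorithm: a program that is executed before the first arrival and a program that is
executed upon each arrival.  The memory persists. -/
structure OnlineAlgorithm where
  setup : Prog
  onArrival : Prog

namespace OnlineAlgorithm

open Classical in
/-- The value oracle after `a` arrivals.  Elements are named by their arrival times, and names of
elements that have not arrived yet are ignored. -/
def oracle {n : ℕ} (I : SKSInstance n) (σ : Equiv.Perm (Fin n)) (a : ℕ) (f : ℕ → ℕ) : ℝ :=
  I.v ((Finset.univ.filter fun t : Fin n => (t : ℕ) < a ∧ f t ≠ 0).map σ.toEmbedding)

/-- At the start only the number of elements and the budget are in the memory. -/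
def initialMem (n : ℕ) (B : ℝ) : Mem :=
  (({ nat := fun _ _ => 0, real := fun _ _ => 0, steps := 0 } : Mem).setNat 0 0 n).setReal 0 0 B

/-- The arrival at time `t` of an element of cost `x`: the time is written to entry `0` of the
natural array `1`, and the cost to entry `t` of the real array `1`. -/
def present (m : Mem) (t : ℕ) (x : ℝ) : Mem := (m.setNat 1 0 t).setReal 1 t x

/-- Processes the arrivals at the listed times.  The arriving element is accepted if, when the
program for this arrival ends, entry `0` of the natural array `2` is not zero, and otherwise it is
rejected; `acc` is the set accepted so far. -/
def runFrom (P : OnlineAlgorithm) {n : ℕ} (I : SKSInstance n) (σ : Equiv.Perm (Fin n)) :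
    List (Fin n) → Mem → Finset (Fin n) → PMF (Mem × Finset (Fin n))
  | [], m, acc => PMF.pure (m, acc)
  | t :: l, m, acc =>
      (P.onArrival.exec (oracle I σ (t + 1)) (present m t (I.c (σ t)))).bind fun m' =>
        P.runFrom I σ l m' (if m'.nat 2 0 = 0 then acc else insert (σ t) acc)

/-- The joint distribution of the final memory and the accepted set. -/
def run (P : OnlineAlgorithm) {n : ℕ} (I : SKSInstance n) (σ : Equiv.Perm (Fin n)) :
    PMF (Mem × Finset (Fin n)) :=
  (P.setup.exec (oracle I σ 0) (initialMem n I.B)).bind fun m =>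
    P.runFrom I σ (List.finRange n) m ∅

def outcome (P : OnlineAlgorithm) : SecretaryOutcome :=
  fun _ I σ => (P.run I σ).map Prod.snd

/-- In every possible run the total number of steps, value queries included, is bounded by a
polynomial in the number of elements. -/
def PolynomialTime (P : OnlineAlgorithm) : Prop :=
  ∃ p : Polynomial ℕ, ∀ (n : ℕ) (I : SKSInstance n) (σ : Equiv.Perm (Fin n)),
    ∀ r ∈ (P.run I σ).support, r.1.steps ≤ p.eval n

end OnlineAlgorithm

/-! ### The procedure GenSm-Online, run with true costs -/

/-- A (randomized) offline procedure for submodular maximization under a knapsack constraint. -/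
abbrev OfflineProcedure : Type := ∀ m : ℕ, SKSInstance m → PMF (Finset (Fin m))

/-- `α`-approximation in expectation, with outputs that never exceed the budget. -/
def OfflineProcedure.IsApprox (alg : OfflineProcedure) (α : ℝ) : Prop :=
  ∀ (m : ℕ) (I : SKSInstance m),
    (∀ S ∈ (alg m I).support, I.Feasible S) ∧ I.opt ≤ α * I.expect (alg m I)

namespace GenSm

variable {n : ℕ} (I : SKSInstance n)

/-- `i` is at least as good as `j` as a singleton, with ties broken by the names. -/
def Better (i j : Fin n) : Prop := I.v {j} < I.v {i} ∨ (I.v {j} = I.v {i} ∧ j ≤ i)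

/-- The arrival at time `t` is after the sample of the first `n / e` arrivals, and it is at least as
good as everything in the sample.  Elements that alone exceed the budget do not count. -/
def Qualifies (σ : Equiv.Perm (Fin n)) (t : Fin n) : Prop :=
  ⌊(n : ℝ) / Real.exp 1⌋₊ ≤ (t : ℕ) ∧ I.c (σ t) ≤ I.B ∧
    ∀ s : Fin n, (s : ℕ) < ⌊(n : ℝ) / Real.exp 1⌋₊ → I.c (σ s) ≤ I.B → Better I (σ t) (σ s)

open Classical in
/-- Dynkin's algorithm: accept the first arrival that qualifies, and nothing else. -/
def dynkin (σ : Equiv.Perm (Fin n)) : Finset (Fin n) :=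
  (Finset.univ.filter fun t => Qualifies I σ t ∧ ∀ u < t, ¬ Qualifies I σ u).map σ.toEmbedding

/-- The two candidate sets `S j`, their random subsets `T j` and the remaining budgets. -/
structure State (n : ℕ) where
  S : Bool → Finset (Fin n)
  T : Bool → Finset (Fin n)
  budget : Bool → ℝ

def State.start : State n where
  S _ := ∅
  T _ := ∅
  budget _ := I.B

/-- The parameter `β`. -/
def beta : ℝ := 8.725

/-- A candidate set for which the marginal value of `i` is largest. -/
def side (s : State n) (i : Fin n) : Bool :=
  if I.marg (s.S true) i ≤ I.marg (s.S false) i then false else true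

/-- The price `(β B / x) v(i | S_j)` that is offered to `i`, for the `j` chosen by `side`. -/
def price (x : ℝ) (s : State n) (i : Fin n) : ℝ :=
  beta * I.B / x * I.marg (s.S (side I s i)) i

/-- Processes the arrival of `i`, for the estimate `x` of the optimum.  For `x = 0` the price is
infinite, hence above the remaining budget, and `i` is rejected. -/
def step (x : ℝ) (s : State n) (i : Fin n) : PMF (State n) :=
  let j := side I s i
  let π := price I x s i
  if 0 < x ∧ I.c i ≤ π ∧ π ≤ s.budget j then
    (PMF.uniformOfFintype Bool).map fun coin =>
      { S := Function.update s.S j (insert i (s.S j))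
        T := if coin then Function.update s.T j (insert i (s.T j)) else s.T
        budget := Function.update s.budget j (s.budget j - π) }
  else PMF.pure s

def sweep (x : ℝ) : List (Fin n) → State n → PMF (State n)
  | [], s => PMF.pure s
  | i :: l, s => (step I x s i).bind (sweep x l)

/-- The set that is returned: each `S j` with probability `1/10`, each `T j` with probability
`2/5`, if `w` is uniformly distributed. -/
def choose (w : Fin 10) (s : State n) : Finset (Fin n) :=
  if w = 0 then s.S false else if w = 1 then s.S true
  else if w < 6 then s.T false else s.T true

/-- GenSm-Online with the offline subroutine `alg`, on an arrival order `σ`, with the true costs.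
With probability `2/5` it runs Dynkin's algorithm.  Otherwise it draws `ξ` from the binomial
distribution `B(n, 1/2)`, as the number of heads in `n` fair coin flips (`H` is the set of heads and
`ξ = H.card`), rejects the first `ξ` arrivals, runs `alg` on them to get the estimate `x`, and sweeps
through the remaining arrivals. -/
def online (alg : OfflineProcedure) : SecretaryOutcome := fun n I σ =>
  (PMF.uniformOfFintype (Fin 5)).bind fun k =>
    if k < 2 then PMF.pure (dynkin I σ)
    else
      (PMF.uniformOfFintype (Fin 10)).bind fun w =>
        (PMF.uniformOfFintype (Finset (Fin n))).bind fun H =>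
          let J := I.firstArrivals σ (card_finset_fin_le H)
          (alg H.card J).bind fun D =>
            (sweep I (J.v D) (((List.finRange n).drop H.card).map σ) (State.start I)).map (choose w)

end GenSm

end

/-! Fix a small δ and call an element affordable if its cost is at most B. If some affordable
element is worth δ·opt, a secretary rule for a single element suffices: with constant probability
the second best affordable element falls into the sample and the best one does not.

Otherwise all affordable elements are small, and the optimum O splits into P and Q of almost equal
value (`exists_prefix`). A binomial sample size makes the sample a uniformly random subset
(`lexp_sample`). Exchanging the elements of P, or of Q, between the sample and its complement yields
four equally likely sets. By subadditivity one of them has half of v(P) inside and half of v(Q)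
outside (`quarter_le_goodSample`). So with probability 1/4 the sample determines opt up to a
constant, while the later arrivals still contain a feasible F of value about opt/4.

The prices paid for S_j telescope to βB·v(S_j)/x. The budget test is therefore β·v(S_j ∪ {i}) ≤ x,
and S_j is feasible because each cost is at most its price. Unless a candidate set or a single
element of F is worth x/(2β), each i in F either joins the set for which its marginal value is
larger or has marginal value below c_i·x/(βB). Hence v(S_j ∪ F) ≤ v(S_1) + v(S_2) + x/β for both j.
As S_1 and S_2 are disjoint, submodularity gives v(F) ≤ v(S_1 ∪ F) + v(S_2 ∪ F), which takes the
place of monotonicity. For x ≤ opt and β > 8 a constant fraction of opt remains for v(S_1) + v(S_2)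
(`PairInv.step`, `pairSweep_value`).

For GenSm-Online the sets T_j play no role in the lower bound. As ALG_1 is good only in expectation,
`lexp_sweep_value` averages over its outputs.

For the polynomial-time algorithm the offline subroutine is the same sweep on the sample, run for
the guesses M, 2M, 4M, … with M the best affordable singleton of the sample. As the optimum of the
sample lies between M and nM, n guesses are enough (`le_bestGuess_of_feasible`). All randomness is
in the setup, so an arrival is a function on memories (`Prog.det`) that preserves an invariant
(`Inv.step`). All loops run n times, so the polynomial bound can be read off the program text. -/

open scoped ENNReal

/-! ### Expectations of non-negative functions -/

namespace PMF

/-- The expectation of a non-negative extended real function. -/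
noncomputable def lexp {α : Type*} (μ : PMF α) (f : α → ℝ≥0∞) : ℝ≥0∞ := ∑' a, μ a * f a

variable {α γ : Type*}

theorem lexp_pure (a : α) (f : α → ℝ≥0∞) : (PMF.pure a).lexp f = f a := by
  classical
  rw [lexp, tsum_eq_single a]
  · simp
  · intro b hb; simp [PMF.pure_apply, hb]

theorem lexp_bind (μ : PMF α) (g : α → PMF γ) (f : γ → ℝ≥0∞) :
    (μ.bind g).lexp f = μ.lexp fun a => (g a).lexp f := by
  simp only [lexp, PMF.bind_apply, ← ENNReal.tsum_mul_right, ← ENNReal.tsum_mul_left]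
  rw [ENNReal.tsum_comm]
  simp only [mul_assoc]

theorem lexp_map (μ : PMF α) (g : α → γ) (f : γ → ℝ≥0∞) :
    (μ.map g).lexp f = μ.lexp (f ∘ g) := by
  rw [← PMF.bind_pure_comp, lexp_bind]
  simp [lexp_pure, Function.comp_def]

theorem lexp_mono_support (μ : PMF α) {f g : α → ℝ≥0∞} (h : ∀ a ∈ μ.support, f a ≤ g a) :
    μ.lexp f ≤ μ.lexp g := by
  refine ENNReal.tsum_le_tsum fun a => ?_
  by_cases ha : μ a = 0
  · simp [ha]
  · exact mul_le_mul_right (h a ha) _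

theorem lexp_mono (μ : PMF α) {f g : α → ℝ≥0∞} (h : ∀ a, f a ≤ g a) : μ.lexp f ≤ μ.lexp g :=
  μ.lexp_mono_support fun a _ => h a

theorem lexp_const (μ : PMF α) (b : ℝ≥0∞) : (μ.lexp fun _ => b) = b := by
  simp [lexp, ENNReal.tsum_mul_right]

theorem le_lexp (μ : PMF α) {f : α → ℝ≥0∞} {b : ℝ≥0∞} (h : ∀ a ∈ μ.support, b ≤ f a) :
    b ≤ μ.lexp f := by
  rw [← μ.lexp_const b]
  exact μ.lexp_mono_support h

theorem lexp_add (μ : PMF α) (f g : α → ℝ≥0∞) :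
    (μ.lexp fun a => f a + g a) = μ.lexp f + μ.lexp g := by
  simp [lexp, mul_add, ENNReal.tsum_add]

theorem lexp_const_mul (μ : PMF α) (b : ℝ≥0∞) (f : α → ℝ≥0∞) :
    (μ.lexp fun a => b * f a) = b * μ.lexp f := by
  simp [lexp, mul_left_comm, ENNReal.tsum_mul_left]

theorem lexp_uniform [Fintype α] [Nonempty α] (f : α → ℝ≥0∞) :
    (PMF.uniformOfFintype α).lexp f = (Fintype.card α : ℝ≥0∞)⁻¹ * ∑ a, f a := by
  simp [lexp, tsum_fintype, Finset.mul_sum]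

theorem le_lexp_uniform_single [Fintype α] [Nonempty α] (f : α → ℝ≥0∞) (a : α) :
    (Fintype.card α : ℝ≥0∞)⁻¹ * f a ≤ (PMF.uniformOfFintype α).lexp f := by
  rw [lexp_uniform]
  gcongr
  exact Finset.single_le_sum (f := f) (fun _ _ => zero_le) (Finset.mem_univ a)

end PMF

/-! ### Random subsets -/

/-- The first `k` times. -/
def firstTimes (n k : ℕ) : Finset (Fin n) := Finset.univ.filter fun t => (t : ℕ) < k

theorem mem_firstTimes {n k : ℕ} {t : Fin n} : t ∈ firstTimes n k ↔ (t : ℕ) < k := by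
  simp [firstTimes]

theorem card_firstTimes {n k : ℕ} (hk : k ≤ n) : (firstTimes n k).card = k := by
  simp [firstTimes, Fin.card_filter_val_lt, hk]

theorem exists_perm_map_eq {α : Type*} [Fintype α] [DecidableEq α] {s t : Finset α}
    (h : s.card = t.card) : ∃ τ : Equiv.Perm α, s.map τ.toEmbedding = t := by
  obtain ⟨e⟩ : Nonempty (s ≃ t) := ⟨Finset.equivOfCardEq h⟩
  refine ⟨e.extendSubtype, ?_⟩
  apply Finset.eq_of_subset_of_card_le
  · intro x hx
    obtain ⟨y, hy, rfl⟩ := Finset.mem_map.1 hx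
    simpa using e.extendSubtype_mem y hy
  · simp [h]

/-- If the size of the sample is the number of heads in `n` fair coin flips, the sample is a
uniformly random set. -/
theorem sum_sample {n : ℕ} (g : Finset (Fin n) → ℝ≥0∞) :
    ∑ σ : Equiv.Perm (Fin n), ∑ H : Finset (Fin n),
        g ((firstTimes n H.card).map σ.toEmbedding) =
      (Fintype.card (Equiv.Perm (Fin n)) : ℝ≥0∞) * ∑ H : Finset (Fin n), g H := by
  -- For τ mapping the first |H| times onto H, substituting στ for σ turns the sample into σ(H). For
  -- fixed σ, the map H ↦ σ(H) permutes the subsets.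
  have h1 : ∀ H : Finset (Fin n),
      ∑ σ : Equiv.Perm (Fin n), g ((firstTimes n H.card).map σ.toEmbedding) =
        ∑ σ : Equiv.Perm (Fin n), g (H.map σ.toEmbedding) := by
    intro H
    obtain ⟨τ, hτ⟩ := exists_perm_map_eq
      (card_firstTimes (card_finset_fin_le H) : (firstTimes n H.card).card = H.card)
    rw [← Equiv.sum_comp (Equiv.mulRight τ)
      (fun σ => g ((firstTimes n H.card).map σ.toEmbedding))]
    refine Finset.sum_congr rfl fun σ _ => ?_
    congr 1
    nth_rewrite 2 [← hτ]
    rw [Finset.map_map]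
    rfl
  rw [Finset.sum_comm, Finset.sum_congr rfl fun H _ => h1 H, Finset.sum_comm]
  have h2 : ∀ σ : Equiv.Perm (Fin n), ∑ H : Finset (Fin n), g (H.map σ.toEmbedding) =
      ∑ H : Finset (Fin n), g H := fun σ => Equiv.sum_comp σ.finsetCongr g
  simp [h2]

/-- This moves estimates for uniformly random subsets to the secretary model, where order and sample
size are drawn separately. -/
theorem lexp_sample {n : ℕ} (g : Finset (Fin n) → ℝ≥0∞) :
    ((PMF.uniformOfFintype (Equiv.Perm (Fin n))).lexp fun σ =>
      (PMF.uniformOfFintype (Finset (Fin n))).lexp fun H =>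
        g ((firstTimes n H.card).map σ.toEmbedding)) =
      (PMF.uniformOfFintype (Finset (Fin n))).lexp g := by
  simp only [PMF.lexp_uniform, ← Finset.mul_sum]
  rw [mul_left_comm, sum_sample, ← mul_assoc (_ : ℝ≥0∞)⁻¹ (Fintype.card (Equiv.Perm (Fin n)) : ℝ≥0∞),
    ENNReal.inv_mul_cancel (by simp) (by simp), one_mul]

/-- An event that holds for one of the four sets which arise from `H` by exchanging the elements of
`P` and `Q` has probability at least `1 / 4`. -/
theorem quarter_le_lexp {n : ℕ} (Ev : Finset (Fin n) → Prop) [DecidablePred Ev]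
    (P Q : Finset (Fin n))
    (h : ∀ H, Ev H ∨ Ev (symmDiff H P) ∨ Ev (symmDiff H Q) ∨ Ev (symmDiff (symmDiff H P) Q))
    (b : ℝ≥0∞) :
    4⁻¹ * b ≤ (PMF.uniformOfFintype (Finset (Fin n))).lexp fun H => if Ev H then b else 0 := by
  set f : Finset (Fin n) → ℝ≥0∞ := fun H => if Ev H then b else 0 with hf
  -- Exchanging P is an involution of the subsets. So the four translates of `f` have equal sums
  -- over all H, while at each H they add up to at least b.
  have inv : ∀ P : Finset (Fin n), Function.Involutive fun H => symmDiff H P := by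
    intro P H; simp
  have e : ∀ (P : Finset (Fin n)) (f : Finset (Fin n) → ℝ≥0∞),
      ∑ H, f (symmDiff H P) = ∑ H, f H := fun P f =>
    Equiv.sum_comp (inv P).toPerm f
  have key : (Fintype.card (Finset (Fin n)) : ℝ≥0∞) * b ≤ 4 * ∑ H, f H := by
    calc (Fintype.card (Finset (Fin n)) : ℝ≥0∞) * b = ∑ _H : Finset (Fin n), b := by simp
      _ ≤ ∑ H, (f H + f (symmDiff H P) + f (symmDiff H Q) + f (symmDiff (symmDiff H P) Q)) := by
        refine Finset.sum_le_sum fun H _ => ?_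
        rcases h H with h | h | h | h
        · exact le_add_right (le_add_right (le_add_right (by simp [hf, h])))
        · exact le_add_right (le_add_right (le_add_left (by simp [hf, h])))
        · exact le_add_right (le_add_left (by simp [hf, h]))
        · exact le_add_left (by simp [hf, h])
      _ = 4 * ∑ H, f H := by
        rw [Finset.sum_add_distrib, Finset.sum_add_distrib, Finset.sum_add_distrib, e P f, e Q f,
          e P (fun H => f (symmDiff H Q)), e Q f]
        ring
  rw [PMF.lexp_uniform]
  calc 4⁻¹ * b = 4⁻¹ * ((Fintype.card (Finset (Fin n)) : ℝ≥0∞)⁻¹ *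
        ((Fintype.card (Finset (Fin n)) : ℝ≥0∞) * b)) := by
        rw [← mul_assoc (_ : ℝ≥0∞)⁻¹ (Fintype.card (Finset (Fin n)) : ℝ≥0∞),
          ENNReal.inv_mul_cancel (by simp) (by simp), one_mul]
    _ ≤ 4⁻¹ * ((Fintype.card (Finset (Fin n)) : ℝ≥0∞)⁻¹ * (4 * ∑ H, f H)) := by gcongr
    _ = (Fintype.card (Finset (Fin n)) : ℝ≥0∞)⁻¹ * ∑ H, f H := by
      rw [mul_left_comm, ← mul_assoc (4⁻¹ : ℝ≥0∞), ENNReal.inv_mul_cancel (by simp) (by simp), one_mul]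

namespace SKSInstance

variable {n : ℕ} (I : SKSInstance n)

/-! ### Basic facts -/

theorem le_opt {S : Finset (Fin n)} (hS : I.Feasible S) : I.v S ≤ I.opt := by
  classical
  exact Finset.le_sup' I.v (by simpa using hS)

theorem exists_opt : ∃ S, I.Feasible S ∧ I.v S = I.opt := by
  classical
  obtain ⟨S, hS, h⟩ := Finset.exists_mem_eq_sup' (s := Finset.univ.filter I.Feasible)
    ⟨∅, by simpa using I.feasible_empty⟩ I.v
  exact ⟨S, by simpa using hS, by rw [opt]; convert h.symm⟩

theorem opt_nonneg : 0 ≤ I.opt := (I.v_nonneg ∅).trans (I.le_opt I.feasible_empty)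

variable {I} in
theorem Feasible.mono {S T : Finset (Fin n)} (hT : I.Feasible T) (h : S ⊆ T) : I.Feasible S :=
  (Finset.sum_le_sum_of_subset_of_nonneg h fun _ _ _ => I.c_nonneg _).trans hT

variable {I} in
theorem Feasible.cost_le {S : Finset (Fin n)} (hS : I.Feasible S) {i : Fin n} (hi : i ∈ S) :
    I.c i ≤ I.B :=
  (Finset.single_le_sum (fun j _ => I.c_nonneg j) hi).trans hS

theorem feasible_singleton {i : Fin n} : I.Feasible {i} ↔ I.c i ≤ I.B := by simp [Feasible]

theorem ofReal_expect (μ : PMF (Finset (Fin n))) :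
    ENNReal.ofReal (I.expect μ) = μ.lexp fun S => ENNReal.ofReal (I.v S) := by
  rw [expect, ENNReal.ofReal_sum_of_nonneg
    fun S _ => mul_nonneg ENNReal.toReal_nonneg (I.v_nonneg S), PMF.lexp, tsum_fintype]
  refine Finset.sum_congr rfl fun S _ => ?_
  rw [ENNReal.ofReal_mul ENNReal.toReal_nonneg, ENNReal.ofReal_toReal (μ.apply_ne_top S)]

theorem expect_nonneg (μ : PMF (Finset (Fin n))) : 0 ≤ I.expect μ :=
  Finset.sum_nonneg fun S _ => mul_nonneg ENNReal.toReal_nonneg (I.v_nonneg S)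

/-- Diminishing returns: submodularity applied to S ∪ {i} and T, which meet exactly in S because i ∉
T. -/
theorem v_insert_le {S T : Finset (Fin n)} {i : Fin n} (h : S ⊆ T) (hi : i ∉ T) :
    I.v (insert i T) ≤ I.v T + I.marg S i := by
  have h1 := I.submodular (insert i S) T
  have h2 : insert i S ∪ T = insert i T := by
    rw [Finset.insert_union, Finset.union_eq_right.2 h]
  have h3 : insert i S ∩ T = S := by
    rw [Finset.insert_inter_of_notMem hi, Finset.inter_eq_left.2 h]
  rw [h2, h3] at h1
  rw [marg]
  linarith

theorem marg_le_singleton {S : Finset (Fin n)} {i : Fin n} (hi : i ∉ S) :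
    I.marg S i ≤ I.v {i} := by
  have := I.v_insert_le (Finset.empty_subset S) hi
  simp only [marg, insert_empty_eq, I.v_empty] at *
  linarith

theorem v_union_le (S T : Finset (Fin n)) : I.v (S ∪ T) ≤ I.v S + I.v T := by
  have := I.submodular S T
  have := I.v_nonneg (S ∩ T)
  linarith

theorem v_le_sum (S : Finset (Fin n)) : I.v S ≤ ∑ i ∈ S, I.v {i} := by
  induction S using Finset.induction_on with
  | empty => simp [I.v_empty]
  | insert i S hi ih =>
    rw [Finset.sum_insert hi, Finset.insert_eq]
    linarith [I.v_union_le {i} S]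

/-! ### Splitting a set into two valuable parts -/

/-- Remove elements one at a time until the value first drops below a. By subadditivity the set just
before exceeds a by at most one singleton value; monotonicity is not needed. -/
theorem exists_prefix {a d : ℝ} (ha : 0 ≤ a) (hd : 0 ≤ d) (O : Finset (Fin n))
    (hO : ∀ i ∈ O, I.v {i} ≤ d) (h : a ≤ I.v O) : ∃ P ⊆ O, a ≤ I.v P ∧ I.v P ≤ a + d := by
  induction O using Finset.induction_on with
  | empty => exact ⟨∅, Finset.Subset.refl _, h, by rw [I.v_empty]; linarith⟩
  | insert i O hi ih =>
    by_cases h' : a ≤ I.v O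
    · obtain ⟨P, hP, h1⟩ := ih (fun j hj => hO j (Finset.mem_insert_of_mem hj)) h'
      exact ⟨P, hP.trans (Finset.subset_insert _ _), h1⟩
    · refine ⟨insert i O, Finset.Subset.refl _, h, ?_⟩
      have := I.v_union_le {i} O
      have := hO i (Finset.mem_insert_self _ _)
      rw [Finset.insert_eq]
      linarith

/-- The sample `A` and its complement both contain valuable feasible sets. -/
def GoodSample (δ : ℝ) (A : Finset (Fin n)) : Prop :=
  (∃ F ⊆ A, I.Feasible F ∧ I.opt / 4 ≤ I.v F) ∧
    ∃ F ⊆ Aᶜ, I.Feasible F ∧ (1 / 4 - δ / 2) * I.opt ≤ I.v F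

-- The prefix P of O has value at least opt/2, and Q = O \ P has value at least (1/2 − δ)·opt. For
-- any H, the better half of P is P ∩ H or P \ H, and likewise for Q. Exchanging P, Q, both or
-- neither moves the better half of P into the sample and that of Q out of it.
open Classical in
theorem quarter_le_goodSample {δ : ℝ} (hδ : 0 ≤ δ)
    (h : ∀ i, I.c i ≤ I.B → I.v {i} ≤ δ * I.opt) (b : ℝ≥0∞) :
    4⁻¹ * b ≤ (PMF.uniformOfFintype (Finset (Fin n))).lexp fun H =>
      if I.GoodSample δ H then b else 0 := by
  obtain ⟨O, hO, hv⟩ := I.exists_opt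
  have h0 := I.opt_nonneg
  obtain ⟨P, hPO, h1, h2⟩ := I.exists_prefix (a := I.opt / 2) (d := δ * I.opt) (by linarith)
    (mul_nonneg hδ h0) O (fun i hi => h i (hO.cost_le hi)) (by linarith)
  have hQ : (1 / 2 - δ) * I.opt ≤ I.v (O \ P) := by
    have := I.v_union_le P (O \ P)
    rw [Finset.union_sdiff_of_subset hPO, hv] at this
    linarith
  have hPQ : Disjoint P (O \ P) := Finset.disjoint_sdiff
  have fP : I.Feasible P := hO.mono hPO
  have fQ : I.Feasible (O \ P) := hO.mono Finset.sdiff_subset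
  set Q := O \ P
  have good : ∀ H, I.v P / 2 ≤ I.v (P ∩ H) → I.v Q / 2 ≤ I.v (Q \ H) → I.GoodSample δ H := by
    intro H a1 a2
    refine ⟨⟨P ∩ H, Finset.inter_subset_right, fP.mono Finset.inter_subset_left, by linarith⟩,
      ⟨Q \ H, fun x hx => ?_, fQ.mono Finset.sdiff_subset, by linarith⟩⟩
    simp only [Finset.mem_sdiff, Finset.mem_compl] at hx ⊢
    exact hx.2
  refine quarter_le_lexp _ P Q (fun H => ?_) b
  have d : ∀ x, x ∈ P → x ∉ Q := fun x h1 h2 => Finset.disjoint_left.1 hPQ h1 h2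
  have e1 : P ∩ symmDiff H P = P \ H := by
    ext x; simp only [Finset.mem_inter, Finset.mem_symmDiff, Finset.mem_sdiff]; tauto
  have e2 : Q \ symmDiff H P = Q \ H := by
    ext x; have := d x; simp only [Finset.mem_symmDiff, Finset.mem_sdiff]; tauto
  have e3 : P ∩ symmDiff H Q = P ∩ H := by
    ext x; have := d x; simp only [Finset.mem_inter, Finset.mem_symmDiff]; tauto
  have e4 : Q \ symmDiff H Q = Q ∩ H := by
    ext x; simp only [Finset.mem_inter, Finset.mem_symmDiff, Finset.mem_sdiff]; tauto
  have e5 : P ∩ symmDiff (symmDiff H P) Q = P \ H := by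
    ext x; have := d x
    simp only [Finset.mem_inter, Finset.mem_symmDiff, Finset.mem_sdiff]; tauto
  have e6 : Q \ symmDiff (symmDiff H P) Q = Q ∩ H := by
    ext x; have := d x
    simp only [Finset.mem_inter, Finset.mem_symmDiff, Finset.mem_sdiff]; tauto
  have sP := I.v_union_le (P ∩ H) (P \ H)
  have sQ := I.v_union_le (Q ∩ H) (Q \ H)
  rw [Finset.union_comm, Finset.sdiff_union_inter] at sP sQ
  have gH := good H
  have gP := good (symmDiff H P)
  have gQ := good (symmDiff H Q)
  have gPQ := good (symmDiff (symmDiff H P) Q)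
  rw [e1, e2] at gP
  rw [e3, e4] at gQ
  rw [e5, e6] at gPQ
  rcases le_or_gt (I.v P / 2) (I.v (P ∩ H)) with p | p <;>
    rcases le_or_gt (I.v Q / 2) (I.v (Q \ H)) with q | q
  · exact Or.inl (gH p q)
  · exact Or.inr (Or.inr (Or.inl (gQ p (by linarith))))
  · exact Or.inr (Or.inl (gP (by linarith) q))
  · exact Or.inr (Or.inr (Or.inr (gPQ (by linarith) (by linarith))))

/-! ### The sweep that builds two candidate sets -/

/-- The index of a candidate set for which the marginal value of `i` is largest. -/
noncomputable def bestSide (S : Bool → Finset (Fin n)) (i : Fin n) : Bool :=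
  if I.marg (S true) i ≤ I.marg (S false) i then false else true

theorem marg_le_bestSide (S : Bool → Finset (Fin n)) (i : Fin n) (j : Bool) :
    I.marg (S j) i ≤ I.marg (S (I.bestSide S i)) i := by
  unfold bestSide
  split_ifs with h
  · cases j
    · exact le_rfl
    · exact h
  · cases j
    · exact (not_le.1 h).le
    · exact le_rfl

/-- The test for adding an element to a candidate set, for the estimate `x` of the optimum. With
the price `π = (β B / x) v(i | S j)`, it says that `c i ≤ π` and that the prices paid for `S j`
remain within the budget. -/
def Admits (β x : ℝ) (S : Bool → Finset (Fin n)) (i : Fin n) (j : Bool) : Prop :=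
  0 < x ∧ I.c i * x ≤ β * I.B * I.marg (S j) i ∧ β * I.v (insert i (S j)) ≤ x

open Classical in
/-- The arrival of `i`. -/
noncomputable def pairStep (β x : ℝ) (S : Bool → Finset (Fin n)) (i : Fin n) :
    Bool → Finset (Fin n) :=
  if I.Admits β x S i (I.bestSide S i) then
    Function.update S (I.bestSide S i) (insert i (S (I.bestSide S i)))
  else S

/-- The arrival of the elements of a list. -/
noncomputable def pairSweep (β x : ℝ) (l : List (Fin n)) (S : Bool → Finset (Fin n)) :
    Bool → Finset (Fin n) :=
  l.foldl (I.pairStep β x) S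

/-- The invariant of the sweep, after the arrival of the elements of `A`. -/
structure PairInv (β x : ℝ) (O A : Finset (Fin n)) (S : Bool → Finset (Fin n)) : Prop where
  subset : ∀ j, S j ⊆ A
  disjoint : Disjoint (S false) (S true)
  cost : ∀ j, (∑ i ∈ S j, I.c i) * x ≤ β * I.B * I.v (S j)
  le_est : ∀ j, β * I.v (S j) ≤ x
  bound : ((∃ j, x ≤ 2 * β * I.v (S j)) ∨ ∃ i ∈ O, x ≤ 2 * β * I.v {i}) ∨
    ∀ j, β * I.B * I.v (S j ∪ (O ∩ A)) ≤
      β * I.B * (I.v (S j) + I.v (S !j)) + x * ∑ i ∈ O ∩ A, I.c i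

-- In `bound`, the value of S_j ∪ (O ∩ A) is charged to both candidate sets and to the cost of O. An
-- accepted element raises the right side by its marginal for the chosen set, which is its largest.
-- An element of O that fails the cost test is paid for by its own cost. Failure of the capacity
-- test leads to the first alternative, which persists because the candidate sets never lose value.
variable {I} in
theorem PairInv.step {β x : ℝ} (hβ : 0 < β) (hx : 0 < x) {O A : Finset (Fin n)}
    {S : Bool → Finset (Fin n)} (h : I.PairInv β x O A S) {i : Fin n} (hi : i ∉ A) :
    I.PairInv β x O (insert i A) (I.pairStep β x S i) := by
  classical
  have hB := I.B_pos
  have hβB : 0 < β * I.B := mul_pos hβ hB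
  have hiS : ∀ j, i ∉ S j := fun j hj => hi (h.subset j hj)
  have hiO : ∀ j, i ∉ S j ∪ (O ∩ A) := fun j => by simp [hiS j, hi]
  have hUO : i ∈ O → ∀ T : Finset (Fin n), T ∪ (O ∩ insert i A) = insert i (T ∪ (O ∩ A)) := by
    intro hO T
    ext y; simp only [Finset.mem_union, Finset.mem_inter, Finset.mem_insert]
    by_cases hy : y = i
    · subst hy; simp [hO]
    · simp [hy]
  have hUc : i ∈ O → ∑ k ∈ O ∩ insert i A, I.c k = I.c i + ∑ k ∈ O ∩ A, I.c k := by
    intro hO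
    have := hUO hO ∅
    simp only [Finset.empty_union] at this
    rw [this, Finset.sum_insert (by simp [hi])]
  have hUN : i ∉ O → O ∩ insert i A = O ∩ A := fun hO => by
    rw [Finset.inter_insert_of_notMem hO]
  have hv : ∀ j, I.v (insert i (S j ∪ (O ∩ A))) ≤ I.v (S j ∪ (O ∩ A)) + I.marg (S j) i :=
    fun j => I.v_insert_le Finset.subset_union_left (hiO j)
  unfold pairStep
  set j := I.bestSide S i with hj
  have hbest := I.marg_le_bestSide S i
  rw [← hj] at hbest
  split_ifs with hT
  · obtain ⟨-, hT1, hT2⟩ := hT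
    have hc := mul_nonneg (I.c_nonneg i) hx.le
    -- Although v need not be monotone, the cost test and c_i·x ≥ 0 force a non-negative marginal.
    have hm : 0 ≤ I.marg (S j) i := by
      by_contra hcon
      have := mul_neg_of_pos_of_neg hβB (not_le.1 hcon)
      linarith
    have hins : I.v (insert i (S j)) = I.v (S j) + I.marg (S j) i := by rw [marg]; ring
    have hval : ∀ k, I.v (S k) ≤ I.v (Function.update S j (insert i (S j)) k) := by
      intro k
      by_cases hk : k = j
      · subst hk; rw [Function.update_self, hins]; linarith
      · rw [Function.update_of_ne hk]
    refine ⟨fun k => ?_, ?_, fun k => ?_, fun k => ?_, ?_⟩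
    · by_cases hk : k = j
      · subst hk; rw [Function.update_self]; exact Finset.insert_subset_insert _ (h.subset _)
      · rw [Function.update_of_ne hk]; exact (h.subset k).trans (Finset.subset_insert _ _)
    · have := h.disjoint
      have a := hiS false
      have b := hiS true
      rcases j with _ | _
      · simp [Finset.disjoint_insert_left, this, b]
      · simp [Finset.disjoint_insert_right, this, a]
    · by_cases hk : k = j
      · rw [hk, Function.update_self, Finset.sum_insert (hiS _), hins]
        have := h.cost j
        linarith
      · rw [Function.update_of_ne hk]; exact h.cost k
    · by_cases hk : k = j
      · subst hk; rw [Function.update_self]; exact hT2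
      · rw [Function.update_of_ne hk]; exact h.le_est k
    · rcases h.bound with (⟨k, hk⟩ | hk) | hb
      · refine Or.inl (Or.inl ⟨k, hk.trans ?_⟩)
        exact mul_le_mul_of_nonneg_left (hval k) (by linarith)
      · exact Or.inl (Or.inr hk)
      · refine Or.inr fun k => ?_
        have hbk := hb k
        by_cases hk : k = j
        · have hk' : (!k) ≠ j := by rw [hk]; simp
          rw [Function.update_of_ne hk', hk, Function.update_self]
          -- For the chosen side the union gains i whether or not i ∈ O, and the increase of v(S_j)
          -- pays for it.
          have e : insert i (S j) ∪ (O ∩ insert i A) = insert i (S j ∪ (O ∩ A)) := by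
            ext y; simp only [Finset.mem_union, Finset.mem_inter, Finset.mem_insert]; tauto
          rw [e, hins]
          have h1 : β * I.B * I.v (insert i (S j ∪ (O ∩ A))) ≤
            β * I.B * (I.v (S j ∪ (O ∩ A)) + I.marg (S j) i) :=
            mul_le_mul_of_nonneg_left (hv j) hβB.le
          have h2 : x * ∑ k ∈ O ∩ A, I.c k ≤ x * ∑ k ∈ O ∩ insert i A, I.c k :=
            mul_le_mul_of_nonneg_left (Finset.sum_le_sum_of_subset_of_nonneg
              (Finset.inter_subset_inter_left (Finset.subset_insert _ _))
              fun _ _ _ => I.c_nonneg _) hx.le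
          rw [hk] at hbk
          linarith
        · have hk' : (!k) = j := by revert hk; cases k <;> cases j <;> simp
          rw [hk', Function.update_of_ne hk, Function.update_self, hins]
          rw [hk'] at hbk
          by_cases hO : i ∈ O
          · rw [hUO hO, hUc hO]
            have h1 : β * I.B * I.v (insert i (S k ∪ (O ∩ A))) ≤
              β * I.B * (I.v (S k ∪ (O ∩ A)) + I.marg (S j) i) :=
              mul_le_mul_of_nonneg_left ((hv k).trans (by linarith [hbest k])) hβB.le
            linarith
          · rw [hUN hO]
            have := mul_nonneg hβB.le hm
            linarith
  · refine ⟨fun k => (h.subset k).trans (Finset.subset_insert _ _), h.disjoint, h.cost, h.le_est,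
      ?_⟩
    rcases h.bound with hb | hb
    · exact Or.inl hb
    by_cases hO : i ∈ O
    · by_cases hc : I.c i * x ≤ β * I.B * I.marg (S j) i
      · left
        -- Only the capacity test can have failed, so v(S_j) plus the marginal exceeds x/β. One
        -- summand is at least x/(2β), and the marginal is at most v({i}).
        have h2 : x < β * I.v (insert i (S j)) := by
          by_contra hcon
          exact hT ⟨hx, hc, not_lt.1 hcon⟩
        have hins : I.v (insert i (S j)) = I.v (S j) + I.marg (S j) i := by rw [marg]; ring
        by_cases h3 : x ≤ 2 * β * I.v (S j)
        · exact Or.inl ⟨j, h3⟩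
        · refine Or.inr ⟨i, hO, ?_⟩
          have := mul_le_mul_of_nonneg_left (I.marg_le_singleton (hiS j)) hβ.le
          rw [hins] at h2
          linarith
      · right
        intro k
        rw [hUO hO, hUc hO]
        have h1 : β * I.B * I.v (insert i (S k ∪ (O ∩ A))) ≤
          β * I.B * (I.v (S k ∪ (O ∩ A)) + I.marg (S j) i) :=
          mul_le_mul_of_nonneg_left ((hv k).trans (by linarith [hbest k])) hβB.le
        have := hb k
        linarith
    · right
      rwa [hUN hO]

variable {I} in
theorem PairInv.sweep {β x : ℝ} (hβ : 0 < β) (hx : 0 < x) {O : Finset (Fin n)}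
    (l : List (Fin n)) {A : Finset (Fin n)} {S : Bool → Finset (Fin n)}
    (h : I.PairInv β x O A S) (hl : l.Nodup) (hA : ∀ i ∈ l, i ∉ A) :
    I.PairInv β x O (A ∪ l.toFinset) (I.pairSweep β x l S) := by
  induction l generalizing A S with
  | nil => simpa [pairSweep] using h
  | cons i l ih =>
    rw [List.nodup_cons] at hl
    have := ih (h.step hβ hx (hA i (by simp))) hl.2 (by
      intro k hk
      rw [Finset.mem_insert, not_or]
      exact ⟨fun e => hl.1 (e ▸ hk), hA k (List.mem_cons_of_mem _ hk)⟩)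
    rw [List.toFinset_cons, Finset.union_insert, ← Finset.insert_union]
    exact this

theorem pairInv_start {β x : ℝ} (hx : 0 < x) (O : Finset (Fin n)) :
    I.PairInv β x O ∅ fun _ => ∅ := by
  refine ⟨fun _ => Finset.Subset.refl _, by simp, ?_, ?_, Or.inr ?_⟩ <;> simp [I.v_empty, hx.le]

theorem pairInv_sweep_start {β x : ℝ} (hβ : 0 < β) (hx : 0 < x) (O : Finset (Fin n))
    {l : List (Fin n)} (hl : l.Nodup) :
    I.PairInv β x O l.toFinset (I.pairSweep β x l fun _ => ∅) := by
  simpa using (I.pairInv_start hx O).sweep hβ hx l hl (by simp)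

theorem pairSweep_of_nonpos {β x : ℝ} (hx : x ≤ 0) (l : List (Fin n))
    (S : Bool → Finset (Fin n)) : I.pairSweep β x l S = S := by
  induction l generalizing S with
  | nil => rfl
  | cons i l ih =>
    have : I.pairStep β x S i = S := if_neg fun h => absurd h.1 (not_lt.2 hx)
    rw [pairSweep, List.foldl_cons, this]
    exact ih S

/-- The invariants `cost` and `le_est` chain to c(S_j)·x ≤ βB·v(S_j) ≤ B·x. For x ≤ 0 nothing is
admitted. -/
theorem feasible_pairSweep {β : ℝ} (hβ : 0 < β) (x : ℝ) {l : List (Fin n)} (hl : l.Nodup)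
    (j : Bool) : I.Feasible (I.pairSweep β x l (fun _ => ∅) j) := by
  rcases le_or_gt x 0 with hx | hx
  · rw [pairSweep_of_nonpos I hx]
    exact I.feasible_empty
  · have h := I.pairInv_sweep_start hβ hx ∅ hl
    have h1 := h.cost j
    have h2 := mul_le_mul_of_nonneg_left (h.le_est j) I.B_pos.le
    exact le_of_mul_le_mul_right (by linarith : _ ≤ I.B * x) hx

/-- The value of the two candidate sets. -/
theorem pairSweep_value {β x : ℝ} (hβ : 0 < β) (hx : 0 < x) {O : Finset (Fin n)}
    (hO : I.Feasible O) {l : List (Fin n)} (hl : l.Nodup) (hOl : O ⊆ l.toFinset) :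
    (∃ j, x ≤ 2 * β * I.v (I.pairSweep β x l (fun _ => ∅) j)) ∨
      (∃ i ∈ O, x ≤ 2 * β * I.v {i}) ∨
      β * I.v O ≤ 2 * β * (I.v (I.pairSweep β x l (fun _ => ∅) false) +
        I.v (I.pairSweep β x l (fun _ => ∅) true)) + 2 * x := by
  have h := I.pairInv_sweep_start hβ hx O hl
  set S := I.pairSweep β x l fun _ => ∅
  rcases h.bound with (hb | hb) | hb
  · exact Or.inl hb
  · exact Or.inr (Or.inl hb)
  · right; right
    rw [Finset.inter_eq_left.2 hOl] at hb
    have h1 := hb false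
    have h2 := hb true
    simp only [Bool.not_false, Bool.not_true] at h1 h2
    -- Since the candidate sets are disjoint, the two unions meet exactly in O; the value of their
    -- union is dropped by non-negativity.
    have h3 := I.submodular (S false ∪ O) (S true ∪ O)
    rw [← Finset.inter_union_distrib_right, Finset.disjoint_iff_inter_eq_empty.1 h.disjoint,
      Finset.empty_union] at h3
    have h4 := I.v_nonneg (S false ∪ O ∪ (S true ∪ O))
    have h5 : x * ∑ i ∈ O, I.c i ≤ x * I.B := mul_le_mul_of_nonneg_left hO hx.le
    have hB := I.B_pos
    have h6 : β * I.B * I.v O ≤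
        β * I.B * (I.v (S false ∪ O) + I.v (S true ∪ O)) :=
      mul_le_mul_of_nonneg_left (by linarith) (by positivity)
    refine le_of_mul_le_mul_left ?_ hB
    linarith

/-- If the estimate is good and no single element is valuable, the sweep is successful on a good
sample. -/
theorem pairSweep_value_of_goodSample {x γ δ : ℝ}
    (hδγ : 20 * δ ≤ γ) (hδ : δ ≤ 1 / 200)
    (h : ∀ i, I.c i ≤ I.B → I.v {i} < δ * I.opt) {A : Finset (Fin n)} (hA : I.GoodSample δ A)
    {l : List (Fin n)} (hl : l.Nodup) (hAl : Aᶜ ⊆ l.toFinset) (hx : 0 < x) (hx1 : γ * I.opt ≤ x)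
    (hx2 : x ≤ I.opt) :
    min (γ / 20) (1 / 200) * I.opt ≤
      I.v (I.pairSweep 8.725 x l (fun _ => ∅) false) +
        I.v (I.pairSweep 8.725 x l (fun _ => ∅) true) := by
  obtain ⟨-, F, hF, fF, hv⟩ := hA
  have hopt : 0 < I.opt := hx.trans_le hx2
  have v0 := I.v_nonneg (I.pairSweep 8.725 x l (fun _ => ∅) false)
  have v1 := I.v_nonneg (I.pairSweep 8.725 x l (fun _ => ∅) true)
  have m1 : min (γ / 20) (1 / 200) * I.opt ≤ γ / 20 * I.opt :=
    mul_le_mul_of_nonneg_right (min_le_left _ _) hopt.le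
  have m2 : min (γ / 20) (1 / 200) * I.opt ≤ 1 / 200 * I.opt :=
    mul_le_mul_of_nonneg_right (min_le_right _ _) hopt.le
  rcases I.pairSweep_value (by norm_num : (0 : ℝ) < 8.725) hx fF hl (hF.trans hAl) with
    ⟨j, hj⟩ | ⟨i, hi, hj⟩ | hj
  · have : I.v (I.pairSweep 8.725 x l (fun _ => ∅) j) ≤
        I.v (I.pairSweep 8.725 x l (fun _ => ∅) false) +
          I.v (I.pairSweep 8.725 x l (fun _ => ∅) true) := by
      cases j <;> linarith
    linarith
  -- Impossible: 2β = 17.45 < 20, so a small element stays below x/(2β) when x ≥ γ·opt ≥ 20δ·opt.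
  · have := h i (fF.cost_le hi)
    have : 20 * δ * I.opt ≤ γ * I.opt := mul_le_mul_of_nonneg_right hδγ hopt.le
    linarith
  -- Here β > 8 matters: β(1/4 − δ/2) > 2.15 for δ ≤ 1/200. After subtracting 2x ≤ 2·opt and
  -- dividing by 2β, more than opt/200 remains.
  · have : δ * I.opt ≤ 1 / 200 * I.opt := mul_le_mul_of_nonneg_right hδ hopt.le
    linarith

end SKSInstance

namespace SKSInstance

variable {n : ℕ} (I : SKSInstance n)

/-! ### The part of an instance that has arrived -/

theorem feasible_firstArrivals (σ : Equiv.Perm (Fin n)) {k : ℕ} (hk : k ≤ n)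
    {S : Finset (Fin k)} : (I.firstArrivals σ hk).Feasible S ↔
      I.Feasible (S.map ((Fin.castLEEmb hk).trans σ.toEmbedding)) := by
  simp [Feasible, firstArrivals, Finset.sum_map]

theorem firstArrivals_opt_le (σ : Equiv.Perm (Fin n)) {k : ℕ} (hk : k ≤ n) :
    (I.firstArrivals σ hk).opt ≤ I.opt := by
  obtain ⟨S, hS, h⟩ := (I.firstArrivals σ hk).exists_opt
  rw [← h]
  exact I.le_opt ((I.feasible_firstArrivals σ hk).1 hS)

theorem le_firstArrivals_opt (σ : Equiv.Perm (Fin n)) {k : ℕ} (hk : k ≤ n)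
    {F : Finset (Fin n)} (hF : F ⊆ (firstTimes n k).map σ.toEmbedding) (fF : I.Feasible F) :
    I.v F ≤ (I.firstArrivals σ hk).opt := by
  have e : (Finset.univ.filter fun j : Fin k => σ (Fin.castLE hk j) ∈ F).map
      ((Fin.castLEEmb hk).trans σ.toEmbedding) = F := by
    ext y
    simp only [Finset.mem_map, Finset.mem_filter, Finset.mem_univ, true_and,
      Function.Embedding.trans_apply, Fin.castLEEmb_apply, Equiv.coe_toEmbedding]
    constructor
    · rintro ⟨j, h, rfl⟩; exact h
    · intro hy
      obtain ⟨t, ht, rfl⟩ := Finset.mem_map.1 (hF hy)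
      rw [mem_firstTimes] at ht
      exact ⟨⟨t, ht⟩, hy, rfl⟩
  have h : (I.firstArrivals σ hk).Feasible
      (Finset.univ.filter fun j : Fin k => σ (Fin.castLE hk j) ∈ F) := by
    rw [feasible_firstArrivals, e]; exact fF
  have := (I.firstArrivals σ hk).le_opt h
  rw [show (I.firstArrivals σ hk).v (Finset.univ.filter fun j : Fin k => σ (Fin.castLE hk j) ∈ F)
    = I.v F from congrArg I.v e] at this
  exact this

end SKSInstance

theorem mem_drop_finRange {n k : ℕ} {t : Fin n} : t ∈ (List.finRange n).drop k ↔ k ≤ (t : ℕ) := by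
  rw [List.mem_drop_iff_getElem]
  constructor
  · rintro ⟨i, hi, rfl⟩; simp
  · intro h
    refine ⟨(t : ℕ) - k, ?_, ?_⟩
    · have := t.2
      simp only [List.length_finRange]; omega
    · ext; simp [h]

theorem nodup_drop_finRange (n k : ℕ) : ((List.finRange n).drop k).Nodup :=
  (List.nodup_finRange n).sublist (List.drop_sublist _ _)

theorem compl_subset_arrivals {n : ℕ} (σ : Equiv.Perm (Fin n)) (k : ℕ) :
    ((firstTimes n k).map σ.toEmbedding)ᶜ ⊆ (((List.finRange n).drop k).map σ).toFinset := by
  intro y hy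
  rw [List.mem_toFinset, List.mem_map]
  refine ⟨σ.symm y, ?_, by simp⟩
  rw [mem_drop_finRange]
  by_contra h
  exact (Finset.mem_compl.1 hy) (Finset.mem_map.2 ⟨σ.symm y, by
    rw [mem_firstTimes]; omega, by simp⟩)

/-! ### The positions of two elements in a random order -/

theorem exists_perm_pair {α : Type*} [DecidableEq α] {a b a' b' : α} (h : a ≠ b) (h' : a' ≠ b') :
    ∃ τ : Equiv.Perm α, τ a = a' ∧ τ b = b' := by
  refine ⟨Equiv.swap (Equiv.swap a a' b) b' * Equiv.swap a a', ?_, by simp⟩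
  rw [Equiv.Perm.mul_apply, Equiv.swap_apply_left, Equiv.swap_apply_of_ne_of_ne _ h']
  intro e
  have := congrArg (Equiv.swap a a') e
  rw [Equiv.swap_apply_right, Equiv.swap_apply_self] at this
  exact h this

/-- In a random order, `j` is among the first `k` arrivals and `i` is not, with probability
`k (n - k) / (n (n - 1))`. -/
theorem card_perm_separating {n : ℕ} {i j : Fin n} (hij : i ≠ j) {k : ℕ} (hk : k ≤ n) :
    (Finset.univ.filter fun σ : Equiv.Perm (Fin n) =>
        (σ.symm j : ℕ) < k ∧ k ≤ (σ.symm i : ℕ)).card * (n * (n - 1)) =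
      k * (n - k) * Fintype.card (Equiv.Perm (Fin n)) := by
  classical
  set N : Fin n × Fin n → ℕ := fun p =>
    (Finset.univ.filter fun σ : Equiv.Perm (Fin n) => (σ.symm j, σ.symm i) = p).card with hN
  -- Right multiplication of the order permutes the positions, and the symmetric group is doubly
  -- transitive. So all pairs of distinct positions are equally frequent, and it remains to count
  -- pairs.
  have hconst : ∀ p q : Fin n × Fin n, p.1 ≠ p.2 → q.1 ≠ q.2 → N p = N q := by
    intro p q hp hq
    obtain ⟨τ, h1, h2⟩ := exists_perm_pair hp hq
    refine Finset.card_bij (fun σ _ => σ * τ⁻¹) ?_ ?_ ?_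
    · intro σ hσ
      simp only [Finset.mem_filter, Finset.mem_univ, true_and] at hσ ⊢
      have a1 : σ.symm j = p.1 := congrArg Prod.fst hσ
      have a2 : σ.symm i = p.2 := congrArg Prod.snd hσ
      refine Prod.ext ?_ ?_
      · change τ (σ.symm j) = q.1
        rw [a1, h1]
      · change τ (σ.symm i) = q.2
        rw [a2, h2]
    · intro σ _ σ' _ h
      exact mul_right_cancel h
    · intro σ hσ
      simp only [Finset.mem_filter, Finset.mem_univ, true_and] at hσ
      have a1 : σ.symm j = q.1 := congrArg Prod.fst hσ
      have a2 : σ.symm i = q.2 := congrArg Prod.snd hσ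
      refine ⟨σ * τ, ?_, by simp⟩
      simp only [Finset.mem_filter, Finset.mem_univ, true_and]
      refine Prod.ext ?_ ?_
      · change τ.symm (σ.symm j) = p.1
        rw [a1, ← h1, Equiv.symm_apply_apply]
      · change τ.symm (σ.symm i) = p.2
        rw [a2, ← h2, Equiv.symm_apply_apply]
  have hall : Fintype.card (Equiv.Perm (Fin n)) =
      ∑ p ∈ (Finset.univ : Finset (Fin n)).offDiag, N p := by
    rw [← Finset.card_univ]
    refine Finset.card_eq_sum_card_fiberwise (f := fun σ : Equiv.Perm (Fin n) =>
      (σ.symm j, σ.symm i)) ?_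
    intro σ _
    simpa using hij.symm
  have hev : (Finset.univ.filter fun σ : Equiv.Perm (Fin n) =>
      (σ.symm j : ℕ) < k ∧ k ≤ (σ.symm i : ℕ)).card =
      ∑ p ∈ firstTimes n k ×ˢ (firstTimes n k)ᶜ, N p := by
    rw [Finset.card_eq_sum_card_fiberwise (f := fun σ : Equiv.Perm (Fin n) =>
      (σ.symm j, σ.symm i)) (t := firstTimes n k ×ˢ (firstTimes n k)ᶜ)]
    · refine Finset.sum_congr rfl fun p hp => ?_
      rw [Finset.mem_product, Finset.mem_compl, mem_firstTimes, mem_firstTimes] at hp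
      rw [hN, Finset.filter_filter]
      congr 1
      ext σ
      simp only [Finset.mem_filter, Finset.mem_univ, true_and]
      constructor
      · exact fun h => h.2
      · intro h
        refine ⟨?_, h⟩
        rw [← h] at hp
        exact ⟨hp.1, not_lt.1 hp.2⟩
    · intro σ hσ
      simp only [Finset.coe_filter, Finset.mem_univ, true_and, Set.mem_ofPred_eq] at hσ
      simp only [Finset.coe_product, Set.mem_prod, Finset.mem_coe, Finset.mem_compl,
        mem_firstTimes]
      exact ⟨hσ.1, not_lt.2 hσ.2⟩
  have hp0 : ∀ p ∈ (Finset.univ : Finset (Fin n)).offDiag, N p = N (i, j) := fun p hp =>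
    hconst _ _ (by simpa using hp) hij
  have hp1 : ∀ p ∈ firstTimes n k ×ˢ (firstTimes n k)ᶜ, N p = N (i, j) := fun p hp => by
    refine hconst _ _ ?_ hij
    rw [Finset.mem_product, Finset.mem_compl] at hp
    exact fun h => hp.2 (h ▸ hp.1)
  rw [hev, hall, Finset.sum_congr rfl hp0, Finset.sum_congr rfl hp1, Finset.sum_const,
    Finset.sum_const, Finset.card_product, Finset.card_compl, card_firstTimes hk,
    Finset.offDiag_card, Finset.card_univ, Fintype.card_fin, smul_eq_mul, smul_eq_mul,
    ← Nat.mul_sub_one]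
  ring

namespace GenSm

variable {n : ℕ} (I : SKSInstance n)

/-! ### Dynkin's algorithm -/

/-- As a lexicographic order, `Better` is total, so best and second best elements are well defined
in spite of ties. -/
theorem better_iff (i j : Fin n) :
    Better I i j ↔ toLex (I.v {j}, j) ≤ toLex (I.v {i}, i) := by
  rw [Better, Prod.Lex.toLex_le_toLex]

theorem exists_best {s : Finset (Fin n)} (hs : s.Nonempty) : ∃ i ∈ s, ∀ j ∈ s, Better I i j := by
  obtain ⟨i, hi, h⟩ := s.exists_max_image (fun i => toLex (I.v {i}, i)) hs
  exact ⟨i, hi, fun j hj => (better_iff I i j).2 (h j hj)⟩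

theorem Better.antisymm {I : SKSInstance n} {i j : Fin n} (h : Better I i j) (h' : Better I j i) :
    i = j := by
  rw [better_iff] at h h'
  exact congrArg (fun p => (ofLex p).2) (le_antisymm h' h)

theorem Better.le {I : SKSInstance n} {i j : Fin n} (h : Better I i j) : I.v {j} ≤ I.v {i} := by
  rcases h with h | h
  · exact h.le
  · exact h.1.le

theorem dynkin_eq {σ : Equiv.Perm (Fin n)} {t : Fin n} (ht : Qualifies I σ t)
    (h : ∀ u < t, ¬ Qualifies I σ u) : dynkin I σ = {σ t} := by
  classical
  have : (Finset.univ.filter fun t => Qualifies I σ t ∧ ∀ u < t, ¬ Qualifies I σ u) = {t} := by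
    ext s
    simp only [Finset.mem_filter, Finset.mem_univ, true_and, Finset.mem_singleton]
    constructor
    · rintro ⟨h1, h2⟩
      rcases lt_trichotomy s t with hs | hs | hs
      · exact absurd h1 (h s hs)
      · exact hs
      · exact absurd ht (h2 t hs)
    · rintro rfl; exact ⟨ht, h⟩
  rw [dynkin]
  convert congrArg (Finset.map σ.toEmbedding) this
  exact (Finset.map_singleton σ.toEmbedding t).symm

theorem feasible_dynkin (σ : Equiv.Perm (Fin n)) : I.Feasible (dynkin I σ) := by
  classical
  by_cases h : ∃ t, Qualifies I σ t
  · obtain ⟨t, ht, hm⟩ := (Finset.univ.filter fun t => Qualifies I σ t).exists_min_image id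
      (by obtain ⟨t, ht⟩ := h; exact ⟨t, by simpa using ht⟩)
    have ht : Qualifies I σ t := by simpa using ht
    rw [dynkin_eq I ht fun u hu hq => absurd (hm u (by simpa using hq)) (not_le.2 hu),
      SKSInstance.feasible_singleton]
    exact ht.2.1
  · have : dynkin I σ = ∅ := by
      rw [dynkin, Finset.map_eq_empty, Finset.filter_eq_empty_iff]
      exact fun t _ ht => h ⟨t, ht.1⟩
    rw [this]
    exact I.feasible_empty

/-- The optimal constant of Dynkin's rule is not needed: with n/6 ≤ k ≤ n/2 the probability k(n −
k)/(n(n − 1)) is at least 1/12. For 3 ≤ n ≤ 6 the lower bound only says that the sample is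
non-empty, as e < 3. -/
theorem sample_bounds {n : ℕ} (hn : 3 ≤ n) :
    n ≤ 6 * ⌊(n : ℝ) / Real.exp 1⌋₊ ∧ 2 * ⌊(n : ℝ) / Real.exp 1⌋₊ ≤ n := by
  have e1 := Real.exp_one_gt_d9
  have e2 := Real.exp_one_lt_d9
  have hn' : (3 : ℝ) ≤ n := by exact_mod_cast hn
  have hpos : (0 : ℝ) ≤ n / Real.exp 1 := by positivity
  constructor
  · by_cases h6 : n ≤ 6
    · have : 1 ≤ ⌊(n : ℝ) / Real.exp 1⌋₊ := by
        rw [Nat.one_le_floor_iff, le_div_iff₀ (by linarith)]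
        linarith
      omega
    · have h7 : (7 : ℝ) ≤ n := by exact_mod_cast (by omega : 7 ≤ n)
      have h := Nat.lt_floor_add_one ((n : ℝ) / Real.exp 1)
      rw [div_lt_iff₀ (by linarith)] at h
      have : (n : ℝ) ≤ 6 * (⌊(n : ℝ) / Real.exp 1⌋₊ : ℝ) := by
        have h0 : (0 : ℝ) ≤ (⌊(n : ℝ) / Real.exp 1⌋₊ : ℝ) := by positivity
        nlinarith
      exact_mod_cast this
  · have h := Nat.floor_le hpos
    rw [le_div_iff₀ (by linarith)] at h
    have : 2 * (⌊(n : ℝ) / Real.exp 1⌋₊ : ℝ) ≤ n := by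
      have h0 : (0 : ℝ) ≤ (⌊(n : ℝ) / Real.exp 1⌋₊ : ℝ) := by positivity
      nlinarith
    exact_mod_cast this

/-- Dynkin's algorithm obtains a constant fraction of the most valuable element. -/
theorem dynkin_value {i₀ : Fin n} (h₀ : I.c i₀ ≤ I.B) :
    12⁻¹ * ENNReal.ofReal (I.v {i₀}) ≤ (PMF.uniformOfFintype (Equiv.Perm (Fin n))).lexp fun σ =>
      ENNReal.ofReal (I.v (dynkin I σ)) := by
  classical
  obtain ⟨i, hi, hbest⟩ := exists_best I (s := Finset.univ.filter fun i => I.c i ≤ I.B)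
    ⟨i₀, by simpa using h₀⟩
  simp only [Finset.mem_filter, Finset.mem_univ, true_and] at hi hbest
  refine (mul_le_mul_right (ENNReal.ofReal_le_ofReal (hbest i₀ h₀).le) _).trans ?_
  have hqual : ∀ σ : Equiv.Perm (Fin n), ⌊(n : ℝ) / Real.exp 1⌋₊ ≤ (σ.symm i : ℕ) →
      Qualifies I σ (σ.symm i) := by
    intro σ hσ
    refine ⟨hσ, by simpa using hi, fun s _ hs => ?_⟩
    rw [Equiv.apply_symm_apply]
    exact hbest _ hs
  -- For n ≤ 2 the sample is empty, and one of the at most two orders starts with i.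
  rcases lt_or_ge n 3 with hn | hn
  · have hk : ⌊(n : ℝ) / Real.exp 1⌋₊ = 0 := by
      rw [Nat.floor_eq_zero, div_lt_one (Real.exp_pos 1)]
      have e1 := Real.exp_one_gt_d9
      have : (n : ℝ) ≤ 2 := by exact_mod_cast (by omega : n ≤ 2)
      linarith
    have hn0 : 0 < n := i.pos
    have hd : dynkin I (Equiv.swap ⟨0, hn0⟩ i) = {i} := by
      have hs : (Equiv.swap ⟨0, hn0⟩ i).symm i = ⟨0, hn0⟩ := by simp
      rw [dynkin_eq I (hqual (Equiv.swap ⟨0, hn0⟩ i) (by simp [hk])), Equiv.apply_symm_apply]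
      intro u hu
      rw [hs] at hu
      exact absurd hu (Nat.not_lt_zero _)
    refine le_trans ?_ (PMF.le_lexp_uniform_single _ (Equiv.swap ⟨0, hn0⟩ i))
    rw [hd]
    refine mul_le_mul_left ?_ _
    rw [ENNReal.inv_le_inv, Fintype.card_perm, Fintype.card_fin]
    have : n.factorial ≤ 2 := by
      interval_cases n <;> decide
    exact_mod_cast this.trans (by norm_num)
  · obtain ⟨hk1, hk2⟩ := sample_bounds hn
    set k := ⌊(n : ℝ) / Real.exp 1⌋₊ with hk
    -- The second best affordable element, or any other element if i alone is affordable.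
    obtain ⟨j, hij, hj⟩ : ∃ j, i ≠ j ∧ ((I.c j ≤ I.B ∧ ∀ l, I.c l ≤ I.B → l ≠ i → Better I j l) ∨
        ∀ l, I.c l ≤ I.B → l = i) := by
      by_cases he : ∃ l, I.c l ≤ I.B ∧ l ≠ i
      · obtain ⟨j, hj, h⟩ := exists_best I
          (s := Finset.univ.filter fun l => I.c l ≤ I.B ∧ l ≠ i) (by
            obtain ⟨l, hl⟩ := he; exact ⟨l, by simpa using hl⟩)
        simp only [Finset.mem_filter, Finset.mem_univ, true_and] at hj h
        exact ⟨j, hj.2.symm, Or.inl ⟨hj.1, fun l h1 h2 => h l ⟨h1, h2⟩⟩⟩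
      · have : Nontrivial (Fin n) := Fin.nontrivial_iff_two_le.2 (by omega)
        obtain ⟨j, hj⟩ := exists_ne i
        refine ⟨j, hj.symm, Or.inr fun l hl => ?_⟩
        by_contra hne
        exact he ⟨l, hl, hne⟩
    -- If j is in the sample, an element other than i that qualifies would be at least as good as j,
    -- hence j itself, which came too early.
    have hev : ∀ σ : Equiv.Perm (Fin n), (σ.symm j : ℕ) < k ∧ k ≤ (σ.symm i : ℕ) →
        dynkin I σ = {i} := by
      rintro σ ⟨h1, h2⟩
      rw [dynkin_eq I (hqual σ h2), Equiv.apply_symm_apply]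
      rintro u hu ⟨q1, q2, q3⟩
      have hui : σ u ≠ i := by
        rintro rfl
        simp at hu
      rcases hj with ⟨hj1, hj2⟩ | hj
      · have b1 := q3 (σ.symm j) h1 (by simpa using hj1)
        rw [Equiv.apply_symm_apply] at b1
        have := b1.antisymm (hj2 _ q2 hui)
        rw [← this, Equiv.symm_apply_apply] at h1
        exact absurd h1 (not_lt.2 q1)
      · exact hui (hj _ q2)
    have hcard := card_perm_separating hij (k := k) (by omega)
    set E := Finset.univ.filter fun σ : Equiv.Perm (Fin n) =>
      (σ.symm j : ℕ) < k ∧ k ≤ (σ.symm i : ℕ) with hE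
    have hle : Fintype.card (Equiv.Perm (Fin n)) ≤ 12 * E.card := by
      have h1 : n * (n - 1) ≤ 12 * (k * (n - k)) := by
        have a1 : n - 1 ≤ 2 * (n - k) := by omega
        calc n * (n - 1) ≤ (6 * k) * (2 * (n - k)) := Nat.mul_le_mul hk1 a1
          _ = _ := by ring
      have hpos : 0 < n * (n - 1) := Nat.mul_pos (by omega) (by omega)
      refine Nat.le_of_mul_le_mul_right ?_ hpos
      calc Fintype.card (Equiv.Perm (Fin n)) * (n * (n - 1)) ≤
          Fintype.card (Equiv.Perm (Fin n)) * (12 * (k * (n - k))) := Nat.mul_le_mul_left _ h1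
        _ = 12 * (k * (n - k) * Fintype.card (Equiv.Perm (Fin n))) := by ring
        _ = 12 * E.card * (n * (n - 1)) := by rw [← hcard]; ring
    rw [PMF.lexp_uniform]
    set b := ENNReal.ofReal (I.v {i})
    have hsum : (E.card : ℝ≥0∞) * b ≤ ∑ σ, ENNReal.ofReal (I.v (dynkin I σ)) := by
      calc (E.card : ℝ≥0∞) * b = ∑ σ ∈ E, b := by simp
        _ = ∑ σ ∈ E, ENNReal.ofReal (I.v (dynkin I σ)) := by
          refine Finset.sum_congr rfl fun σ hσ => ?_
          rw [hev σ (by simpa [hE] using hσ)]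
        _ ≤ _ := Finset.sum_le_sum_of_subset (Finset.subset_univ _)
    have hle' : (Fintype.card (Equiv.Perm (Fin n)) : ℝ≥0∞) ≤ 12 * E.card := by exact_mod_cast hle
    calc 12⁻¹ * b = 12⁻¹ * ((Fintype.card (Equiv.Perm (Fin n)) : ℝ≥0∞)⁻¹ *
          ((Fintype.card (Equiv.Perm (Fin n)) : ℝ≥0∞) * b)) := by
          rw [← mul_assoc (_ : ℝ≥0∞)⁻¹ (Fintype.card (Equiv.Perm (Fin n)) : ℝ≥0∞),
            ENNReal.inv_mul_cancel (by simp) (by simp), one_mul]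
      _ ≤ 12⁻¹ * ((Fintype.card (Equiv.Perm (Fin n)) : ℝ≥0∞)⁻¹ * (12 * E.card * b)) := by gcongr
      _ = (Fintype.card (Equiv.Perm (Fin n)) : ℝ≥0∞)⁻¹ * (E.card * b) := by
        rw [mul_left_comm, mul_assoc, ← mul_assoc (12⁻¹ : ℝ≥0∞),
          ENNReal.inv_mul_cancel (by simp) (by simp), one_mul]
      _ ≤ _ := by gcongr

/-! ### The sweep -/

/-- The budgets are what the prices leave, and `T` consists of elements of `S`. -/
def Consistent (x : ℝ) (s : State n) : Prop :=
  (∀ j, s.budget j * x = I.B * x - beta * I.B * I.v (s.S j)) ∧ ∀ j, s.T j ⊆ s.S j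

/-- By telescoping, the remaining budget is B − βB·v(S_j)/x, so π ≤ B_j is equivalent to β·v(S_j ∪
{i}) ≤ x. The coin affects only T. -/
theorem support_step {x : ℝ} {s : State n} (hs : Consistent I x s) (i : Fin n)
    (hi : ∀ j, i ∉ s.S j) {s' : State n} (h : s' ∈ (step I x s i).support) :
    Consistent I x s' ∧ s'.S = I.pairStep beta x s.S i := by
  classical
  have hside : side I s i = I.bestSide s.S i := rfl
  have hiff : (0 < x ∧ I.c i ≤ price I x s i ∧ price I x s i ≤ s.budget (side I s i)) ↔
      I.Admits beta x s.S i (I.bestSide s.S i) := by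
    unfold SKSInstance.Admits price
    rw [hside]
    refine and_congr_right fun hx => ?_
    set m := I.marg (s.S (I.bestSide s.S i)) i with hm
    have hb := hs.1 (I.bestSide s.S i)
    have hins : I.v (insert i (s.S (I.bestSide s.S i))) = I.v (s.S (I.bestSide s.S i)) + m := by
      rw [hm, SKSInstance.marg]; ring
    have e : beta * I.B / x * m = beta * I.B * m / x := by ring
    rw [e, le_div_iff₀ hx, div_le_iff₀ hx, hb, hins]
    refine and_congr_right fun _ => ?_
    have hB := I.B_pos
    constructor
    · intro h
      refine le_of_mul_le_mul_left ?_ hB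
      linarith
    · intro h
      have := mul_le_mul_of_nonneg_left h hB.le
      linarith
  unfold step SKSInstance.pairStep at *
  by_cases hc : I.Admits beta x s.S i (I.bestSide s.S i)
  · rw [if_pos hc]
    rw [if_pos (hiff.2 hc), PMF.support_map] at h
    obtain ⟨coin, -, rfl⟩ := h
    have hx := hc.1
    refine ⟨⟨fun j => ?_, fun j => ?_⟩, rfl⟩
    · by_cases hj : j = side I s i
      · subst hj
        simp only [Function.update_self]
        rw [sub_mul, hs.1, price, SKSInstance.marg]
        field_simp
        ring
      · simp only [Function.update_of_ne hj]
        exact hs.1 j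
    · by_cases hj : j = side I s i
      · subst hj
        cases coin
        · simp only [Function.update_self]
          exact (hs.2 _).trans (Finset.subset_insert _ _)
        · simp only [Function.update_self, if_true]
          exact Finset.insert_subset_insert _ (hs.2 _)
      · cases coin
        · simp only [Function.update_of_ne hj]
          exact hs.2 j
        · simp only [Function.update_of_ne hj, if_true]
          exact hs.2 j
  · rw [if_neg hc]
    rw [if_neg (fun h' => hc (hiff.1 h')), PMF.mem_support_pure_iff] at h
    subst h
    exact ⟨hs, rfl⟩

theorem pairStep_subset (β x : ℝ) (S : Bool → Finset (Fin n)) (i : Fin n) (j : Bool) :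
    I.pairStep β x S i j ⊆ insert i (S j) := by
  classical
  unfold SKSInstance.pairStep
  split_ifs
  · by_cases hj : j = I.bestSide S i
    · rw [← hj, Function.update_self]
    · rw [Function.update_of_ne hj]; exact Finset.subset_insert _ _
  · exact Finset.subset_insert _ _

/-- No decision depends on T, so all outcomes of the randomized sweep share the candidate sets of
the deterministic one. -/
theorem support_sweep {x : ℝ} (l : List (Fin n)) (hl : l.Nodup) {s : State n}
    (hs : Consistent I x s) (hi : ∀ i ∈ l, ∀ j, i ∉ s.S j) {s' : State n}
    (h : s' ∈ (sweep I x l s).support) :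
    Consistent I x s' ∧ s'.S = I.pairSweep beta x l s.S := by
  induction l generalizing s with
  | nil =>
    rw [sweep, PMF.mem_support_pure_iff] at h
    subst h
    exact ⟨hs, rfl⟩
  | cons i l ih =>
    rw [sweep, PMF.mem_support_bind_iff] at h
    obtain ⟨s₁, h1, h2⟩ := h
    obtain ⟨c1, e1⟩ := support_step I hs i (hi i (by simp)) h1
    rw [List.nodup_cons] at hl
    obtain ⟨c2, e2⟩ := ih hl.2 c1 (by
      intro k hk j hkj
      rw [e1] at hkj
      rcases Finset.mem_insert.1 (pairStep_subset I _ _ _ _ _ hkj) with rfl | hm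
      · exact hl.1 hk
      · exact hi k (List.mem_cons_of_mem _ hk) j hm) h2
    refine ⟨c2, ?_⟩
    rw [e2, e1]
    rfl

theorem support_sweep_start {x : ℝ} {l : List (Fin n)} (hl : l.Nodup) {s : State n}
    (h : s ∈ (sweep I x l (State.start I)).support) :
    s.S = I.pairSweep beta x l (fun _ => ∅) ∧ ∀ j, s.T j ⊆ s.S j := by
  obtain ⟨h1, h2⟩ := support_sweep I l hl (s := State.start I)
    ⟨by simp [State.start, I.v_empty], by simp [State.start]⟩ (by simp [State.start]) h
  exact ⟨h2, h1.2⟩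

theorem feasible_choose {x : ℝ} {l : List (Fin n)} (hl : l.Nodup) {s : State n}
    (h : s ∈ (sweep I x l (State.start I)).support) (w : Fin 10) : I.Feasible (choose w s) := by
  obtain ⟨h1, h2⟩ := support_sweep_start I hl h
  have hS : ∀ j, I.Feasible (s.S j) := fun j => by
    rw [h1]; exact I.feasible_pairSweep (by norm_num [beta]) x hl j
  unfold choose
  split_ifs
  · exact hS _
  · exact hS _
  · exact (hS _).mono (h2 _)
  · exact (hS _).mono (h2 _)

/-! ### The approximation guarantee -/

theorem feasible_online (alg : OfflineProcedure) (σ : Equiv.Perm (Fin n)) {S : Finset (Fin n)}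
    (hS : S ∈ (online alg n I σ).support) : I.Feasible S := by
  unfold online at hS
  rw [PMF.mem_support_bind_iff] at hS
  obtain ⟨k, -, hS⟩ := hS
  split_ifs at hS with hk
  · rw [PMF.mem_support_pure_iff] at hS
    subst hS
    exact feasible_dynkin I σ
  · rw [PMF.mem_support_bind_iff] at hS
    obtain ⟨w, -, hS⟩ := hS
    rw [PMF.mem_support_bind_iff] at hS
    obtain ⟨H, -, hS⟩ := hS
    simp only [PMF.mem_support_bind_iff, PMF.support_map, Set.mem_image] at hS
    obtain ⟨D, -, s, hs, rfl⟩ := hS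
    exact feasible_choose I ((nodup_drop_finRange _ _).map σ.injective) hs w

theorem lexp_uniform_fin_two_le {m : ℕ} {i j : Fin (m + 1)} (hij : i ≠ j)
    (f : Fin (m + 1) → ℝ≥0∞) :
    ((m + 1 : ℕ) : ℝ≥0∞)⁻¹ * (f i + f j) ≤ (PMF.uniformOfFintype (Fin (m + 1))).lexp f := by
  rw [PMF.lexp_uniform, Fintype.card_fin, ← Finset.sum_pair hij]
  gcongr
  exact Finset.subset_univ _

theorem dynkin_le_online (alg : OfflineProcedure) (σ : Equiv.Perm (Fin n))
    (f : Finset (Fin n) → ℝ≥0∞) :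
    5⁻¹ * f (dynkin I σ) ≤ (online alg n I σ).lexp f := by
  rw [online, PMF.lexp_bind]
  refine le_trans ?_ (PMF.le_lexp_uniform_single _ 0)
  simp [PMF.lexp_pure]

/-- Only one sweep branch, of probability 1/5, and the returns of S_1 and S_2, of probability 1/10
each, are counted. All else is non-negative. -/
theorem sweep_le_online (alg : OfflineProcedure) (σ : Equiv.Perm (Fin n))
    (f : Finset (Fin n) → ℝ≥0∞) :
    50⁻¹ * ((PMF.uniformOfFintype (Finset (Fin n))).lexp fun H =>
      (alg H.card (I.firstArrivals σ (card_finset_fin_le H))).lexp fun D =>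
        f (I.pairSweep beta ((I.firstArrivals σ (card_finset_fin_le H)).v D)
            (((List.finRange n).drop H.card).map σ) (fun _ => ∅) false) +
          f (I.pairSweep beta ((I.firstArrivals σ (card_finset_fin_le H)).v D)
            (((List.finRange n).drop H.card).map σ) (fun _ => ∅) true)) ≤
      (online alg n I σ).lexp f := by
  rw [online, PMF.lexp_bind]
  refine le_trans ?_ (PMF.le_lexp_uniform_single _ 2)
  simp only [lt_irrefl, if_false]
  rw [PMF.lexp_bind]
  refine le_trans ?_ (mul_le_mul_right
    (lexp_uniform_fin_two_le (m := 9) (by decide : (0 : Fin 10) ≠ 1) _) _)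
  rw [← mul_assoc, PMF.lexp_bind, PMF.lexp_bind, ← PMF.lexp_add]
  refine mul_le_mul' ?_ (PMF.lexp_mono _ fun H => ?_)
  · rw [Fintype.card_fin, ← ENNReal.mul_inv (by simp) (by simp)]
    norm_num
  · rw [PMF.lexp_bind, PMF.lexp_bind, ← PMF.lexp_add]
    refine PMF.lexp_mono _ fun D => ?_
    rw [PMF.lexp_map, PMF.lexp_map, ← PMF.lexp_add]
    refine PMF.le_lexp _ fun s hs => ?_
    obtain ⟨h1, -⟩ := support_sweep_start I ((nodup_drop_finRange _ _).map σ.injective) hs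
    simp [choose, h1]

/-- The sweep on a good sample. -/
theorem lexp_sweep_value {alg : OfflineProcedure} {α : ℝ} (hα : 1 ≤ α) (halg : alg.IsApprox α)
    (h : ∀ i, I.c i ≤ I.B → I.v {i} < 1 / (200 * α) * I.opt) (σ : Equiv.Perm (Fin n))
    {k : ℕ} (hk : k ≤ n)
    (hA : I.GoodSample (1 / (200 * α)) ((firstTimes n k).map σ.toEmbedding)) :
    ENNReal.ofReal (1 / (1600 * α ^ 2) * I.opt) ≤
      (alg k (I.firstArrivals σ hk)).lexp fun D =>
        ENNReal.ofReal (I.v (I.pairSweep beta ((I.firstArrivals σ hk).v D)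
            (((List.finRange n).drop k).map σ) (fun _ => ∅) false)) +
          ENNReal.ofReal (I.v (I.pairSweep beta ((I.firstArrivals σ hk).v D)
            (((List.finRange n).drop k).map σ) (fun _ => ∅) true)) := by
  set J := I.firstArrivals σ hk with hJ
  obtain ⟨hfeas, happ⟩ := halg k J
  have hα0 : 0 < α := by linarith
  have hJI : J.opt ≤ I.opt := I.firstArrivals_opt_le σ hk
  have hIJ : I.opt ≤ 4 * J.opt := by
    obtain ⟨⟨F, hF, fF, hv⟩, -⟩ := hA
    have := I.le_firstArrivals_opt σ hk hF fF
    linarith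
  have hJ0 := J.opt_nonneg
  set c : ℝ := 1 / (200 * α) with hc
  have hc0 : 0 < c := by positivity
  set W : Finset (Fin k) → ℝ≥0∞ := fun D =>
    ENNReal.ofReal (I.v (I.pairSweep beta (J.v D)
        (((List.finRange n).drop k).map σ) (fun _ => ∅) false)) +
      ENNReal.ofReal (I.v (I.pairSweep beta (J.v D)
        (((List.finRange n).drop k).map σ) (fun _ => ∅) true)) with hW
  -- Poor estimates, with v(D) ≤ opt_J/(2α), are absorbed by the last term. For the others the sweep
  -- earns at least c·opt, which is at least c·v(D).
  have key : ∀ D ∈ (alg k J).support, ENNReal.ofReal c * ENNReal.ofReal (J.v D) ≤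
      W D + ENNReal.ofReal (c * (J.opt / (2 * α))) := by
    intro D hD
    have hx2 : J.v D ≤ J.opt := J.le_opt (hfeas D hD)
    rw [← ENNReal.ofReal_mul hc0.le]
    by_cases hx : J.v D ≤ J.opt / (2 * α)
    · exact le_add_left (ENNReal.ofReal_le_ofReal (mul_le_mul_of_nonneg_left hx hc0.le))
    · refine le_add_right ?_
      rw [not_le] at hx
      have hx0 : 0 < J.v D := lt_of_le_of_lt (by positivity) hx
      -- A good sample has opt_J ≥ opt/4, so v(D) > opt_J/(2α) yields γ = 1/(8α).
      have hγ : 1 / (8 * α) * I.opt ≤ J.v D := by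
        refine le_trans ?_ hx.le
        rw [div_mul_eq_mul_div, one_mul, div_le_div_iff₀ (by positivity) (by positivity)]
        nlinarith
      have hval := I.pairSweep_value_of_goodSample (γ := 1 / (8 * α)) (δ := c)
        (by rw [hc]
            rw [mul_one_div, div_le_div_iff₀ (by positivity) (by positivity)]
            linarith)
        (by rw [hc]; exact one_div_le_one_div_of_le (by norm_num) (by linarith)) h hA
        ((nodup_drop_finRange _ _).map σ.injective) (compl_subset_arrivals σ k) hx0 hγ
        (hx2.trans hJI)
      have hmin : c ≤ min (1 / (8 * α) / 20) (1 / 200) := by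
        refine le_min ?_ ?_
        · rw [hc, div_div]
          exact one_div_le_one_div_of_le (by positivity) (by linarith)
        · rw [hc]; exact one_div_le_one_div_of_le (by norm_num) (by linarith)
      simp only [hW]
      rw [← ENNReal.ofReal_add (I.v_nonneg _) (I.v_nonneg _)]
      refine ENNReal.ofReal_le_ofReal (le_trans ?_ hval)
      exact mul_le_mul hmin (hx2.trans hJI) hx0.le (hc0.le.trans hmin)
  have h1 := PMF.lexp_mono_support _ key
  rw [PMF.lexp_const_mul, PMF.lexp_add, PMF.lexp_const, ← J.ofReal_expect,
    ← ENNReal.ofReal_mul hc0.le] at h1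
  -- The expected value of D is at least opt_J/α. Written as two equal halves, one of them cancels
  -- without a truncated subtraction.
  have h2 : ENNReal.ofReal (c * (J.opt / (2 * α))) + ENNReal.ofReal (c * (J.opt / (2 * α))) ≤
      (alg k J).lexp W + ENNReal.ofReal (c * (J.opt / (2 * α))) := by
    refine le_trans ?_ h1
    rw [← ENNReal.ofReal_add (by positivity) (by positivity), ← mul_add]
    refine ENNReal.ofReal_le_ofReal (mul_le_mul_of_nonneg_left ?_ hc0.le)
    have : J.opt / (2 * α) + J.opt / (2 * α) = J.opt / α := by field_simp; norm_num
    rw [this, div_le_iff₀ hα0]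
    linarith
  refine le_trans (ENNReal.ofReal_le_ofReal ?_)
    ((ENNReal.add_le_add_iff_right ENNReal.ofReal_ne_top).1 h2)
  have e : c * (J.opt / (2 * α)) = 1 / (400 * α ^ 2) * J.opt := by
    rw [hc]; field_simp; ring
  rw [e]
  have : 1 / (1600 * α ^ 2) * (4 * J.opt) = 1 / (400 * α ^ 2) * J.opt := by field_simp; ring
  rw [← this]
  exact mul_le_mul_of_nonneg_left hIJ (by positivity)

end GenSm

/-- A lower bound in one of two cases gives an approximation guarantee. -/
theorem SKSInstance.opt_le_of_ofReal_le {n : ℕ} (I : SKSInstance n) (μ : PMF (Finset (Fin n)))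
    {a b : ℝ} (ha : 0 < a) (hb : 0 < b)
    (h : ENNReal.ofReal (a * I.opt) ≤ (μ.lexp fun S => ENNReal.ofReal (I.v S)) ∨
      ENNReal.ofReal (b * I.opt) ≤ (μ.lexp fun S => ENNReal.ofReal (I.v S))) :
    I.opt ≤ (1 / a + 1 / b) * I.expect μ := by
  have h0 := I.expect_nonneg μ
  rw [← I.ofReal_expect, ENNReal.ofReal_le_ofReal_iff h0, ENNReal.ofReal_le_ofReal_iff h0] at h
  have ha' : 0 ≤ 1 / a * I.expect μ := by positivity
  have hb' : 0 ≤ 1 / b * I.expect μ := by positivity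
  rw [add_mul]
  rcases h with h | h
  · have : I.opt ≤ 1 / a * I.expect μ := by
      rw [div_mul_eq_mul_div, one_mul, le_div_iff₀ ha]; linarith
    linarith
  · have : I.opt ≤ 1 / b * I.expect μ := by
      rw [div_mul_eq_mul_div, one_mul, le_div_iff₀ hb]; linarith
    linarith

/-- With a valuable element, Dynkin's rule yields 1/5 · 1/12 · 1/(200α) of opt. Otherwise the sweep
yields 1/50 · 1/4 · 1/(1600α²). The sum of the reciprocals covers both cases. -/
theorem GenSm.isSecretaryApprox_online {α : ℝ} (hα : 1 ≤ α) {alg : OfflineProcedure}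
    (halg : alg.IsApprox α) :
    IsSecretaryApprox (1 / (1 / (12000 * α)) + 1 / (1 / (320000 * α ^ 2))) (GenSm.online alg) := by
  classical
  intro n I
  have hα0 : 0 < α := by linarith
  refine ⟨fun σ S hS => GenSm.feasible_online I alg σ hS,
    I.opt_le_of_ofReal_le _ (by positivity) (by positivity) ?_⟩
  rw [PMF.lexp_bind]
  by_cases h : ∀ i, I.c i ≤ I.B → I.v {i} < 1 / (200 * α) * I.opt
  · right
    have h4 := I.quarter_le_goodSample (δ := 1 / (200 * α)) (by positivity)
      (fun i hi => (h i hi).le) (ENNReal.ofReal (1 / (1600 * α ^ 2) * I.opt))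
    rw [← lexp_sample] at h4
    calc ENNReal.ofReal (1 / (320000 * α ^ 2) * I.opt)
        = 50⁻¹ * (4⁻¹ * ENNReal.ofReal (1 / (1600 * α ^ 2) * I.opt)) := by
          rw [← mul_assoc, ← ENNReal.mul_inv (by simp) (by simp),
            show ((50 : ℝ≥0∞) * 4)⁻¹ = ENNReal.ofReal (200⁻¹) by
              rw [ENNReal.ofReal_inv_of_pos (by norm_num)]; norm_num,
            ← ENNReal.ofReal_mul (by norm_num)]
          congr 1
          field_simp
          ring
      _ ≤ _ := mul_le_mul_right h4 _
      _ = _ := (PMF.lexp_const_mul _ _ _).symm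
      _ ≤ _ := by
        refine PMF.lexp_mono _ fun σ => ?_
        refine le_trans (mul_le_mul_right ?_ _) (GenSm.sweep_le_online I alg σ _)
        refine PMF.lexp_mono _ fun H => ?_
        split_ifs with hA
        · exact GenSm.lexp_sweep_value I hα halg h σ (card_finset_fin_le H) hA
        · exact zero_le
  · left
    push Not at h
    obtain ⟨i, hi, hv⟩ := h
    calc ENNReal.ofReal (1 / (12000 * α) * I.opt)
        = 5⁻¹ * (12⁻¹ * ENNReal.ofReal (1 / (200 * α) * I.opt)) := by
          rw [← mul_assoc, ← ENNReal.mul_inv (by simp) (by simp),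
            show ((5 : ℝ≥0∞) * 12)⁻¹ = ENNReal.ofReal (60⁻¹) by
              rw [ENNReal.ofReal_inv_of_pos (by norm_num)]; norm_num,
            ← ENNReal.ofReal_mul (by norm_num)]
          congr 1
          field_simp
          ring
      _ ≤ 5⁻¹ * (12⁻¹ * ENNReal.ofReal (I.v {i})) := by gcongr
      _ ≤ _ := mul_le_mul_right (GenSm.dynkin_value I hi) _
      _ = _ := (PMF.lexp_const_mul _ _ _).symm
      _ ≤ _ := PMF.lexp_mono _ fun σ => GenSm.dynkin_le_online I alg σ _

/-! ### Running times -/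

namespace Prog

/-- A bound on the number of steps of a program all of whose loops run `n` times, as a polynomial
in `n`. -/
noncomputable def cost : Prog → Polynomial ℕ
  | .skip => 1
  | .nset _ i e => Polynomial.C (i.size + e.size + 1)
  | .rset _ i e => Polynomial.C (i.size + e.size + 1)
  | .query _ i _ => Polynomial.C (i.size + 1)
  | .rand _ i e => Polynomial.C (i.size + e.size + 1)
  | .seq p q => p.cost + q.cost
  | .ite t p q => Polynomial.C t.size + p.cost + q.cost
  | .loop e p => Polynomial.C (e.size + 1) + Polynomial.X * p.cost

/-- The program never writes to the natural array `0`, and its loops run as often as entry `0` of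
this array says. -/
def Tame : Prog → Prop
  | .skip => True
  | .nset k _ _ => k ≠ 0
  | .rset _ _ _ => True
  | .query _ _ _ => True
  | .rand k _ _ => k ≠ 0
  | .seq p q => p.Tame ∧ q.Tame
  | .ite _ p q => p.Tame ∧ q.Tame
  | .loop e p => e = .get 0 (.lit 0) ∧ p.Tame

theorem support_iterM {orc : (ℕ → ℕ) → ℝ} {p : Prog} {N b : ℕ}
    (hp : ∀ m : Mem, m.nat 0 0 = N → ∀ m' ∈ (p.exec orc m).support,
      m'.nat 0 = m.nat 0 ∧ m'.steps ≤ m.steps + b) (k : ℕ) (m : Mem) (hm : m.nat 0 0 = N) :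
    ∀ m' ∈ (iterM (p.exec orc) k m).support,
      m'.nat 0 = m.nat 0 ∧ m'.steps ≤ m.steps + k * b := by
  induction k generalizing m with
  | zero =>
    intro m' h
    rw [iterM, PMF.mem_support_pure_iff] at h
    subst h
    simp
  | succ k ih =>
    intro m' h
    rw [iterM, PMF.mem_support_bind_iff] at h
    obtain ⟨m₁, h1, h2⟩ := h
    obtain ⟨a1, a2⟩ := hp m hm m₁ h1
    obtain ⟨b1, b2⟩ := ih m₁ (by rw [a1, hm]) m' h2
    refine ⟨b1.trans a1, ?_⟩
    rw [Nat.succ_mul]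
    omega

/-- As array 0 is never written, the loop count stays the same throughout, and a loop multiplies the
bound of its body by it. -/
theorem support_exec {orc : (ℕ → ℕ) → ℝ} {p : Prog} (hp : p.Tame) (m : Mem) :
    ∀ m' ∈ (p.exec orc m).support,
      m'.nat 0 = m.nat 0 ∧ m'.steps ≤ m.steps + p.cost.eval (m.nat 0 0) := by
  induction p generalizing m with
  | skip =>
    intro m' h
    rw [exec, PMF.mem_support_pure_iff] at h
    subst h
    simp [Mem.tick, cost]
  | nset k i e =>
    intro m' h
    rw [exec, PMF.mem_support_pure_iff] at h
    subst h
    exact ⟨by simp [Mem.tick, Mem.setNat, Function.update_of_ne (Ne.symm hp)],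
      by simp [Mem.tick, Mem.setNat, cost]⟩
  | rset k i e =>
    intro m' h
    rw [exec, PMF.mem_support_pure_iff] at h
    subst h
    simp [Mem.tick, Mem.setReal, cost]
  | query k i j =>
    intro m' h
    rw [exec, PMF.mem_support_pure_iff] at h
    subst h
    simp [Mem.tick, Mem.setReal, cost]
  | rand k i e =>
    intro m' h
    rw [exec, PMF.mem_support_bind_iff] at h
    obtain ⟨r, -, h⟩ := h
    rw [PMF.mem_support_pure_iff] at h
    subst h
    exact ⟨by simp [Mem.tick, Mem.setNat, Function.update_of_ne (Ne.symm hp)],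
      by simp [Mem.tick, Mem.setNat, cost]⟩
  | seq p q ihp ihq =>
    intro m' h
    rw [exec, PMF.mem_support_bind_iff] at h
    obtain ⟨m₁, h1, h2⟩ := h
    obtain ⟨a1, a2⟩ := ihp hp.1 m m₁ h1
    obtain ⟨b1, b2⟩ := ihq hp.2 m₁ m' h2
    rw [a1] at b2
    refine ⟨b1.trans a1, ?_⟩
    rw [cost, Polynomial.eval_add]
    omega
  | ite t p q ihp ihq =>
    intro m' h
    rw [exec] at h
    rw [cost, Polynomial.eval_add, Polynomial.eval_add, Polynomial.eval_C]
    split_ifs at h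
    · obtain ⟨a1, a2⟩ := ihp hp.1 (m.tick t.size) m' h
      simp only [Mem.tick] at a1 a2
      exact ⟨a1, by omega⟩
    · obtain ⟨a1, a2⟩ := ihq hp.2 (m.tick t.size) m' h
      simp only [Mem.tick] at a1 a2
      exact ⟨a1, by omega⟩
  | loop e p ih =>
    intro m' h
    obtain ⟨rfl, hp⟩ := hp
    rw [exec] at h
    obtain ⟨a1, a2⟩ := support_iterM (orc := orc) (p := p) (N := m.nat 0 0)
      (b := p.cost.eval (m.nat 0 0)) (fun m₁ h₁ m₂ h₂ => by rw [← h₁]; exact ih hp m₁ m₂ h₂) _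
      (m.tick _) rfl m' h
    refine ⟨a1, ?_⟩
    simp only [Mem.tick, NExp.eval] at a2
    simp only [cost, Polynomial.eval_add, Polynomial.eval_C, Polynomial.eval_mul,
      Polynomial.eval_X]
    omega

end Prog

theorem OnlineAlgorithm.support_runFrom (P : OnlineAlgorithm) (h : P.onArrival.Tame) {n : ℕ}
    (I : SKSInstance n) (σ : Equiv.Perm (Fin n)) (l : List (Fin n)) (m : Mem)
    (acc : Finset (Fin n)) : ∀ r ∈ (P.runFrom I σ l m acc).support,
      r.1.steps ≤ m.steps + l.length * P.onArrival.cost.eval (m.nat 0 0) := by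
  induction l generalizing m acc with
  | nil =>
    intro r hr
    rw [runFrom, PMF.mem_support_pure_iff] at hr
    subst hr
    simp
  | cons t l ih =>
    intro r hr
    rw [runFrom, PMF.mem_support_bind_iff] at hr
    obtain ⟨m', h1, h2⟩ := hr
    obtain ⟨a1, a2⟩ := Prog.support_exec h _ m' h1
    have a3 : (present m t (I.c (σ t))).nat 0 = m.nat 0 := by
      simp [present, Mem.setNat, Mem.setReal]
    have a4 : (present m t (I.c (σ t))).steps = m.steps := rfl
    have h3 := ih m' _ r h2
    rw [a1, a3] at h3
    rw [a3, a4] at a2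
    rw [List.length_cons, Nat.succ_mul]
    omega

theorem OnlineAlgorithm.polynomialTime (P : OnlineAlgorithm) (h1 : P.setup.Tame)
    (h2 : P.onArrival.Tame) : P.PolynomialTime := by
  refine ⟨P.setup.cost + Polynomial.X * P.onArrival.cost, fun n I σ r hr => ?_⟩
  rw [run, PMF.mem_support_bind_iff] at hr
  obtain ⟨m, hm, hr⟩ := hr
  obtain ⟨a1, a2⟩ := Prog.support_exec h1 _ m hm
  have e1 : (initialMem n I.B).nat 0 0 = n := by simp [initialMem, Mem.setNat, Mem.setReal]
  have e2 : (initialMem n I.B).steps = 0 := rfl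
  have h3 := P.support_runFrom h2 I σ _ m ∅ r hr
  rw [e1, e2] at a2
  rw [a1, e1, List.length_finRange] at h3
  simp only [Polynomial.eval_add, Polynomial.eval_mul, Polynomial.eval_X]
  omega

/-! ### Programs without random choices -/

namespace Mem

@[simp] theorem nat_tick (m : Mem) (t : ℕ) : (m.tick t).nat = m.nat := rfl

@[simp] theorem real_tick (m : Mem) (t : ℕ) : (m.tick t).real = m.real := rfl

@[simp] theorem nat_setReal (m : Mem) (k i : ℕ) (x : ℝ) : (m.setReal k i x).nat = m.nat := rfl

@[simp] theorem real_setNat (m : Mem) (k i x : ℕ) : (m.setNat k i x).real = m.real := rfl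

theorem nat_setNat (m : Mem) (k i x k' : ℕ) :
    (m.setNat k i x).nat k' = if k' = k then Function.update (m.nat k) i x else m.nat k' := by
  simp only [setNat, Function.update_apply]

theorem real_setReal (m : Mem) (k i : ℕ) (x : ℝ) (k' : ℕ) :
    (m.setReal k i x).real k' = if k' = k then Function.update (m.real k) i x else m.real k' := by
  simp only [setReal, Function.update_apply]

end Mem

namespace Prog

open Classical in
/-- The memory after the execution of a program that makes no random choices. -/
noncomputable def det (orc : (ℕ → ℕ) → ℝ) : Prog → Mem → Mem
  | .skip, m => m.tick 1
  | .nset k i e, m => (m.setNat k (i.eval m) (e.eval m)).tick (i.size + e.size + 1)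
  | .rset k i e, m => (m.setReal k (i.eval m) (e.eval m)).tick (i.size + e.size + 1)
  | .query k i j, m => (m.setReal k (i.eval m) (orc (m.nat j))).tick (i.size + 1)
  -- A dummy value: `exec_eq_pure` excludes this case.
  | .rand _ _ _, m => m
  | .seq p q, m => q.det orc (p.det orc m)
  | .ite t p q, m =>
      if t.Holds m then p.det orc (m.tick t.size) else q.det orc (m.tick t.size)
  | .loop e p, m => (p.det orc)^[e.eval m] (m.tick (e.size + 1))

theorem det_seq (orc : (ℕ → ℕ) → ℝ) (p q : Prog) (m : Mem) :
    (seq p q).det orc m = q.det orc (p.det orc m) := rfl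

/-- The program makes no random choices. -/
def RandFree : Prog → Prop
  | .rand _ _ _ => False
  | .seq p q => p.RandFree ∧ q.RandFree
  | .ite _ p q => p.RandFree ∧ q.RandFree
  | .loop _ p => p.RandFree
  | _ => True

/-- This removes probability from the verification of arrivals, whose program makes no random
choices. -/
theorem exec_eq_pure {orc : (ℕ → ℕ) → ℝ} {p : Prog} (hp : p.RandFree) (m : Mem) :
    p.exec orc m = PMF.pure (p.det orc m) := by
  induction p generalizing m with
  | skip => rfl
  | nset k i e => rfl
  | rset k i e => rfl
  | query k i j => rfl
  | rand k i e => exact hp.elim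
  | seq p q ihp ihq =>
    rw [exec, ihp hp.1, PMF.pure_bind, ihq hp.2]
    rfl
  | ite t p q ihp ihq =>
    rw [exec, det]
    split_ifs
    · exact ihp hp.1 _
    · exact ihq hp.2 _
  | loop e p ih =>
    rw [exec, det]
    generalize m.tick (e.size + 1) = m'
    generalize e.eval m = k
    induction k generalizing m' with
    | zero => rfl
    | succ k ihk => rw [iterM, ih hp, PMF.pure_bind, ihk, Function.iterate_succ_apply]

/-- The natural arrays that a program may change. -/
def natWrites : Prog → List ℕ
  | .nset k _ _ => [k]
  | .rand k _ _ => [k]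
  | .seq p q => p.natWrites ++ q.natWrites
  | .ite _ p q => p.natWrites ++ q.natWrites
  | .loop _ p => p.natWrites
  | _ => []

/-- The real arrays that a program may change. -/
def realWrites : Prog → List ℕ
  | .rset k _ _ => [k]
  | .query k _ _ => [k]
  | .seq p q => p.realWrites ++ q.realWrites
  | .ite _ p q => p.realWrites ++ q.realWrites
  | .loop _ p => p.realWrites
  | _ => []

/-- A frame rule. For a concrete program the hypothesis is decidable, so persistence of registers is
settled by evaluation. -/
theorem nat_det {orc : (ℕ → ℕ) → ℝ} {p : Prog} {k : ℕ} (hk : k ∉ p.natWrites) (m : Mem) :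
    (p.det orc m).nat k = m.nat k := by
  induction p generalizing m with
  | nset j i e =>
    have : k ≠ j := by simpa [natWrites] using hk
    simp [det, Mem.nat_setNat, this]
  | seq p q ihp ihq =>
    simp only [natWrites, List.mem_append, not_or] at hk
    rw [det, ihq hk.2, ihp hk.1]
  | ite t p q ihp ihq =>
    simp only [natWrites, List.mem_append, not_or] at hk
    rw [det]
    split_ifs
    · rw [ihp hk.1]; rfl
    · rw [ihq hk.2]; rfl
  | loop e p ih =>
    rw [det]
    generalize e.eval m = l
    rw [show m.nat k = (m.tick (e.size + 1)).nat k from rfl]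
    generalize m.tick (e.size + 1) = m'
    induction l generalizing m' with
    | zero => rfl
    | succ l ihl => rw [Function.iterate_succ_apply, ihl, ih hk]
  | _ => rfl

theorem real_det {orc : (ℕ → ℕ) → ℝ} {p : Prog} {k : ℕ} (hk : k ∉ p.realWrites) (m : Mem) :
    (p.det orc m).real k = m.real k := by
  induction p generalizing m with
  | rset j i e =>
    have : k ≠ j := by simpa [realWrites] using hk
    simp [det, Mem.real_setReal, this]
  | query j i e =>
    have : k ≠ j := by simpa [realWrites] using hk
    simp [det, Mem.real_setReal, this]
  | seq p q ihp ihq =>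
    simp only [realWrites, List.mem_append, not_or] at hk
    rw [det, ihq hk.2, ihp hk.1]
  | ite t p q ihp ihq =>
    simp only [realWrites, List.mem_append, not_or] at hk
    rw [det]
    split_ifs
    · rw [ihp hk.1]; rfl
    · rw [ihq hk.2]; rfl
  | loop e p ih =>
    rw [det]
    generalize e.eval m = l
    rw [show m.real k = (m.tick (e.size + 1)).real k from rfl]
    generalize m.tick (e.size + 1) = m'
    induction l generalizing m' with
    | zero => rfl
    | succ l ihl => rw [Function.iterate_succ_apply, ihl, ih hk]
  | _ => rfl

/-- An invariant of a loop. -/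
theorem det_loop {orc : (ℕ → ℕ) → ℝ} {e : NExp} {p : Prog} {N : ℕ} (Q : ℕ → Mem → Prop) (m : Mem)
    (he : e.eval m = N) (h0 : Q 0 (m.tick (e.size + 1)))
    (hs : ∀ k < N, ∀ m, Q k m → Q (k + 1) (p.det orc m)) : Q N ((loop e p).det orc m) := by
  rw [det, he]
  generalize m.tick (e.size + 1) = m' at h0
  have : ∀ k ≤ N, Q k ((p.det orc)^[k] m') := by
    intro k
    induction k with
    | zero => exact fun _ => h0
    | succ k ih =>
      intro hk
      rw [Function.iterate_succ_apply']
      exact hs k (by omega) _ (ih (by omega))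
  exact this N le_rfl

end Prog

namespace Secretary

/-! ### The program

Registers are entries `0` of arrays.  Natural arrays: `3` sample size, `4` mode, `6` a flag that is
set when the Dynkin mode has accepted, `7` the element that is processed, `10` and `11` the two
candidate sets, `12` an empty set, `13` and `14` flags for an addition to a candidate set.  Real
arrays: `3` the best value of an element of the sample, `4` the value of the arriving element, `5`
and `6` the values of the candidate sets, `7` and `8` their values with the current element added,
`9` the estimate of the optimum, `10` a guess of the optimum, `11` the best value found offline. -/

abbrev natReg (k : ℕ) : NExp := .get k (.lit 0)

abbrev realReg (k : ℕ) : RExp := .get k (.lit 0)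

/-- Stores in `Q` the value of the set `S` with the current element added. -/
def trialProg (S Q : ℕ) : Prog :=
  .seq (.nset S (natReg 7) (.lit 1)) (.seq (.query Q (.lit 0) S) (.nset S (natReg 7) (.lit 0)))

/-- Adds the current element to the candidate set `S` of value `V`, if it is admitted. -/
def admitProg (S V Q F : ℕ) : Prog :=
  .ite (.rle (realReg 9) (.lit 1) (.lit 0) (.lit 1)) .skip
    -- The test c_i ≤ π is multiplied by x > 0 to avoid the division; 349/40 is β.
    (.ite (.rle (.get 1 (natReg 7)) (realReg 9) (.smul (349 / 40) (realReg 0))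
        (.sub (realReg Q) (realReg V)))
      (.ite (.rle (.smul (349 / 40) (realReg Q)) (.lit 1) (realReg 9) (.lit 1))
        (.seq (.nset S (natReg 7) (.lit 1))
          (.seq (.rset V (.lit 0) (realReg Q)) (.nset F (.lit 0) (.lit 1))))
        .skip) .skip)

/-- Clears the flags for additions. -/
def clearProg : Prog := .seq (.nset 13 (.lit 0) (.lit 0)) (.nset 14 (.lit 0) (.lit 0))

/-- One step of the sweep with two candidate sets. -/
def pairProg : Prog :=
  .seq (trialProg 10 7) (.seq (trialProg 11 8)
    (.seq clearProg
      (.ite (.rle (.sub (realReg 8) (realReg 6)) (.lit 1) (.sub (realReg 7) (realReg 5)) (.lit 1))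
        (admitProg 10 5 7 13) (admitProg 11 6 8 14))))

/-- Executes `p` for all elements. -/
def forAll (p : Prog) : Prog :=
  .seq (.nset 7 (.lit 0) (.lit 0))
    (.loop (natReg 0) (.seq p (.nset 7 (.lit 0) (.add (natReg 7) (.lit 1)))))

/-- Makes the candidate sets empty. -/
def resetProg : Prog :=
  .seq (.rset 5 (.lit 0) (.lit 0)) (.seq (.rset 6 (.lit 0) (.lit 0))
    (forAll (.seq (.nset 10 (natReg 7) (.lit 0)) (.nset 11 (natReg 7) (.lit 0)))))

/-- The sweep through the sample. -/
def sampleSweep : Prog :=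
  .seq resetProg (forAll (.ite (.nle (.add (natReg 7) (.lit 1)) (natReg 3)) pairProg .skip))

/-- Replaces register `11` by the maximum of registers `11` and `V`. -/
def maxProg (V : ℕ) : Prog :=
  .ite (.rle (realReg 11) (.lit 1) (realReg V) (.lit 1)) (.rset 11 (.lit 0) (realReg V)) .skip

/-- The sweep through the sample for one guess. -/
def guessProg : Prog :=
  .seq (.rset 9 (.lit 0) (realReg 10)) (.seq sampleSweep (.seq (maxProg 5) (.seq (maxProg 6)
    (.rset 10 (.lit 0) (.smul 2 (realReg 10))))))

/-- Computes the estimate of the optimum from the sample. -/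
def offlineProg : Prog :=
  .seq (.rset 10 (.lit 0) (realReg 3)) (.seq (.rset 11 (.lit 0) (realReg 3))
    (.seq (.loop (natReg 0) guessProg) (.seq (.rset 9 (.lit 0) (realReg 11)) resetProg)))

/-- Evaluates the arriving element. -/
def headProg : Prog :=
  .seq (.nset 2 (.lit 0) (.lit 0)) (.seq (.nset 7 (.lit 0) (natReg 1)) (trialProg 12 4))

/-- An arrival in the sample. -/
def sampleProg : Prog :=
  .ite (.rle (.get 1 (natReg 7)) (.lit 1) (realReg 0) (.lit 1))
    (.ite (.rle (realReg 3) (.lit 1) (realReg 4) (.lit 1)) (.rset 3 (.lit 0) (realReg 4)) .skip)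
    .skip

/-- An arrival after the sample in the Dynkin mode. -/
def dynkinProg (q : ℚ) : Prog :=
  .ite (.nle (natReg 6) (.lit 0))
    (.ite (.rle (.get 1 (natReg 7)) (.lit 1) (realReg 0) (.lit 1))
      (.ite (.rle (realReg 4) (.lit 1) (.smul q (realReg 3)) (.lit 1)) .skip
        (.seq (.nset 2 (.lit 0) (.lit 1)) (.nset 6 (.lit 0) (.lit 1)))) .skip) .skip

/-- An arrival after the sample in the sweep mode. -/
def sweepProg : Prog :=
  -- Before time ξ this program is not run, so the test singles out the first arrival after the
  -- sample.
  .seq (.ite (.nle (natReg 1) (natReg 3)) offlineProg .skip)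
    (.seq (.nset 7 (.lit 0) (natReg 1)) (.seq pairProg
      (.ite (.nle (natReg 4) (.lit 2)) (.nset 2 (.lit 0) (natReg 13))
        (.nset 2 (.lit 0) (natReg 14)))))

/-- Modes 0 and 1 are threshold rules with factors 1 and 1/2, the second one for ties between the
best elements. Modes 2 and 3 build both candidate sets but accept only the additions to one of them.
-/
def arrivalProg : Prog :=
  .seq headProg (.ite (.nle (.add (natReg 1) (.lit 1)) (natReg 3)) sampleProg
    (.ite (.nle (natReg 4) (.lit 0)) (dynkinProg 1)
      (.ite (.nle (natReg 4) (.lit 1)) (dynkinProg (1 / 2)) sweepProg)))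

/-- One fair coin flip. -/
def coinProg : Prog :=
  .seq (.rand 5 (.lit 0) (.lit 1)) (.nset 3 (.lit 0) (.add (natReg 3) (natReg 5)))

def setupProg : Prog :=
  .seq (.loop (natReg 0) coinProg) (.rand 4 (.lit 0) (.lit 3))

def algorithm : OnlineAlgorithm where
  setup := setupProg
  onArrival := arrivalProg

theorem polynomialTime_algorithm : algorithm.PolynomialTime := by
  refine algorithm.polynomialTime ?_ ?_
  · simp [algorithm, setupProg, coinProg, Prog.Tame]
  · simp [algorithm, arrivalProg, headProg, trialProg, sampleProg, dynkinProg, sweepProg,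
      offlineProg, guessProg, maxProg, sampleSweep, resetProg, forAll, pairProg, clearProg, admitProg,
      Prog.Tame]

theorem randFree_arrivalProg : arrivalProg.RandFree := by
  simp [arrivalProg, headProg, trialProg, sampleProg, dynkinProg, sweepProg,
    offlineProg, guessProg, maxProg, sampleSweep, resetProg, forAll, pairProg, clearProg, admitProg,
    Prog.RandFree]

/-! ### The sweep with two candidate sets -/

variable {n : ℕ} {J : SKSInstance n} {a ξ : ℕ} {orc : (ℕ → ℕ) → ℝ} {m : Mem}

/-- The oracle knows the values of the sets of elements before time `a`. -/
def Answers (orc : (ℕ → ℕ) → ℝ) (J : SKSInstance n) (a : ℕ) : Prop :=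
  ∀ (f : ℕ → ℕ) (T : Finset (Fin n)), (∀ t : Fin n, f t ≠ 0 ↔ t ∈ T) → (∀ t ∈ T, (t : ℕ) < a) →
    orc f = J.v T

/-- The array is the indicator function of the set. -/
def IsIndicator (f : ℕ → ℕ) (T : Finset (Fin n)) : Prop :=
  ∀ t : Fin n, f t = if t ∈ T then 1 else 0

theorem IsIndicator.insert {f : ℕ → ℕ} {T : Finset (Fin n)} (h : IsIndicator f T) (i : Fin n) :
    IsIndicator (Function.update f i 1) (insert i T) := by
  intro t
  by_cases ht : t = i
  · subst ht; simp
  · rw [Function.update_of_ne (fun e => ht (Fin.ext e)), h t]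
    simp [ht]

theorem Answers.eq (h : Answers orc J a) {f : ℕ → ℕ} {T : Finset (Fin n)}
    (hf : IsIndicator f T) (hT : ∀ t ∈ T, (t : ℕ) < a) : orc f = J.v T :=
  h f T (fun t => by rw [hf t]; by_cases ht : t ∈ T <;> simp [ht]) hT

/-- The data of the instance that the program has received before time `a`. -/
structure Ctx (J : SKSInstance n) (a ξ : ℕ) (m : Mem) : Prop where
  size : m.nat 0 0 = n
  sample : m.nat 3 0 = ξ
  budget : m.real 0 0 = J.B
  cost : ∀ t : Fin n, (t : ℕ) < a → m.real 1 t = J.c t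

/-- The program leaves the data of the instance alone. -/
def Spares (p : Prog) : Prop :=
  (0 ∉ p.natWrites ∧ 3 ∉ p.natWrites) ∧ 0 ∉ p.realWrites ∧ 1 ∉ p.realWrites

instance (p : Prog) : Decidable (Spares p) := inferInstanceAs (Decidable (_ ∧ _))

theorem Ctx.congr (h : Ctx J a ξ m) {m' : Mem} (h0 : m'.nat 0 = m.nat 0) (h3 : m'.nat 3 = m.nat 3)
    (r0 : m'.real 0 = m.real 0) (r1 : m'.real 1 = m.real 1) : Ctx J a ξ m' :=
  ⟨by rw [h0, h.size], by rw [h3, h.sample], by rw [r0, h.budget],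
    fun t ht => by rw [r1, h.cost t ht]⟩

theorem Ctx.tick (h : Ctx J a ξ m) (t : ℕ) : Ctx J a ξ (m.tick t) := h.congr rfl rfl rfl rfl

theorem Ctx.det (h : Ctx J a ξ m) {p : Prog} (hp : Spares p) : Ctx J a ξ (p.det orc m) :=
  h.congr (Prog.nat_det hp.1.1 m) (Prog.nat_det hp.1.2 m) (Prog.real_det hp.2.1 m)
    (Prog.real_det hp.2.2 m)

/-- The candidate sets in the memory are `S`. -/
structure Rep (J : SKSInstance n) (m : Mem) (S : Bool → Finset (Fin n)) : Prop where
  ind_false : IsIndicator (m.nat 10) (S false)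
  ind_true : IsIndicator (m.nat 11) (S true)
  val_false : m.real 5 0 = J.v (S false)
  val_true : m.real 6 0 = J.v (S true)

theorem Rep.congr {S : Bool → Finset (Fin n)} (h : Rep J m S) {m' : Mem}
    (h10 : m'.nat 10 = m.nat 10) (h11 : m'.nat 11 = m.nat 11) (h5 : m'.real 5 = m.real 5)
    (h6 : m'.real 6 = m.real 6) : Rep J m' S :=
  ⟨by rw [h10]; exact h.ind_false, by rw [h11]; exact h.ind_true, by rw [h5, h.val_false],
    by rw [h6, h.val_true]⟩

theorem Rep.tick {S : Bool → Finset (Fin n)} (h : Rep J m S) (t : ℕ) : Rep J (m.tick t) S :=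
  h.congr rfl rfl rfl rfl

/-- The bit of i is set for the query and cleared again. As i ∉ T it was zero before, so the natural
arrays are restored. -/
theorem det_trialProg (ho : Answers orc J a) {S Q : ℕ} (hS : S ≠ 7) {i : Fin n} (hia : (i : ℕ) < a)
    (hi : m.nat 7 0 = i) {T : Finset (Fin n)} (hT : IsIndicator (m.nat S) T) (hiT : i ∉ T)
    (hTa : ∀ t ∈ T, (t : ℕ) < a) :
    ((trialProg S Q).det orc m).nat = m.nat ∧ ((trialProg S Q).det orc m).real =
      Function.update m.real Q (Function.update (m.real Q) 0 (J.v (insert i T))) := by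
  have h0 : m.nat S i = 0 := by rw [hT i, if_neg hiT]
  have e : orc (Function.update (m.nat S) i 1) = J.v (insert i T) :=
    ho.eq (hT.insert i) (by
      intro t ht
      rcases Finset.mem_insert.1 ht with rfl | ht
      · exact hia
      · exact hTa t ht)
  constructor
  · funext k
    simp only [trialProg, Prog.det, NExp.eval, Mem.nat_tick, Mem.nat_setReal, Mem.nat_setNat]
    simp only [hS.symm, if_false, if_true, hi]
    by_cases hk : k = S
    · subst hk
      simp [h0]
    · simp [hk]
  · simp only [trialProg, Prog.det, NExp.eval, Mem.nat_tick, Mem.real_tick, Mem.real_setNat,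
      Mem.nat_setNat, Mem.setReal, if_true, hi, e]

theorem det_admitProg {S V Q F : ℕ} (hF : F ≠ S) (orc : (ℕ → ℕ) → ℝ) {c x B q v : ℝ}
    {i : ℕ} (hi : m.nat 7 0 = i) (hc : m.real 1 i = c) (hx : m.real 9 0 = x)
    (hB : m.real 0 0 = B) (hq : m.real Q 0 = q) (hv : m.real V 0 = v) :
    (0 < x ∧ c * x ≤ 8.725 * B * (q - v) ∧ 8.725 * q ≤ x ∧
      ((admitProg S V Q F).det orc m).nat = Function.update
        (Function.update m.nat S (Function.update (m.nat S) i 1)) F (Function.update (m.nat F) 0 1) ∧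
      ((admitProg S V Q F).det orc m).real =
        Function.update m.real V (Function.update (m.real V) 0 q)) ∨
    (¬ (0 < x ∧ c * x ≤ 8.725 * B * (q - v) ∧ 8.725 * q ≤ x) ∧
      ((admitProg S V Q F).det orc m).nat = m.nat ∧
      ((admitProg S V Q F).det orc m).real = m.real) := by
  have e : ((349 / 40 : ℚ) : ℝ) = 8.725 := by norm_num
  simp only [admitProg, Prog.det, Test.Holds, RExp.eval, NExp.eval, Mem.nat_tick, Mem.real_tick,
    hi, hc, hx, hB, hq, hv, e, Rat.cast_one, Rat.cast_zero, mul_one]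
  split_ifs with h1 h2 h3
  · exact Or.inr ⟨fun h => absurd h.1 (not_lt.2 h1), rfl, rfl⟩
  · refine Or.inl ⟨not_le.1 h1, h2, h3, ?_, ?_⟩
    · simp [Mem.setNat, Mem.setReal, Mem.tick, hF]
    · simp [Mem.setNat, Mem.setReal, Mem.tick, hq]
  · exact Or.inr ⟨fun h => h3 h.2.2, rfl, rfl⟩
  · exact Or.inr ⟨fun h => h2 h.2.1, rfl, rfl⟩

/-- Differences of stored values are the marginals, so the tests of the program decide `bestSide`
and `Admits`. As i is in neither set before, a flag for an addition is the same as membership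
afterwards. -/
theorem det_pairProg (ho : Answers orc J a) (hm : Ctx J a ξ m) {S : Bool → Finset (Fin n)}
    (hS : Rep J m S) (hSa : ∀ j, ∀ t ∈ S j, (t : ℕ) < a) {i : Fin n} (hia : (i : ℕ) < a)
    (hi : m.nat 7 0 = i) (hiS : ∀ j, i ∉ S j) {x : ℝ} (hx : m.real 9 0 = x) :
    Rep J (pairProg.det orc m) (J.pairStep 8.725 x S i) ∧
      ((pairProg.det orc m).nat 13 0 ≠ 0 ↔ i ∈ J.pairStep 8.725 x S i false) ∧
      ((pairProg.det orc m).nat 14 0 ≠ 0 ↔ i ∈ J.pairStep 8.725 x S i true) := by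
  classical
  obtain ⟨n1, r1⟩ := det_trialProg (Q := 7) ho (by decide : 10 ≠ 7) hia hi hS.ind_false
    (hiS false) (hSa false)
  set m₁ := (trialProg 10 7).det orc m with hm₁
  obtain ⟨n2, r2⟩ := det_trialProg (m := m₁) (Q := 8) ho (by decide : 11 ≠ 7) hia (by rw [n1, hi])
    (by rw [n1]; exact hS.ind_true) (hiS true) (hSa true)
  set m₂ := (trialProg 11 8).det orc m₁ with hm₂
  rw [n1] at n2
  rw [r1] at r2
  have hc := hm.cost i hia
  have hB := hm.budget
  have v0 := hS.val_false
  have v1 := hS.val_true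
  have i0 := hS.ind_false
  have i1 := hS.ind_true
  rw [pairProg, Prog.det_seq, Prog.det_seq, Prog.det_seq, ← hm₁, ← hm₂]
  set m₃ := clearProg.det orc m₂ with hm₃
  have r3 : m₃.real = m₂.real := rfl
  have n3 : ∀ k, k ≠ 13 → k ≠ 14 → m₃.nat k = m.nat k := by
    intro k h13 h14
    rw [hm₃, Prog.nat_det (by simp [clearProg, Prog.natWrites, h13, h14]), n2]
  have n13 : m₃.nat 13 0 = 0 := by simp [hm₃, clearProg, Prog.det, Mem.nat_setNat, NExp.eval]
  have n14 : m₃.nat 14 0 = 0 := by simp [hm₃, clearProg, Prog.det, Mem.nat_setNat, NExp.eval]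
  have r8 : m₃.real 8 0 = J.v (insert i (S true)) := by rw [r3, r2]; simp
  have r7 : m₃.real 7 0 = J.v (insert i (S false)) := by rw [r3, r2]; simp
  have rk : ∀ k, k ≠ 7 → k ≠ 8 → m₃.real k = m.real k := by
    intro k h7 h8
    rw [r3, r2]; simp [h7, h8]
  have r5 : m₃.real 5 0 = J.v (S false) := by rw [rk 5 (by decide) (by decide), v0]
  have r6 : m₃.real 6 0 = J.v (S true) := by rw [rk 6 (by decide) (by decide), v1]
  clear_value m₃
  have hside : (Test.rle (.sub (realReg 8) (realReg 6)) (.lit 1) (.sub (realReg 7) (realReg 5))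
      (.lit 1)).Holds m₃ ↔ J.marg (S true) i ≤ J.marg (S false) i := by
    simp [Test.Holds, RExp.eval, NExp.eval, r5, r6, r7, r8, SKSInstance.marg]
  rw [SKSInstance.pairStep, Prog.det]
  split_ifs with h1 h2 h2
  · have hb : J.bestSide S i = false := if_pos (hside.1 h1)
    rw [hb] at h2 ⊢
    rcases det_admitProg (m := m₃.tick (Test.size _)) (S := 10) (V := 5) (Q := 7) (F := 13)
      (by decide) orc
      (by rw [Mem.nat_tick, n3 7 (by decide) (by decide), hi])
      (by rw [Mem.real_tick, rk 1 (by decide) (by decide), hc])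
      (by rw [Mem.real_tick, rk 9 (by decide) (by decide), hx])
      (by rw [Mem.real_tick, rk 0 (by decide) (by decide), hB]) r7 r5 with
      ⟨-, -, -, en, er⟩ | ⟨hn, -, -⟩
    · refine ⟨⟨?_, ?_, ?_, ?_⟩, ?_, ?_⟩
      · rw [en]
        simpa [n3] using i0.insert i
      · rw [en]
        simpa [n3] using i1
      · rw [er]; simp
      · rw [er]; simpa using r6
      · rw [en]; simp
      · rw [en]; simp [n14, hiS]
    · exact absurd h2 hn
  · have hb : J.bestSide S i = false := if_pos (hside.1 h1)
    rw [hb] at h2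
    rcases det_admitProg (m := m₃.tick (Test.size _)) (S := 10) (V := 5) (Q := 7) (F := 13)
      (by decide) orc
      (by rw [Mem.nat_tick, n3 7 (by decide) (by decide), hi])
      (by rw [Mem.real_tick, rk 1 (by decide) (by decide), hc])
      (by rw [Mem.real_tick, rk 9 (by decide) (by decide), hx])
      (by rw [Mem.real_tick, rk 0 (by decide) (by decide), hB]) r7 r5 with
      ⟨p1, p2, p3, -, -⟩ | ⟨-, en, er⟩
    · exact absurd ⟨p1, p2, p3⟩ h2
    · refine ⟨⟨?_, ?_, ?_, ?_⟩, ?_, ?_⟩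
      · rw [en]; simpa [n3] using i0
      · rw [en]; simpa [n3] using i1
      · rw [er]; exact r5
      · rw [er]; exact r6
      · rw [en]; simp [n13, hiS]
      · rw [en]; simp [n14, hiS]
  · have hb : J.bestSide S i = true := if_neg (fun h => h1 (hside.2 h))
    rw [hb] at h2 ⊢
    rcases det_admitProg (m := m₃.tick (Test.size _)) (S := 11) (V := 6) (Q := 8) (F := 14)
      (by decide) orc
      (by rw [Mem.nat_tick, n3 7 (by decide) (by decide), hi])
      (by rw [Mem.real_tick, rk 1 (by decide) (by decide), hc])
      (by rw [Mem.real_tick, rk 9 (by decide) (by decide), hx])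
      (by rw [Mem.real_tick, rk 0 (by decide) (by decide), hB]) r8 r6 with
      ⟨-, -, -, en, er⟩ | ⟨hn, -, -⟩
    · refine ⟨⟨?_, ?_, ?_, ?_⟩, ?_, ?_⟩
      · rw [en]
        simpa [n3] using i0
      · rw [en]
        simpa [n3] using i1.insert i
      · rw [er]; simpa using r5
      · rw [er]; simp
      · rw [en]; simp [n13, hiS]
      · rw [en]; simp
    · exact absurd h2 hn
  · have hb : J.bestSide S i = true := if_neg (fun h => h1 (hside.2 h))
    rw [hb] at h2
    rcases det_admitProg (m := m₃.tick (Test.size _)) (S := 11) (V := 6) (Q := 8) (F := 14)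
      (by decide) orc
      (by rw [Mem.nat_tick, n3 7 (by decide) (by decide), hi])
      (by rw [Mem.real_tick, rk 1 (by decide) (by decide), hc])
      (by rw [Mem.real_tick, rk 9 (by decide) (by decide), hx])
      (by rw [Mem.real_tick, rk 0 (by decide) (by decide), hB]) r8 r6 with
      ⟨p1, p2, p3, -, -⟩ | ⟨-, en, er⟩
    · exact absurd ⟨p1, p2, p3⟩ h2
    · refine ⟨⟨?_, ?_, ?_, ?_⟩, ?_, ?_⟩
      · rw [en]; simpa [n3] using i0
      · rw [en]; simpa [n3] using i1
      · rw [er]; exact r5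
      · rw [er]; exact r6
      · rw [en]; simp [n13, hiS]
      · rw [en]; simp [n14, hiS]

/-! ### Sweeps through the sample -/

/-- An invariant of a loop over all elements. -/
theorem det_forAll {p : Prog} (hp : Spares p) (h7 : 7 ∉ p.natWrites) (Q : ℕ → Mem → Prop)
    -- The invariant has to survive the increment of the loop variable in array 7 and of the step
    -- counter.
    (hQ : ∀ k m m', (∀ j, j ≠ 7 → m'.nat j = m.nat j) → m'.real = m.real → Q k m → Q k m')
    (hm : Ctx J a ξ m) (h0 : Q 0 m)
    (hs : ∀ (k : Fin n) (m : Mem), Ctx J a ξ m → m.nat 7 0 = k → Q k m →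
      Q (k + 1) (p.det orc m)) : Q n ((forAll p).det orc m) := by
  rw [forAll, Prog.det_seq]
  refine (Prog.det_loop (N := n) (fun k m => Ctx J a ξ m ∧ m.nat 7 0 = k ∧ Q k m) _ ?_ ?_ ?_).2.2
  · simpa [NExp.eval, Prog.det, Mem.nat_setNat] using hm.size
  · refine ⟨hm.congr ?_ ?_ rfl rfl, ?_, hQ 0 m _ (fun j hj => ?_) rfl h0⟩
    · simp [Prog.det, Mem.nat_setNat]
    · simp [Prog.det, Mem.nat_setNat]
    · simp [Prog.det, Mem.nat_setNat, NExp.eval]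
    · simp [Prog.det, Mem.nat_setNat, hj]
  · rintro k hk m ⟨c, e, q⟩
    have c' := c.det (orc := orc) hp
    have q' := hs ⟨k, hk⟩ m c e q
    have e' : (p.det orc m).nat 7 0 = k := by rw [Prog.nat_det h7, e]
    rw [Prog.det_seq]
    refine ⟨c'.congr ?_ ?_ rfl rfl, ?_, hQ (k + 1) (p.det orc m) _ (fun j hj => ?_) rfl q'⟩
    · simp [Prog.det, Mem.nat_setNat]
    · simp [Prog.det, Mem.nat_setNat]
    · simp [Prog.det, Mem.nat_setNat, NExp.eval, e']
    · simp [Prog.det, Mem.nat_setNat, hj]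

theorem det_resetProg (hm : Ctx J a ξ m) :
    Rep J (resetProg.det orc m) fun _ => ∅ := by
  rw [resetProg, Prog.det_seq, Prog.det_seq]
  set m₁ := (Prog.rset 6 (.lit 0) (.lit 0)).det orc ((Prog.rset 5 (.lit 0) (.lit 0)).det orc m)
    with hm₁
  have c₁ : Ctx J a ξ m₁ := (hm.det (by decide)).det (by decide)
  have h5 : m₁.real 5 0 = 0 := by simp [hm₁, Prog.det, Mem.real_setReal, NExp.eval, RExp.eval]
  have h6 : m₁.real 6 0 = 0 := by simp [hm₁, Prog.det, Mem.real_setReal, NExp.eval, RExp.eval]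
  have := det_forAll (orc := orc) (p := .seq (.nset 10 (natReg 7) (.lit 0))
      (.nset 11 (natReg 7) (.lit 0))) (by decide) (by decide)
    (fun k m => (∀ t : Fin n, (t : ℕ) < k → m.nat 10 t = 0 ∧ m.nat 11 t = 0) ∧
      m.real 5 0 = 0 ∧ m.real 6 0 = 0)
    (by
      intro k m m' h1 h2 h3
      rwa [h1 10 (by decide), h1 11 (by decide), h2])
    c₁ ⟨fun t ht => absurd ht (Nat.not_lt_zero _), h5, h6⟩
    (by
      rintro k m - e ⟨q, q5, q6⟩
      refine ⟨fun t ht => ?_, by simpa [Prog.det] using q5, by simpa [Prog.det] using q6⟩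
      simp only [Prog.det, NExp.eval, Mem.nat_tick, Mem.nat_setNat, e, if_true]
      by_cases htk : (t : ℕ) = k
      · simp [htk, e]
      · have := q t (by omega)
        simp [htk, e, this])
  obtain ⟨q, q5, q6⟩ := this
  refine ⟨fun t => ?_, fun t => ?_, ?_, ?_⟩
  · simpa using (q t t.2).1
  · simpa using (q t t.2).2
  · rw [q5, J.v_empty]
  · rw [q6, J.v_empty]

theorem mem_take_finRange {n k : ℕ} {t : Fin n} : t ∈ (List.finRange n).take k ↔ (t : ℕ) < k := by
  rw [List.mem_take_iff_getElem]
  constructor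
  · rintro ⟨i, hi, rfl⟩
    simp only [List.length_finRange] at hi
    simp only [List.getElem_finRange, Fin.val_cast]
    omega
  · intro h
    refine ⟨t, ?_, ?_⟩
    · have := t.2
      simp only [List.length_finRange]; omega
    · ext; simp

theorem nodup_take_finRange (n k : ℕ) : ((List.finRange n).take k).Nodup :=
  (List.nodup_finRange n).sublist (List.take_sublist _ _)

theorem take_succ_finRange (i : Fin n) :
    (List.finRange n).take (i + 1) = (List.finRange n).take i ++ [i] := by
  rw [List.take_succ_eq_append_getElem (by simp)]
  simp

theorem pairSweep_append (β x : ℝ) (l : List (Fin n)) (i : Fin n) (S : Bool → Finset (Fin n)) :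
    J.pairSweep β x (l ++ [i]) S = J.pairStep β x (J.pairSweep β x l S) i := by
  simp [SKSInstance.pairSweep]

theorem pairSweep_subset (β x : ℝ) (l : List (Fin n)) (j : Bool) :
    J.pairSweep β x l (fun _ => ∅) j ⊆ l.toFinset := by
  induction l using List.reverseRecOn with
  | nil => simp [SKSInstance.pairSweep]
  | append_singleton l i ih =>
    rw [pairSweep_append]
    refine (GenSm.pairStep_subset J β x _ i j).trans ?_
    intro t ht
    rcases Finset.mem_insert.1 ht with rfl | ht
    · simp
    · have := ih ht
      simp only [List.mem_toFinset, List.mem_append] at this ⊢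
      exact Or.inl this

/-- The sweep through the sample. -/
noncomputable def sweepSample (J : SKSInstance n) (ξ : ℕ) (x : ℝ) : Bool → Finset (Fin n) :=
  J.pairSweep 8.725 x ((List.finRange n).take ξ) fun _ => ∅

theorem det_sampleSweep (ho : Answers orc J a) (hξ : ξ ≤ a) (hm : Ctx J a ξ m) {x : ℝ}
    (hx : m.real 9 0 = x) : Rep J (sampleSweep.det orc m) (sweepSample J ξ x) := by
  rw [sampleSweep, Prog.det]
  have hr := det_resetProg (orc := orc) hm
  have c₁ := hm.det (orc := orc) (p := resetProg) (by decide)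
  have hx₁ : (resetProg.det orc m).real 9 0 = x := by rw [Prog.real_det (by decide), hx]
  have := det_forAll (orc := orc)
    (p := .ite (.nle (.add (natReg 7) (.lit 1)) (natReg 3)) pairProg .skip) (by decide) (by decide)
    -- The loop runs n times whatever ξ is; its turns from ξ on do nothing, hence the minimum.
    (fun k m => m.real 9 0 = x ∧
      Rep J m (J.pairSweep 8.725 x ((List.finRange n).take (min k ξ)) fun _ => ∅))
    (by
      rintro k m m' h1 h2 ⟨h3, h4⟩
      exact ⟨by rw [h2, h3], h4.congr (h1 10 (by decide)) (h1 11 (by decide)) (by rw [h2])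
        (by rw [h2])⟩)
    c₁ ⟨hx₁, by simpa [SKSInstance.pairSweep] using hr⟩
    (by
      rintro k m c e ⟨q, r⟩
      rw [Prog.det]
      have htest : (Test.nle (.add (natReg 7) (.lit 1)) (natReg 3)).Holds m ↔ (k : ℕ) < ξ := by
        simp only [Test.Holds, NExp.eval, e, c.sample]
        omega
      have hmem : ∀ j, ∀ t ∈ J.pairSweep 8.725 x ((List.finRange n).take (min k ξ))
          (fun _ => ∅) j, (t : ℕ) < min (k : ℕ) ξ := by
        intro j t ht
        simpa only [List.mem_toFinset, mem_take_finRange] using pairSweep_subset _ _ _ _ ht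
      split_ifs with h
      · rw [htest] at h
        refine ⟨by rw [Prog.real_det (by decide)]; exact q, ?_⟩
        rw [min_eq_left (by omega : (k : ℕ) + 1 ≤ ξ), take_succ_finRange, pairSweep_append]
        rw [min_eq_left h.le] at r hmem
        exact (det_pairProg ho (c.tick _) (r.tick _)
          (fun j t ht => by have := hmem j t ht; omega) (by omega : (k : ℕ) < a)
          (by rw [Mem.nat_tick]; exact e) (fun j hj => by have := hmem j k hj; omega)
          (by rw [Mem.real_tick]; exact q)).1
      · rw [htest, not_lt] at h
        rw [min_eq_right h] at r
        rw [min_eq_right (by omega : ξ ≤ (k : ℕ) + 1)]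
        exact ⟨q, (r.tick _).tick 1⟩)
  have h := this.2
  rw [sweepSample]
  convert h using 2
  rw [List.take_eq_take_min, List.length_finRange, min_comm]

/-- The best value that is found for the first `k` of the guesses `M, 2 M, 4 M, …`. -/
noncomputable def bestGuess (J : SKSInstance n) (ξ : ℕ) (M : ℝ) : ℕ → ℝ
  | 0 => M
  | k + 1 => max (max (bestGuess J ξ M k) (J.v (sweepSample J ξ (2 ^ k * M) false)))
      (J.v (sweepSample J ξ (2 ^ k * M) true))

theorem det_maxProg (V : ℕ) (orc : (ℕ → ℕ) → ℝ) (m : Mem) :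
    ((maxProg V).det orc m).real 11 0 = max (m.real 11 0) (m.real V 0) := by
  rw [maxProg, Prog.det]
  split_ifs with h
  · have h : m.real 11 0 ≤ m.real V 0 := by simpa [Test.Holds, RExp.eval, NExp.eval] using h
    simp [Prog.det, Mem.real_setReal, NExp.eval, RExp.eval, h]
  · have h : ¬ m.real 11 0 ≤ m.real V 0 := by simpa [Test.Holds, RExp.eval, NExp.eval] using h
    simp [Prog.det, (not_le.1 h).le]

/-- The offline and online sweeps share the candidate arrays and the estimate register, which
explains the final copy and reset. -/
theorem det_offlineProg (ho : Answers orc J a) (hξ : ξ ≤ a) (hm : Ctx J a ξ m) {M : ℝ}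
    (hM : m.real 3 0 = M) : (offlineProg.det orc m).real 9 0 = bestGuess J ξ M n ∧
      Rep J (offlineProg.det orc m) fun _ => ∅ := by
  simp only [offlineProg, Prog.det]
  set m₂ := ((m.setReal 10 (NExp.eval _ (.lit 0)) (RExp.eval _ (realReg 3))).tick _).setReal 11
    (NExp.eval _ (.lit 0)) (RExp.eval _ (realReg 3)) |>.tick
      ((NExp.lit 0).size + (realReg 3).size + 1) with hm₂
  have c₂ : Ctx J a ξ m₂ := hm.congr rfl rfl
    (by simp [hm₂, Mem.real_setReal]) (by simp [hm₂, Mem.real_setReal])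
  have e10 : m₂.real 10 0 = M := by simp [hm₂, Mem.real_setReal, NExp.eval, RExp.eval, hM]
  have e11 : m₂.real 11 0 = M := by simp [hm₂, Mem.real_setReal, NExp.eval, RExp.eval, hM]
  clear_value m₂
  obtain ⟨c₃, -, q⟩ := Prog.det_loop (orc := orc) (e := natReg 0) (p := guessProg) (N := n)
    (fun k m => Ctx J a ξ m ∧ m.real 10 0 = 2 ^ k * M ∧ m.real 11 0 = bestGuess J ξ M k) m₂
    c₂.size ⟨c₂.congr rfl rfl rfl rfl, by simpa using e10, e11⟩
    (by
      rintro k - m ⟨c, q10, q11⟩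
      refine ⟨c.det (by decide), ?_⟩
      simp only [guessProg, Prog.det]
      set m₁ := (m.setReal 9 (NExp.eval m (.lit 0)) (RExp.eval m (realReg 10))).tick
        ((NExp.lit 0).size + (realReg 10).size + 1) with hm₁
      have c₁ : Ctx J a ξ m₁ := c.congr rfl rfl
        (by simp [hm₁, Mem.real_setReal]) (by simp [hm₁, Mem.real_setReal])
      have r := det_sampleSweep ho hξ c₁ (x := 2 ^ k * M) (by
        simp [hm₁, Mem.real_setReal, NExp.eval, RExp.eval, q10])
      have s10 : (sampleSweep.det orc m₁).real 10 0 = 2 ^ k * M := by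
        rw [Prog.real_det (by decide)]
        simp [hm₁, Mem.real_setReal, q10]
      have s11 : (sampleSweep.det orc m₁).real 11 0 = bestGuess J ξ M k := by
        rw [Prog.real_det (by decide)]
        simp [hm₁, Mem.real_setReal, q11]
      generalize sampleSweep.det orc m₁ = m₂ at r s10 s11
      have t10 : ((maxProg 6).det orc ((maxProg 5).det orc m₂)).real 10 0 = 2 ^ k * M := by
        rw [Prog.real_det (by decide), Prog.real_det (by decide), s10]
      have t11 : ((maxProg 6).det orc ((maxProg 5).det orc m₂)).real 11 0 =
          bestGuess J ξ M (k + 1) := by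
        rw [det_maxProg, det_maxProg, Prog.real_det (p := maxProg 5) (k := 6) (by decide), s11,
          r.val_false, r.val_true]
        rfl
      generalize (maxProg 6).det orc ((maxProg 5).det orc m₂) = m₃ at t10 t11
      constructor
      · simp [Mem.real_setReal, NExp.eval, RExp.eval, t10, pow_succ]
        ring
      · simpa [Mem.real_setReal] using t11)
  rw [Prog.det] at c₃ q
  generalize (guessProg.det orc)^[NExp.eval m₂ (natReg 0)] _ = m₃ at c₃ q
  constructor
  · rw [Prog.real_det (by decide)]
    simp [Mem.real_setReal, NExp.eval, RExp.eval, q]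
  · refine det_resetProg (c₃.congr rfl rfl ?_ ?_) <;> simp [Mem.real_setReal]

end Secretary

namespace Secretary

variable {n : ℕ} {J : SKSInstance n} {a ξ k : ℕ} {orc : (ℕ → ℕ) → ℝ} {m : Mem}

/-! ### The processing of an arrival -/

/-- `M` is the largest value of an element before time `b` that alone is feasible. -/
def SampleMax (J : SKSInstance n) (b : ℕ) (M : ℝ) : Prop :=
  (∀ t : Fin n, (t : ℕ) < b → J.c t ≤ J.B → J.v {t} ≤ M) ∧
    (M = 0 ∨ ∃ t : Fin n, (t : ℕ) < b ∧ J.c t ≤ J.B ∧ M = J.v {t})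

/-- The factor that the Dynkin modes apply to the best value in the sample. -/
noncomputable def dynkinFactor (k : ℕ) : ℝ := if k = 0 then 1 else 1 / 2

/-- The candidate sets after the arrivals before time `a`. -/
noncomputable def sweepAfter (J : SKSInstance n) (ξ : ℕ) (M : ℝ) (a : ℕ) :
    Bool → Finset (Fin n) :=
  J.pairSweep 8.725 (bestGuess J ξ M n) (((List.finRange n).take a).drop ξ) fun _ => ∅

theorem sweepAfter_of_le (h : a ≤ ξ) (M : ℝ) : sweepAfter J ξ M a = fun _ => ∅ := by
  rw [sweepAfter, List.drop_eq_nil_of_le]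
  · rfl
  · rw [List.length_take]; omega

theorem sweepAfter_succ {i : Fin n} (h : ξ ≤ i) (M : ℝ) : sweepAfter J ξ M (i + 1) =
    J.pairStep 8.725 (bestGuess J ξ M n) (sweepAfter J ξ M i) i := by
  rw [sweepAfter, take_succ_finRange, List.drop_append_of_le_length, pairSweep_append]
  · rfl
  · have := i.2
    simp only [List.length_take, List.length_finRange]
    omega

theorem pairStep_eq (β x : ℝ) (S : Bool → Finset (Fin n)) (i : Fin n) (j : Bool) :
    J.pairStep β x S i j = S j ∨ J.pairStep β x S i j = insert i (S j) := by
  classical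
  rw [SKSInstance.pairStep]
  split_ifs
  · by_cases hj : j = J.bestSide S i
    · right; rw [← hj, Function.update_self]
    · left; rw [Function.update_of_ne hj]
  · exact Or.inl rfl

theorem lt_of_mem_sweepAfter {M : ℝ} {j : Bool} {t : Fin n} (h : t ∈ sweepAfter J ξ M a j) :
    (t : ℕ) < a := by
  have := pairSweep_subset _ _ _ _ h
  exact mem_take_finRange.1 (List.mem_of_mem_drop (List.mem_toFinset.1 this))

/-- The state before time `a`, if the elements of `T` have been accepted. -/
structure Inv (J : SKSInstance n) (a ξ k : ℕ) (m : Mem) (T : Finset (Fin n)) : Prop where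
  ctx : Ctx J a ξ m
  mode : m.nat 4 0 = k
  clean : ∀ i, m.nat 12 i = 0
  max : SampleMax J (min a ξ) (m.real 3 0)
  dynkin : k ≤ 1 →
    (m.nat 6 0 = 0 ∧ T = ∅ ∧ ∀ t : Fin n, ξ ≤ t → (t : ℕ) < a → J.c t ≤ J.B →
      J.v {t} ≤ dynkinFactor k * m.real 3 0) ∨
    (m.nat 6 0 ≠ 0 ∧ ∃ t : Fin n, ξ ≤ t ∧ (t : ℕ) < a ∧ J.c t ≤ J.B ∧
      dynkinFactor k * m.real 3 0 < J.v {t} ∧ T = {t})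
  sweep : 2 ≤ k → T = sweepAfter J ξ (m.real 3 0) a (decide (k ≠ 2)) ∧
    (ξ < a → m.real 9 0 = bestGuess J ξ (m.real 3 0) n ∧ Rep J m (sweepAfter J ξ (m.real 3 0) a))

/-- The state after the arriving element has been evaluated. -/
structure Head (J : SKSInstance n) (i : Fin n) (ξ : ℕ) (m h : Mem) : Prop where
  ctx : Ctx J (i + 1) ξ h
  time : h.nat 1 0 = i
  current : h.nat 7 0 = i
  accept : h.nat 2 0 = 0
  value : h.real 4 0 = J.v {i}
  nat_eq : ∀ j, j ≠ 1 → j ≠ 2 → j ≠ 7 → h.nat j = m.nat j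
  real_eq : ∀ j, j ≠ 1 → j ≠ 4 → h.real j = m.real j

theorem head_headProg {i : Fin n} (ho : Answers orc J (i + 1)) (hm : Ctx J i ξ m)
    (h12 : ∀ j, m.nat 12 j = 0) :
    Head J i ξ m (headProg.det orc (OnlineAlgorithm.present m i (J.c i))) := by
  rw [headProg, Prog.det_seq, Prog.det_seq]
  set p := OnlineAlgorithm.present m i (J.c i) with hp
  have p1 : p.nat 1 0 = i := by simp [hp, OnlineAlgorithm.present, Mem.nat_setNat]
  have pn : ∀ j, j ≠ 1 → p.nat j = m.nat j := fun j hj => by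
    simp [hp, OnlineAlgorithm.present, Mem.nat_setNat, hj]
  have pr : ∀ j, j ≠ 1 → p.real j = m.real j := fun j hj => by
    simp [hp, OnlineAlgorithm.present, Mem.real_setReal, hj]
  have pc : ∀ t : Fin n, (t : ℕ) < i + 1 → p.real 1 t = J.c t := by
    intro t ht
    by_cases hti : t = i
    · subst hti; simp [hp, OnlineAlgorithm.present, Mem.real_setReal]
    · have hti' : (t : ℕ) ≠ i := fun e => hti (Fin.ext e)
      have := hm.cost t (by omega)
      simp [hp, OnlineAlgorithm.present, Mem.real_setReal, hti', this]
  set q := (Prog.nset 7 (.lit 0) (natReg 1)).det orc ((Prog.nset 2 (.lit 0) (.lit 0)).det orc p)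
    with hq
  have q2 : q.nat 2 0 = 0 := by simp [hq, Prog.det, Mem.nat_setNat, NExp.eval]
  have q7 : q.nat 7 0 = i := by simp [hq, Prog.det, Mem.nat_setNat, NExp.eval, p1]
  have qn : ∀ j, j ≠ 2 → j ≠ 7 → q.nat j = p.nat j := fun j h2 h7 => by
    simp [hq, Prog.det, Mem.nat_setNat, h2, h7]
  have qr : q.real = p.real := rfl
  obtain ⟨en, er⟩ := det_trialProg (m := q) (Q := 4) (T := ∅) ho (by decide : 12 ≠ 7)
    (Nat.lt_succ_self _) q7
    (by intro t; rw [qn 12 (by decide) (by decide), pn 12 (by decide)]; simp [h12])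
    (by simp) (by simp)
  refine ⟨⟨?_, ?_, ?_, ?_⟩, ?_, ?_, ?_, ?_, ?_, ?_⟩
  · rw [en, qn 0 (by decide) (by decide), pn 0 (by decide), hm.size]
  · rw [en, qn 3 (by decide) (by decide), pn 3 (by decide), hm.sample]
  · rw [er, Function.update_of_ne (by decide), qr, pr 0 (by decide), hm.budget]
  · intro t ht
    rw [er, Function.update_of_ne (by decide), qr, pc t ht]
  · rw [en, qn 1 (by decide) (by decide), p1]
  · rw [en, q7]
  · rw [en, q2]
  · rw [er]; simp
  · intro j h1 h2 h7
    rw [en, qn j h2 h7, pn j h1]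
  · intro j h1 h4
    rw [er, Function.update_of_ne h4, qr, pr j h1]

theorem Head.tick {i : Fin n} {h : Mem} (H : Head J i ξ m h) (t : ℕ) : Head J i ξ m (h.tick t) :=
  ⟨H.ctx.tick t, H.time, H.current, H.accept, H.value, H.nat_eq, H.real_eq⟩

theorem det_sampleProg {i : Fin n} {h : Mem} (H : Head J i ξ m h) (orc : (ℕ → ℕ) → ℝ)
    (hM : SampleMax J i (m.real 3 0)) :
    SampleMax J (i + 1) ((sampleProg.det orc h).real 3 0) := by
  have h3 : h.real 3 0 = m.real 3 0 := by rw [H.real_eq 3 (by decide) (by decide)]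
  have hc := H.ctx.cost i (Nat.lt_succ_self _)
  have hB := H.ctx.budget
  have key : ∀ M', (J.c i ≤ J.B → J.v {i} ≤ M') → m.real 3 0 ≤ M' →
      (M' = m.real 3 0 ∨ J.c i ≤ J.B ∧ M' = J.v {i}) → SampleMax J (i + 1) M' := by
    intro M' h1 h2 h4
    refine ⟨fun t ht hct => ?_, ?_⟩
    · by_cases hti : t = i
      · subst hti; exact h1 hct
      · have : (t : ℕ) ≠ i := fun e => hti (Fin.ext e)
        exact (hM.1 t (by omega) hct).trans h2
    · rcases h4 with h4 | ⟨h4, h5⟩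
      · rcases hM.2 with h0 | ⟨t, ht, hct, e⟩
        · exact Or.inl (h4.trans h0)
        · exact Or.inr ⟨t, by omega, hct, h4.trans e⟩
      · exact Or.inr ⟨i, Nat.lt_succ_self _, h4, h5⟩
  simp only [sampleProg, Prog.det, Test.Holds, RExp.eval, NExp.eval, Mem.real_tick,
    H.current, hc, hB, Rat.cast_one, mul_one, h3, H.value]
  split_ifs with h1 h2
  · simp only [Mem.real_tick, Mem.real_setReal, if_true, Function.update_self]
    exact key _ (fun _ => le_rfl) h2 (Or.inr ⟨h1, rfl⟩)
  · simp only [Mem.real_tick, h3]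
    exact key _ (fun _ => (not_le.1 h2).le) le_rfl (Or.inl rfl)
  · simp only [Mem.real_tick, h3]
    exact key _ (fun h => absurd h h1) le_rfl (Or.inl rfl)

theorem det_dynkinProg {i : Fin n} {h : Mem} (H : Head J i ξ m h) (orc : (ℕ → ℕ) → ℝ) (q : ℚ) :
    (m.nat 6 0 = 0 ∧ J.c i ≤ J.B ∧ q * m.real 3 0 < J.v {i} ∧
      ((dynkinProg q).det orc h).nat 2 0 ≠ 0 ∧ ((dynkinProg q).det orc h).nat 6 0 ≠ 0) ∨
    (¬ (m.nat 6 0 = 0 ∧ J.c i ≤ J.B ∧ q * m.real 3 0 < J.v {i}) ∧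
      ((dynkinProg q).det orc h).nat 2 0 = 0 ∧
      ((dynkinProg q).det orc h).nat 6 0 = m.nat 6 0) := by
  have h3 : h.real 3 0 = m.real 3 0 := by rw [H.real_eq 3 (by decide) (by decide)]
  have h6 : h.nat 6 0 = m.nat 6 0 := by rw [H.nat_eq 6 (by decide) (by decide) (by decide)]
  have hc := H.ctx.cost i (Nat.lt_succ_self _)
  have hB := H.ctx.budget
  simp only [dynkinProg, Prog.det, Test.Holds, RExp.eval, NExp.eval, Mem.nat_tick, Mem.real_tick,
    H.current, hc, hB, Rat.cast_one, mul_one, h3, H.value, h6, Nat.le_zero]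
  split_ifs with h1 h2 h4
  · refine Or.inr ⟨fun h' => absurd h4 (not_le.2 h'.2.2), ?_, ?_⟩
    · simpa using H.accept
    · simpa using h6
  · refine Or.inl ⟨h1, h2, not_le.1 h4, ?_, ?_⟩ <;> simp [Mem.nat_setNat]
  · refine Or.inr ⟨fun h' => h2 h'.2.1, ?_, ?_⟩
    · simpa using H.accept
    · simpa using h6
  · refine Or.inr ⟨fun h' => h1 h'.1, ?_, ?_⟩
    · simpa using H.accept
    · simpa using h6

/-- At time ξ the estimate is computed and the candidate sets start empty, so the old memory is
assumed to represent them only for ξ < i. -/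
theorem det_sweepProg {i : Fin n} (ho : Answers orc J (i + 1)) {h : Mem} (H : Head J i ξ m h)
    (hξ : ξ ≤ i) (hk : m.nat 4 0 = k)
    (hm : ξ < i → m.real 9 0 = bestGuess J ξ (m.real 3 0) n ∧
      Rep J m (sweepAfter J ξ (m.real 3 0) i)) :
    (sweepProg.det orc h).real 9 0 = bestGuess J ξ (m.real 3 0) n ∧
    Rep J (sweepProg.det orc h) (sweepAfter J ξ (m.real 3 0) (i + 1)) ∧
    ((sweepProg.det orc h).nat 2 0 ≠ 0 ↔
      i ∈ sweepAfter J ξ (m.real 3 0) (i + 1) (!decide (k ≤ 2))) := by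
  have h3 : h.real 3 0 = m.real 3 0 := by rw [H.real_eq 3 (by decide) (by decide)]
  have h4 : h.nat 4 0 = k := by rw [H.nat_eq 4 (by decide) (by decide) (by decide), hk]
  rw [sweepProg, Prog.det_seq, Prog.det_seq, Prog.det_seq]
  set h₁ := (Prog.ite (.nle (natReg 1) (natReg 3)) offlineProg .skip).det orc h with hh₁
  have c₁ : Ctx J (i + 1) ξ h₁ := H.ctx.det (by decide)
  have t₁ : h₁.nat 1 0 = i := by rw [hh₁, Prog.nat_det (by decide), H.time]
  have k₁ : h₁.nat 4 0 = k := by rw [hh₁, Prog.nat_det (by decide), h4]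
  have r₁ : h₁.real 9 0 = bestGuess J ξ (m.real 3 0) n ∧
      Rep J h₁ (sweepAfter J ξ (m.real 3 0) i) := by
    rw [hh₁, Prog.det]
    split_ifs with ht
    · have hi : (i : ℕ) ≤ ξ := by simpa [Test.Holds, NExp.eval, H.time, H.ctx.sample] using ht
      rw [sweepAfter_of_le hi]
      exact det_offlineProg ho (by omega) (H.ctx.tick _) (by rw [Mem.real_tick, h3])
    · have hi : ¬ (i : ℕ) ≤ ξ := by simpa [Test.Holds, NExp.eval, H.time, H.ctx.sample] using ht
      obtain ⟨a1, a2⟩ := hm (by omega)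
      refine ⟨?_, (((a2.congr (m' := h) ?_ ?_ ?_ ?_).tick _).tick 1)⟩
      · rw [← a1, ← H.real_eq 9 (by decide) (by decide)]; rfl
      · exact H.nat_eq 10 (by decide) (by decide) (by decide)
      · exact H.nat_eq 11 (by decide) (by decide) (by decide)
      · exact H.real_eq 5 (by decide) (by decide)
      · exact H.real_eq 6 (by decide) (by decide)
  clear_value h₁
  set h₂ := (Prog.nset 7 (.lit 0) (natReg 1)).det orc h₁ with hh₂
  have c₂ : Ctx J (i + 1) ξ h₂ := c₁.det (by decide)
  have i₂ : h₂.nat 7 0 = i := by simp [hh₂, Prog.det, Mem.nat_setNat, NExp.eval, t₁]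
  have k₂ : h₂.nat 4 0 = k := by rw [hh₂, Prog.nat_det (by decide), k₁]
  have x₂ : h₂.real 9 0 = bestGuess J ξ (m.real 3 0) n := r₁.1
  have r₂ : Rep J h₂ (sweepAfter J ξ (m.real 3 0) i) :=
    r₁.2.congr (Prog.nat_det (by decide) _) (Prog.nat_det (by decide) _)
      (Prog.real_det (by decide) _) (Prog.real_det (by decide) _)
  clear_value h₂
  obtain ⟨r₃, f, t⟩ := det_pairProg ho c₂ r₂
    (fun j t ht => by have := lt_of_mem_sweepAfter ht; omega) (Nat.lt_succ_self _) i₂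
    (fun j hj => by have := lt_of_mem_sweepAfter hj; omega) x₂
  rw [← sweepAfter_succ hξ] at r₃ f t
  have x₃ : (pairProg.det orc h₂).real 9 0 = bestGuess J ξ (m.real 3 0) n := by
    rw [Prog.real_det (by decide), x₂]
  have k₃ : (pairProg.det orc h₂).nat 4 0 = k := by rw [Prog.nat_det (by decide), k₂]
  generalize pairProg.det orc h₂ = h₃ at *
  refine ⟨?_, r₃.congr (Prog.nat_det (by decide) _) (Prog.nat_det (by decide) _)
      (Prog.real_det (by decide) _) (Prog.real_det (by decide) _), ?_⟩
  · rw [Prog.real_det (by decide), x₃]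
  · have ht : (Test.nle (natReg 4) (.lit 2)).Holds h₃ ↔ k ≤ 2 := by
      simp [Test.Holds, NExp.eval, k₃]
    rw [Prog.det]
    by_cases hk2 : k ≤ 2
    · rw [if_pos (ht.2 hk2)]
      simpa [Prog.det, Mem.nat_setNat, NExp.eval, hk2] using f
    · rw [if_neg (fun h => hk2 (ht.1 h))]
      simpa [Prog.det, Mem.nat_setNat, NExp.eval, hk2] using t

/-- The mode is fixed, so each arrival is a sample, threshold or sweep arrival. In a sweep mode the
acceptance register is set exactly when i joins the tracked candidate set, which keeps that set
equal to the accepted one. -/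
theorem Inv.step {T : Finset (Fin n)} {i : Fin n} (hI : Inv J i ξ k m T)
    (ho : Answers orc J (i + 1)) {m' : Mem}
    (hm' : m' = arrivalProg.det orc (OnlineAlgorithm.present m i (J.c i))) :
    Inv J (i + 1) ξ k m' (if m'.nat 2 0 = 0 then T else insert i T) := by
  have H := head_headProg ho hI.ctx hI.clean
  rw [arrivalProg, Prog.det_seq] at hm'
  set h := headProg.det orc (OnlineAlgorithm.present m i (J.c i)) with hh
  have h3 : h.real 3 0 = m.real 3 0 := by rw [H.real_eq 3 (by decide) (by decide)]
  have h4 : h.nat 4 0 = k := by rw [H.nat_eq 4 (by decide) (by decide) (by decide), hI.mode]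
  have h6 : h.nat 6 0 = m.nat 6 0 := by rw [H.nat_eq 6 (by decide) (by decide) (by decide)]
  have c' : Ctx J (i + 1) ξ m' := by rw [hm']; exact H.ctx.det (by decide)
  have k' : m'.nat 4 0 = k := by rw [hm', Prog.nat_det (by decide), h4]
  have n12' : ∀ j, m'.nat 12 j = 0 := by
    intro j
    rw [hm', Prog.nat_det (by decide), H.nat_eq 12 (by decide) (by decide) (by decide), hI.clean]
  clear_value h
  have t1 : (Test.nle (.add (natReg 1) (.lit 1)) (natReg 3)).Holds h ↔ (i : ℕ) < ξ := by
    simp only [Test.Holds, NExp.eval, H.time, H.ctx.sample]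
    omega
  rw [Prog.det] at hm'
  split_ifs at hm' with hs
  · rw [t1] at hs
    have hM := hI.max
    rw [min_eq_left hs.le] at hM
    have M' : SampleMax J (i + 1) (m'.real 3 0) := by
      rw [hm']; exact det_sampleProg (H.tick _) orc hM
    have a' : m'.nat 2 0 = 0 := by rw [hm', Prog.nat_det (by decide)]; exact H.accept
    have d' : m'.nat 6 0 = m.nat 6 0 := by rw [hm', Prog.nat_det (by decide)]; exact h6
    rw [if_pos a']
    refine ⟨c', k', n12', by rwa [min_eq_left (by omega)], fun hk => ?_, fun hk => ?_⟩
    · left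
      rcases hI.dynkin hk with ⟨b1, b2, -⟩ | ⟨-, t, b1, b2, -⟩
      · exact ⟨by rw [d', b1], b2, fun t b3 b4 => by omega⟩
      · omega
    · have := (hI.sweep hk).1
      rw [sweepAfter_of_le (by omega)] at this ⊢
      exact ⟨this, fun h => by omega⟩
  · rw [t1, not_lt] at hs
    have hM := hI.max
    rw [min_eq_right hs] at hM
    have M3 : m'.real 3 0 = m.real 3 0 := by
      rw [hm', Prog.real_det (by decide)]; exact h3
    have hM' : SampleMax J (min (i + 1) ξ) (m'.real 3 0) := by
      rwa [M3, min_eq_right (by omega)]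
    have t2 : (Test.nle (natReg 4) (.lit 0)).Holds (h.tick
        (Test.nle (.add (natReg 1) (.lit 1)) (natReg 3)).size) ↔ k = 0 := by
      simp [Test.Holds, NExp.eval, h4]
    have t3 : ∀ s s', (Test.nle (natReg 4) (.lit 1)).Holds ((h.tick s).tick s') ↔ k ≤ 1 := by
      simp [Test.Holds, NExp.eval, h4]
    have hdyn : ∀ (q : ℚ) (h' : Mem), Head J i ξ m h' → m' = (dynkinProg q).det orc h' →
        (q : ℝ) = dynkinFactor k → k ≤ 1 →
        Inv J (i + 1) ξ k m' (if m'.nat 2 0 = 0 then T else insert i T) := by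
      intro q h' H' e hq hk
      refine ⟨c', k', n12', hM', fun _ => ?_, fun hk' => by omega⟩
      have D := det_dynkinProg H' orc q
      rw [← e, hq] at D
      rw [M3]
      rcases D with ⟨d1, d2, d3, d4, d5⟩ | ⟨d1, d4, d5⟩
      · rw [if_neg d4]
        rcases hI.dynkin hk with ⟨b1, b2, b3⟩ | ⟨b1, -⟩
        · exact Or.inr ⟨d5, i, hs, Nat.lt_succ_self _, d2, d3, by rw [b2]; rfl⟩
        · exact absurd d1 b1
      · rw [if_pos d4]
        rcases hI.dynkin hk with ⟨b1, b2, b3⟩ | ⟨b1, t, b2, b3, b4⟩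
        · refine Or.inl ⟨by rw [d5, b1], b2, fun t u1 u2 u3 => ?_⟩
          by_cases hti : t = i
          · subst hti
            by_contra hcon
            exact d1 ⟨b1, u3, not_le.1 hcon⟩
          · have : (t : ℕ) ≠ i := fun e => hti (Fin.ext e)
            exact b3 t u1 (by omega) u3
        · exact Or.inr ⟨by rw [d5]; exact b1, t, b2, by omega, b4⟩
    rw [Prog.det] at hm'
    split_ifs at hm' with hs2
    · rw [t2] at hs2
      exact hdyn 1 _ ((H.tick _).tick _) hm' (by simp [dynkinFactor, hs2]) (by omega)
    · rw [t2] at hs2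
      rw [Prog.det] at hm'
      split_ifs at hm' with hs3
      · rw [t3] at hs3
        exact hdyn (1 / 2) _ (((H.tick _).tick _).tick _) hm' (by simp [dynkinFactor, hs2]) hs3
      · rw [t3] at hs3
        have hk : 2 ≤ k := by omega
        obtain ⟨s1, s2⟩ := hI.sweep hk
        obtain ⟨e1, e2, e3⟩ := det_sweepProg ho (((H.tick _).tick _).tick _) hs hI.mode s2
        rw [← hm'] at e1 e2 e3
        refine ⟨c', k', n12', hM', fun hk' => by omega, fun _ => ?_⟩
        rw [M3]
        refine ⟨?_, fun _ => ⟨e1, e2⟩⟩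
        have hside : (!decide (k ≤ 2)) = decide (k ≠ 2) := by
          by_cases h2 : k = 2
          · simp [h2]
          · simp [h2]; omega
        rw [hside, sweepAfter_succ hs] at e3
        rw [sweepAfter_succ hs, s1]
        set S := sweepAfter J ξ (m.real 3 0) i with hS
        have hiS : i ∉ S (decide (k ≠ 2)) := fun hj => by
          have := lt_of_mem_sweepAfter hj; omega
        rcases pairStep_eq (J := J) 8.725 (bestGuess J ξ (m.real 3 0) n) S i (decide (k ≠ 2)) with
          hP | hP
        · rw [hP] at e3 ⊢
          exact if_pos (not_not.1 fun h => hiS (e3.1 h))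
        · rw [hP] at e3 ⊢
          exact if_neg (e3.2 (Finset.mem_insert_self _ _))

/-! ### A complete run -/

theorem firstArrivals_self_v {n : ℕ} (I : SKSInstance n) (σ : Equiv.Perm (Fin n))
    (T : Finset (Fin n)) :
    (I.firstArrivals σ le_rfl).v T = I.v (T.map σ.toEmbedding) := rfl

/-- Naming elements by arrival times turns σ into the identity: the run is analysed in
`I.firstArrivals σ le_rfl`, where element t arrives at time t. The truncation of the oracle is
harmless for sets that have arrived. -/
theorem answers_oracle {n : ℕ} (I : SKSInstance n) (σ : Equiv.Perm (Fin n)) (a : ℕ) :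
    Answers (OnlineAlgorithm.oracle I σ a) (I.firstArrivals σ le_rfl) a := by
  intro f T h1 h2
  rw [OnlineAlgorithm.oracle, firstArrivals_self_v]
  congr 2
  ext t
  simp only [Finset.mem_filter, Finset.mem_univ, true_and, h1]
  exact ⟨fun h => h.2, fun h => ⟨h2 t h, h⟩⟩

theorem runFrom_eq {n : ℕ} (I : SKSInstance n) (σ : Equiv.Perm (Fin n)) (l : List (Fin n))
    {a : ℕ} (hl : l = (List.finRange n).drop a) (ha : a ≤ n) {m : Mem} {T : Finset (Fin n)}
    (h : Inv (I.firstArrivals σ le_rfl) a ξ k m T) :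
    ∃ (m' : Mem) (T' : Finset (Fin n)),
      algorithm.runFrom I σ l m (T.map σ.toEmbedding) =
        PMF.pure (m', T'.map σ.toEmbedding) ∧ Inv (I.firstArrivals σ le_rfl) n ξ k m' T' := by
  induction l generalizing a m T with
  | nil =>
    have : a = n := by
      have := congrArg List.length hl
      simp at this
      omega
    subst this
    exact ⟨m, T, rfl, h⟩
  | cons t l ih =>
    have han : a < n := by
      have := congrArg List.length hl
      simp at this
      omega
    rw [List.drop_eq_getElem_cons (by simpa using han)] at hl
    obtain ⟨ht, hl'⟩ := List.cons.inj hl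
    have hta : (t : ℕ) = a := by rw [ht]; simp
    subst hta
    have hs := h.step (answers_oracle I σ (t + 1)) rfl
    obtain ⟨m', T', e, hi⟩ := ih hl' han hs
    refine ⟨m', T', ?_, hi⟩
    rw [← e, OnlineAlgorithm.runFrom]
    change (arrivalProg.exec _ _).bind _ = _
    rw [Prog.exec_eq_pure randFree_arrivalProg, PMF.pure_bind]
    congr 1
    rw [apply_ite (fun S : Finset (Fin n) => S.map σ.toEmbedding), Finset.map_insert]
    rfl

/-- The state after the setup. -/
structure Start (n : ℕ) (B : ℝ) (ξ k : ℕ) (m : Mem) : Prop where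
  size : m.nat 0 0 = n
  sample : m.nat 3 0 = ξ
  mode : m.nat 4 0 = k
  flag : m.nat 6 0 = 0
  clean : ∀ i, m.nat 12 i = 0
  budget : m.real 0 0 = B
  max : m.real 3 0 = 0

theorem Start.inv {n : ℕ} (J : SKSInstance n) {m : Mem} (h : Start n J.B ξ k m) :
    Inv J 0 ξ k m ∅ := by
  refine ⟨⟨h.size, h.sample, h.budget, fun t ht => absurd ht (Nat.not_lt_zero _)⟩, h.mode, h.clean,
    ⟨fun t ht => by omega, Or.inl h.max⟩,
    fun _ => Or.inl ⟨h.flag, rfl, fun t _ ht => absurd ht (Nat.not_lt_zero _)⟩, fun _ => ⟨?_, ?_⟩⟩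
  · rw [sweepAfter_of_le (Nat.zero_le _)]
  · exact fun h => absurd h (Nat.not_lt_zero _)

/-- The set that is accepted, in terms of arrival times. -/
def Accepts (J : SKSInstance n) (ξ k : ℕ) (T : Finset (Fin n)) : Prop :=
  ∃ M, SampleMax J ξ M ∧
    (k ≤ 1 → (T = ∅ ∧ ∀ t : Fin n, ξ ≤ t → J.c t ≤ J.B → J.v {t} ≤ dynkinFactor k * M) ∨
      ∃ t : Fin n, ξ ≤ t ∧ J.c t ≤ J.B ∧ dynkinFactor k * M < J.v {t} ∧ T = {t}) ∧
    (2 ≤ k → T = J.pairSweep 8.725 (bestGuess J ξ M n) ((List.finRange n).drop ξ) (fun _ => ∅)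
      (decide (k ≠ 2)))

theorem exists_accepts {n : ℕ} (I : SKSInstance n) (σ : Equiv.Perm (Fin n)) (hξ : ξ ≤ n) {m : Mem}
    (h : Start n I.B ξ k m) : ∃ (m' : Mem) (T : Finset (Fin n)),
      algorithm.runFrom I σ (List.finRange n) m ∅ = PMF.pure (m', T.map σ.toEmbedding) ∧
        Accepts (I.firstArrivals σ le_rfl) ξ k T := by
  obtain ⟨m', T, e, hI⟩ := runFrom_eq I σ (List.finRange n) (a := 0) (by simp) (Nat.zero_le _)
    (Start.inv (I.firstArrivals σ le_rfl) h)
  refine ⟨m', T, by simpa using e, m'.real 3 0, ?_, fun hk => ?_, fun hk => ?_⟩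
  · have := hI.max
    rwa [min_eq_right hξ] at this
  · rcases hI.dynkin hk with ⟨-, b1, b2⟩ | ⟨-, t, b1, -, b2, b3⟩
    · exact Or.inl ⟨b1, fun t h1 h2 => b2 t h1 t.2 h2⟩
    · exact Or.inr ⟨t, b1, b2, b3⟩
  · have := (hI.sweep hk).1
    rwa [sweepAfter, List.take_of_length_le (by simp)] at this

end Secretary

/-- The size of a random set, by the membership of the last element. -/
theorem lexp_card_succ (N : ℕ) (F : ℕ → ℝ≥0∞) :
    ((PMF.uniformOfFintype (Finset (Fin (N + 1)))).lexp fun H => F H.card) =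
      2⁻¹ * (((PMF.uniformOfFintype (Finset (Fin N))).lexp fun H => F H.card) +
        (PMF.uniformOfFintype (Finset (Fin N))).lexp fun H => F (H.card + 1)) := by
  have e : ∀ (N : ℕ) (F : ℕ → ℝ≥0∞),
      ∑ H : Finset (Fin N), F H.card = ∑ H ∈ (Finset.range N).powerset, F H.card := by
    intro N F
    rw [Finset.sum_powerset_apply_card, ← Finset.powerset_univ, Finset.sum_powerset_apply_card,
      Finset.card_univ, Fintype.card_fin, Finset.card_range]
  have e' : ∑ H ∈ (Finset.range (N + 1)).powerset, F H.card =
      (∑ H ∈ (Finset.range N).powerset, F H.card) +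
        ∑ H ∈ (Finset.range N).powerset, F (H.card + 1) := by
    rw [Finset.range_add_one, Finset.sum_powerset_insert Finset.notMem_range_self]
    congr 1
    refine Finset.sum_congr rfl fun H hH => ?_
    rw [Finset.card_insert_of_notMem]
    exact fun h => Finset.notMem_range_self (Finset.mem_powerset.1 hH h)
  simp only [PMF.lexp_uniform]
  rw [e, e', e, e N fun k => F (k + 1), ← mul_add, ← mul_assoc, Fintype.card_finset,
    Fintype.card_finset, Fintype.card_fin, Fintype.card_fin,
    ← ENNReal.mul_inv (by simp) (by simp)]
  congr 2
  push_cast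
  ring

namespace Secretary

variable {n : ℕ} {J : SKSInstance n} {ξ k : ℕ}

/-! ### The setup -/

/-- The state between two coin flips. -/
structure Coins (n : ℕ) (B : ℝ) (s : ℕ) (m : Mem) : Prop where
  size : m.nat 0 0 = n
  sample : m.nat 3 0 = s
  flag : m.nat 6 0 = 0
  clean : ∀ i, m.nat 12 i = 0
  budget : m.real 0 0 = B
  max : m.real 3 0 = 0

theorem exec_coinProg {B : ℝ} {s : ℕ} {m : Mem} (h : Coins n B s m) (orc : (ℕ → ℕ) → ℝ) :
    ∃ g : Fin 2 → Mem, (∀ r : Fin 2, Coins n B (s + (r : ℕ)) (g r)) ∧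
      coinProg.exec orc m = (PMF.uniformOfFintype (Fin 2)).bind fun r => PMF.pure (g r) := by
  refine ⟨fun r => (Prog.nset 3 (.lit 0) (.add (natReg 3) (natReg 5))).det orc
    ((m.setNat 5 0 r).tick 3), fun r => ?_, ?_⟩
  · refine ⟨?_, ?_, ?_, ?_, h.budget, h.max⟩
    · simp [Prog.det, Mem.nat_setNat, h.size]
    · simp [Prog.det, Mem.nat_setNat, NExp.eval, h.sample]
    · simp [Prog.det, Mem.nat_setNat, h.flag]
    · simp [Prog.det, Mem.nat_setNat, h.clean]
  · rw [coinProg, Prog.exec, Prog.exec, PMF.bind_bind]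
    refine congrArg (PMF.bind _) (funext fun r => ?_)
    rw [PMF.pure_bind]
    rfl

/-- One coin at a time: `lexp_card_succ` conditions the random subset on one element, as a flip
conditions the counter. -/
theorem le_lexp_coins {B : ℝ} (orc : (ℕ → ℕ) → ℝ) (N : ℕ) {s : ℕ} {m : Mem}
    (h : Coins n B s m) {F : ℕ → ℝ≥0∞} {g : Mem → ℝ≥0∞}
    (hg : ∀ s' m', s' ≤ s + N → Coins n B s' m' → F s' ≤ g m') :
    ((PMF.uniformOfFintype (Finset (Fin N))).lexp fun H => F (s + H.card)) ≤
      (iterM (coinProg.exec orc) N m).lexp g := by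
  induction N generalizing s m with
  | zero =>
    rw [iterM, PMF.lexp_pure]
    refine le_trans (PMF.lexp_mono _ fun H => ?_) (PMF.lexp_const _ _).le
    rw [show H.card = 0 from Nat.le_zero.1 (card_finset_fin_le H)]
    exact hg s m (by omega) h
  | succ N ih =>
    obtain ⟨q, hq, e⟩ := exec_coinProg h orc
    rw [lexp_card_succ N fun c => F (s + c), iterM, e, PMF.bind_bind, PMF.lexp_bind,
      PMF.lexp_uniform (α := Fin 2), Fin.sum_univ_two]
    simp only [PMF.pure_bind, Fintype.card_fin, Nat.cast_ofNat]
    refine mul_le_mul_right (add_le_add ?_ ?_) _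
    · exact ih (hq 0) fun s' m' hs' => hg s' m' (hs'.trans (by simp))
    · refine le_trans (le_of_eq ?_) (ih (hq 1) fun s' m' hs' => hg s' m' (hs'.trans (by simp; omega)))
      congr 1
      funext H
      congr 1
      simp
      ring

theorem support_coins {B : ℝ} (orc : (ℕ → ℕ) → ℝ) (N : ℕ) {s : ℕ} {m m' : Mem}
    (h : Coins n B s m) (hm' : m' ∈ (iterM (coinProg.exec orc) N m).support) :
    ∃ s' ≤ s + N, Coins n B s' m' := by
  induction N generalizing s m with
  | zero =>
    rw [iterM, PMF.mem_support_pure_iff] at hm'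
    subst hm'
    exact ⟨s, by omega, h⟩
  | succ N ih =>
    obtain ⟨q, hq, e⟩ := exec_coinProg h orc
    rw [iterM, PMF.mem_support_bind_iff] at hm'
    obtain ⟨m₁, h1, h2⟩ := hm'
    rw [e, PMF.mem_support_bind_iff] at h1
    obtain ⟨r, -, h1⟩ := h1
    rw [PMF.mem_support_pure_iff] at h1
    subst h1
    obtain ⟨s', hs', hc⟩ := ih (hq r) h2
    have := r.2
    exact ⟨s', by omega, hc⟩

theorem coins_initialMem (n : ℕ) (B : ℝ) (t : ℕ) :
    Coins n B 0 ((OnlineAlgorithm.initialMem n B).tick t) := by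
  refine ⟨?_, ?_, ?_, ?_, ?_, ?_⟩ <;>
    simp [OnlineAlgorithm.initialMem, Mem.nat_setNat, Mem.real_setReal]

theorem Coins.start {B : ℝ} {s : ℕ} {m : Mem} (h : Coins n B s m) (r t : ℕ) :
    Start n B s r ((m.setNat 4 0 r).tick t) := by
  refine ⟨?_, ?_, ?_, ?_, ?_, h.budget, h.max⟩
  · simp [Mem.nat_setNat, h.size]
  · simp [Mem.nat_setNat, h.sample]
  · simp [Mem.nat_setNat]
  · simp [Mem.nat_setNat, h.flag]
  · simp [Mem.nat_setNat, h.clean]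

theorem exec_setupProg (n : ℕ) (B : ℝ) (orc : (ℕ → ℕ) → ℝ) :
    setupProg.exec orc (OnlineAlgorithm.initialMem n B) =
      (iterM (coinProg.exec orc) n ((OnlineAlgorithm.initialMem n B).tick 3)).bind fun m =>
        (PMF.uniformOfFintype (Fin 4)).bind fun r => PMF.pure ((m.setNat 4 0 r).tick 3) := by
  have : (natReg 0).eval (OnlineAlgorithm.initialMem n B) = n := by
    simp [NExp.eval, OnlineAlgorithm.initialMem, Mem.nat_setNat]
  rw [setupProg, Prog.exec, Prog.exec, this]
  rfl

theorem le_lexp_setup (n : ℕ) (B : ℝ) (orc : (ℕ → ℕ) → ℝ) {G : ℕ → ℕ → ℝ≥0∞} {g : Mem → ℝ≥0∞}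
    (hg : ∀ ξ ≤ n, ∀ k < 4, ∀ m, Start n B ξ k m → G ξ k ≤ g m) :
    ((PMF.uniformOfFintype (Finset (Fin n))).lexp fun H =>
      (PMF.uniformOfFintype (Fin 4)).lexp fun k => G H.card k) ≤
      (setupProg.exec orc (OnlineAlgorithm.initialMem n B)).lexp g := by
  rw [exec_setupProg, PMF.lexp_bind]
  have := le_lexp_coins orc n (coins_initialMem n B 3)
    (F := fun s => (PMF.uniformOfFintype (Fin 4)).lexp fun k => G s k)
    (g := fun m => (((PMF.uniformOfFintype (Fin 4)).bind fun r =>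
      PMF.pure ((m.setNat 4 0 r).tick 3)).lexp g)) (by
      intro s m hs hc
      rw [PMF.lexp_bind]
      refine PMF.lexp_mono _ fun r => ?_
      rw [PMF.lexp_pure]
      exact hg s (by omega) r r.2 _ (hc.start r 3))
  simpa using this

theorem support_setup {n : ℕ} {B : ℝ} {orc : (ℕ → ℕ) → ℝ} {m : Mem}
    (hm : m ∈ (setupProg.exec orc (OnlineAlgorithm.initialMem n B)).support) :
    ∃ ξ ≤ n, ∃ k, Start n B ξ k m := by
  rw [exec_setupProg, PMF.mem_support_bind_iff] at hm
  obtain ⟨m₁, h1, h2⟩ := hm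
  rw [PMF.mem_support_bind_iff] at h2
  obtain ⟨r, -, h2⟩ := h2
  rw [PMF.mem_support_pure_iff] at h2
  subst h2
  obtain ⟨s, hs, hc⟩ := support_coins orc n (coins_initialMem n B 3) h1
  exact ⟨s, by omega, r, hc.start r 3⟩

/-- Since `Accepts` constrains the accepted set without computing it, the bound is stated for every
G that lies below f on all sets allowed for (ξ, k). -/
theorem le_lexp_outcome {n : ℕ} (I : SKSInstance n) (σ : Equiv.Perm (Fin n))
    {G : ℕ → ℕ → ℝ≥0∞} {f : Finset (Fin n) → ℝ≥0∞}
    (hG : ∀ ξ ≤ n, ∀ k < 4, ∀ T, Accepts (I.firstArrivals σ le_rfl) ξ k T →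
      G ξ k ≤ f (T.map σ.toEmbedding)) :
    ((PMF.uniformOfFintype (Finset (Fin n))).lexp fun H =>
      (PMF.uniformOfFintype (Fin 4)).lexp fun k => G H.card k) ≤
      (algorithm.outcome n I σ).lexp f := by
  rw [OnlineAlgorithm.outcome, PMF.lexp_map, OnlineAlgorithm.run, PMF.lexp_bind]
  refine le_lexp_setup n I.B _ fun ξ hξ k hk m hm => ?_
  obtain ⟨m', T, e, hT⟩ := exists_accepts I σ hξ hm
  rw [e, PMF.lexp_pure]
  exact hG ξ hξ k hk T hT

theorem accepts_of_mem_support {n : ℕ} (I : SKSInstance n) (σ : Equiv.Perm (Fin n))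
    {S : Finset (Fin n)} (hS : S ∈ (algorithm.outcome n I σ).support) :
    ∃ ξ k T, Accepts (I.firstArrivals σ le_rfl) ξ k T ∧ S = T.map σ.toEmbedding := by
  rw [OnlineAlgorithm.outcome, PMF.support_map, OnlineAlgorithm.run] at hS
  obtain ⟨r, hr, rfl⟩ := hS
  rw [PMF.mem_support_bind_iff] at hr
  obtain ⟨m, hm, hr⟩ := hr
  obtain ⟨ξ, hξ, k, hst⟩ := support_setup hm
  obtain ⟨m', T, e, hT⟩ := exists_accepts I σ hξ hst
  rw [e, PMF.mem_support_pure_iff] at hr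
  subst hr
  exact ⟨ξ, k, T, hT, rfl⟩

theorem Accepts.feasible {T : Finset (Fin n)} (h : Accepts J ξ k T) : J.Feasible T := by
  obtain ⟨M, -, h1, h2⟩ := h
  rcases Nat.lt_or_ge k 2 with hk | hk
  · rcases h1 (by omega) with ⟨rfl, -⟩ | ⟨t, -, hc, -, rfl⟩
    · exact J.feasible_empty
    · exact SKSInstance.feasible_singleton J |>.2 hc
  · rw [h2 hk]
    exact J.feasible_pairSweep (by norm_num) _ (nodup_drop_finRange _ _) _

/-! ### The estimate of the optimum -/

theorem SampleMax.nonneg {M : ℝ} (h : SampleMax J ξ M) : 0 ≤ M := by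
  rcases h.2 with rfl | ⟨t, -, -, rfl⟩
  · exact le_rfl
  · exact J.v_nonneg _

/-- By symmetry the sample maximum is unique, so the two sweep modes use the same estimate. -/
theorem SampleMax.le {M M' : ℝ} (h : SampleMax J ξ M) (h' : SampleMax J ξ M') : M ≤ M' := by
  rcases h.2 with rfl | ⟨t, h1, h2, rfl⟩
  · exact h'.nonneg
  · exact h'.1 t h1 h2

theorem le_bestGuess (M : ℝ) (l : ℕ) : M ≤ bestGuess J ξ M l := by
  induction l with
  | zero => exact le_rfl
  | succ l ih => exact ih.trans ((le_max_left _ _).trans (le_max_left _ _))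

theorem sweepSample_le_bestGuess (M : ℝ) {l L : ℕ} (h : l < L) (j : Bool) :
    J.v (sweepSample J ξ (2 ^ l * M) j) ≤ bestGuess J ξ M L := by
  induction L with
  | zero => omega
  | succ L ih =>
    rcases Nat.lt_succ_iff_lt_or_eq.1 h with h | rfl
    · exact (ih h).trans ((le_max_left _ _).trans (le_max_left _ _))
    · cases j
      · exact (le_max_right _ _).trans (le_max_left _ _)
      · exact le_max_right _ _

theorem bestGuess_le_opt {M : ℝ} (hM : SampleMax J ξ M) (l : ℕ) :
    bestGuess J ξ M l ≤ J.opt := by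
  induction l with
  | zero =>
    rcases hM.2 with h | ⟨t, -, h2, h⟩
    · exact h.le.trans J.opt_nonneg
    · exact h.le.trans (J.le_opt (J.feasible_singleton.2 h2))
  | succ l ih =>
    have hS : ∀ j, J.v (sweepSample J ξ (2 ^ l * M) j) ≤ J.opt := fun j =>
      J.le_opt (J.feasible_pairSweep (by norm_num) _ (nodup_take_finRange _ _) j)
    exact max_le (max_le ih (hS false)) (hS true)

/-- The largest guess that does not exceed V is also at least V/2. -/
theorem exists_guess {M V : ℝ} {N : ℕ} (hN : N ≠ 0) (h1 : M ≤ V) (h2 : V ≤ 2 ^ N * M) :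
    ∃ l < N, 2 ^ l * M ≤ V ∧ V ≤ 2 * (2 ^ l * M) := by
  induction N with
  | zero => exact absurd rfl hN
  | succ N ih =>
    by_cases h : 2 ^ N * M ≤ V
    · exact ⟨N, Nat.lt_succ_self _, h, by rw [pow_succ] at h2; linarith⟩
    · have hN : N ≠ 0 := by
        rintro rfl
        simp at h
        linarith
      obtain ⟨l, hl, hh⟩ := ih hN (not_le.1 h).le
      exact ⟨l, by omega, hh⟩

/-- Let y be the best value found, and suppose that v(F) > 40y ≥ M. As v(F) ≤ nM ≤ 2^n·M, some guess
x has x ≤ v(F) ≤ 2x. In `pairSweep_value` for this x, the first two alternatives give v(F) ≤ 4βy =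
34.9y, and the third gives (β − 2)·v(F) ≤ 4βy. -/
theorem le_bestGuess_of_feasible {M : ℝ} (hM : SampleMax J ξ M) {F : Finset (Fin n)}
    (hF : F ⊆ firstTimes n ξ) (fF : J.Feasible F) : J.v F ≤ 40 * bestGuess J ξ M n := by
  set y := bestGuess J ξ M n
  have hy : M ≤ y := le_bestGuess M n
  have hM0 := hM.nonneg
  have hsing : ∀ i ∈ F, J.v {i} ≤ M := fun i hi =>
    hM.1 i (mem_firstTimes.1 (hF hi)) (fF.cost_le hi)
  by_contra hcon
  rw [not_le] at hcon
  have hsum : J.v F ≤ n * M := by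
    calc J.v F ≤ ∑ i ∈ F, J.v {i} := J.v_le_sum F
      _ ≤ ∑ _i ∈ F, M := Finset.sum_le_sum hsing
      _ = F.card * M := by simp
      _ ≤ n * M := by
        refine mul_le_mul_of_nonneg_right ?_ hM0
        exact_mod_cast card_finset_fin_le F
  have hMpos : 0 < M := by
    by_contra h
    have : M = 0 := le_antisymm (not_lt.1 h) hM0
    rw [this] at hsum hy
    linarith
  have hn : n ≠ 0 := by
    rintro rfl
    simp at hsum
    linarith
  have hpow : (n : ℝ) * M ≤ 2 ^ n * M := by
    refine mul_le_mul_of_nonneg_right ?_ hM0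
    exact_mod_cast Nat.lt_two_pow_self.le
  obtain ⟨l, hl, g1, g2⟩ := exists_guess hn (by linarith : M ≤ J.v F) (hsum.trans hpow)
  have b0 := sweepSample_le_bestGuess (J := J) (ξ := ξ) M hl false
  have b1 := sweepSample_le_bestGuess (J := J) (ξ := ξ) M hl true
  rcases J.pairSweep_value (β := 8.725) (by norm_num) (by positivity : 0 < 2 ^ l * M) fF
    (nodup_take_finRange n ξ) (fun t ht => by
      rw [List.mem_toFinset, mem_take_finRange]; exact mem_firstTimes.1 (hF ht)) with
    ⟨j, hj⟩ | ⟨i, hi, hj⟩ | hj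
  · have := sweepSample_le_bestGuess (J := J) (ξ := ξ) M hl j
    simp only [sweepSample] at this
    linarith
  · have := hsing i hi
    linarith
  · simp only [sweepSample] at b0 b1
    linarith

/-! ### The approximation guarantee -/

section

variable (I : SKSInstance n) (σ : Equiv.Perm (Fin n))

theorem feasible_firstArrivals_self {T : Finset (Fin n)} :
    (I.firstArrivals σ le_rfl).Feasible T ↔ I.Feasible (T.map σ.toEmbedding) :=
  I.feasible_firstArrivals σ le_rfl

theorem exists_map_eq (F : Finset (Fin n)) : ∃ T : Finset (Fin n), T.map σ.toEmbedding = F :=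
  ⟨F.map σ.symm.toEmbedding, by rw [Finset.map_map]; simp⟩

theorem firstArrivals_self_opt : (I.firstArrivals σ le_rfl).opt = I.opt := by
  refine le_antisymm (I.firstArrivals_opt_le σ le_rfl) ?_
  obtain ⟨O, hO, h⟩ := I.exists_opt
  obtain ⟨T, rfl⟩ := exists_map_eq σ O
  rw [← h]
  exact (I.firstArrivals σ le_rfl).le_opt ((feasible_firstArrivals_self I σ).2 hO)

theorem goodSample_firstArrivals {δ : ℝ}
    (h : I.GoodSample δ ((firstTimes n ξ).map σ.toEmbedding)) :
    (I.firstArrivals σ le_rfl).GoodSample δ (firstTimes n ξ) := by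
  obtain ⟨⟨F, hF, fF, hv⟩, ⟨F', hF', fF', hv'⟩⟩ := h
  obtain ⟨T, rfl⟩ := exists_map_eq σ F
  obtain ⟨T', rfl⟩ := exists_map_eq σ F'
  refine ⟨⟨T, Finset.map_subset_map.1 hF, (feasible_firstArrivals_self I σ).2 fF, ?_⟩,
    ⟨T', fun t ht => ?_, (feasible_firstArrivals_self I σ).2 fF', ?_⟩⟩
  · rw [firstArrivals_self_opt]; exact hv
  · have := hF' (Finset.mem_map_of_mem _ ht)
    simpa using this
  · rw [firstArrivals_self_opt]; exact hv'

/-- The two sweep modes on a good sample. -/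
theorem sweep_value (h : ∀ i, I.c i ≤ I.B → I.v {i} < 1 / 3200 * I.opt)
    (hA : I.GoodSample (1 / 3200) ((firstTimes n ξ).map σ.toEmbedding))
    {T T' : Finset (Fin n)} (hT : Accepts (I.firstArrivals σ le_rfl) ξ 2 T)
    (hT' : Accepts (I.firstArrivals σ le_rfl) ξ 3 T') :
    1 / 3200 * I.opt ≤ I.v (T.map σ.toEmbedding) + I.v (T'.map σ.toEmbedding) := by
  obtain ⟨M, hM, -, e⟩ := hT
  obtain ⟨M', hM', -, e'⟩ := hT'
  obtain rfl : M = M' := le_antisymm (hM.le hM') (hM'.le hM)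
  rw [← firstArrivals_self_v, ← firstArrivals_self_v]
  rw [← firstArrivals_self_opt I σ] at h ⊢
  have hA' := goodSample_firstArrivals I σ hA
  have h' : ∀ i, (I.firstArrivals σ le_rfl).c i ≤ (I.firstArrivals σ le_rfl).B →
      (I.firstArrivals σ le_rfl).v {i} < 1 / 3200 * (I.firstArrivals σ le_rfl).opt :=
    fun i hi => by
      have := h (σ i) hi
      rwa [firstArrivals_self_v, Finset.map_singleton]
  generalize I.firstArrivals σ le_rfl = J at *
  have e := e le_rfl
  have e' := e' (by norm_num)
  simp only [ne_eq, not_true_eq_false, decide_false] at e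
  rw [show decide (3 ≠ 2) = true from rfl] at e'
  have x2 := bestGuess_le_opt hM n
  obtain ⟨F, hF, fF, hv⟩ := hA'.1
  have x1 := le_bestGuess_of_feasible hM hF fF
  rcases J.opt_nonneg.eq_or_lt with h0 | h0
  · rw [← h0]
    have := J.v_nonneg T
    have := J.v_nonneg T'
    linarith
  -- From opt/4 ≤ v(F) and v(F) ≤ 40 times the estimate comes γ = 1/160, and δ = γ/20.
  · have := J.pairSweep_value_of_goodSample (γ := 1 / 160) (δ := 1 / 3200)
      (x := bestGuess J ξ M n) (by norm_num) (by norm_num) h' hA'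
      (nodup_drop_finRange n ξ) (fun t ht => by
        rw [List.mem_toFinset, mem_drop_finRange]
        rw [Finset.mem_compl, mem_firstTimes] at ht
        omega) (by linarith) (by linarith) x2
    rw [← e, ← e'] at this
    refine le_trans (le_of_eq ?_) this
    norm_num

/-- A Dynkin mode, if the best element arrives after the sample and the second best one does not. -/
theorem dynkin_mode_value {i : Fin n} (hi : I.c i ≤ I.B)
    (hbest : ∀ l, I.c l ≤ I.B → I.v {l} ≤ I.v {i}) :
    ∃ (P : Finset (Fin n)) (k : ℕ), k ≤ 1 ∧ P.card ≤ 1 ∧ i ∉ P ∧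
      ∀ (σ : Equiv.Perm (Fin n)) (ξ : ℕ) (T : Finset (Fin n)),
        i ∉ (firstTimes n ξ).map σ.toEmbedding → P ⊆ (firstTimes n ξ).map σ.toEmbedding →
        Accepts (I.firstArrivals σ le_rfl) ξ k T → I.v {i} / 2 ≤ I.v (T.map σ.toEmbedding) := by
  classical
  have hpos : ∀ (σ : Equiv.Perm (Fin n)) (ξ : ℕ) (l : Fin n),
      l ∈ (firstTimes n ξ).map σ.toEmbedding ↔ (σ.symm l : ℕ) < ξ := by
    intro σ ξ l
    rw [← mem_firstTimes (n := n), Finset.mem_map_equiv]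
  have hv1 : ∀ (σ : Equiv.Perm (Fin n)) (t : Fin n),
      (I.firstArrivals σ le_rfl).v {t} = I.v {σ t} := by
    intro σ t
    rw [firstArrivals_self_v, Finset.map_singleton]
    rfl
  have hc1 : ∀ (σ : Equiv.Perm (Fin n)) (t : Fin n),
      (I.firstArrivals σ le_rfl).c t = I.c (σ t) := fun σ t => rfl
  have hB1 : ∀ σ : Equiv.Perm (Fin n), (I.firstArrivals σ le_rfl).B = I.B := fun σ => rfl
  have hvi := I.v_nonneg {i}
  by_cases he : ∃ l, I.c l ≤ I.B ∧ l ≠ i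
  · obtain ⟨j, hj, hmax⟩ := (Finset.univ.filter fun l => I.c l ≤ I.B ∧ l ≠ i).exists_max_image
      (fun l => I.v {l}) (by obtain ⟨l, hl⟩ := he; exact ⟨l, by simpa using hl⟩)
    simp only [Finset.mem_filter, Finset.mem_univ, true_and] at hj hmax
    have hjM : ∀ (σ : Equiv.Perm (Fin n)) (ξ : ℕ) (M : ℝ),
        {j} ⊆ (firstTimes n ξ).map σ.toEmbedding →
        SampleMax (I.firstArrivals σ le_rfl) ξ M → I.v {j} ≤ M := by
      intro σ ξ M hP hM
      have := hM.1 (σ.symm j) ((hpos σ ξ j).1 (hP (Finset.mem_singleton_self j)))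
      rw [hc1, hv1, hB1, Equiv.apply_symm_apply] at this
      exact this hj.1
    -- In a tie a strict threshold M would reject i. With factor 1/2 and j in the sample, M =
    -- v({i}), everything accepted is worth more than M/2, and i passes unless its value is 0.
    by_cases hij : I.v {j} = I.v {i}
    · refine ⟨{j}, 1, le_rfl, by simp, by simpa using hj.2.symm, ?_⟩
      rintro σ ξ T h1 h2 ⟨M, hM, h3, -⟩
      rw [hpos, not_lt] at h1
      have hjM := hjM σ ξ M h2 hM
      have hd : dynkinFactor 1 = 1 / 2 := by simp [dynkinFactor]
      rw [hd] at h3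
      rcases h3 le_rfl with ⟨rfl, h4⟩ | ⟨t, -, -, h5, rfl⟩
      · have hMi : M ≤ I.v {i} := by
          rcases hM.2 with rfl | ⟨t, -, h6, rfl⟩
          · exact hvi
          · rw [hv1]; exact hbest _ h6
        have := h4 (σ.symm i) h1
        rw [hc1, hv1, hB1, Equiv.apply_symm_apply] at this
        have := this hi
        rw [Finset.map_empty, I.v_empty]
        linarith
      · rw [hv1] at h5
        rw [Finset.map_singleton]
        change _ ≤ I.v {σ t}
        linarith
    -- Without a tie, i is the only affordable element that exceeds M once j is in the sample and i
    -- is not.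
    · refine ⟨{j}, 0, by norm_num, by simp, by simpa using hj.2.symm, ?_⟩
      rintro σ ξ T h1 h2 ⟨M, hM, h3, -⟩
      have h1' := h1
      rw [hpos, not_lt] at h1
      have hjM := hjM σ ξ M h2 hM
      have hd : dynkinFactor 0 = 1 := by simp [dynkinFactor]
      rw [hd] at h3
      rcases h3 (by norm_num) with ⟨rfl, h4⟩ | ⟨t, -, h5, h6, rfl⟩
      · have h7 := h4 (σ.symm i) h1
        rw [hc1, hv1, hB1, Equiv.apply_symm_apply] at h7
        have h7 := h7 hi
        rw [Finset.map_empty, I.v_empty]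
        rcases hM.2 with rfl | ⟨t, h8, h9, rfl⟩
        · linarith
        · exfalso
          have hti : σ t ≠ i := by
            rintro rfl
            simp at h1
            omega
          have := hmax (σ t) ⟨h9, hti⟩
          rw [hv1] at h7
          have := hbest j hj.1
          exact hij (by linarith)
      · rw [Finset.map_singleton]
        change _ ≤ I.v {σ t}
        rw [hv1] at h6
        by_cases hti : σ t = i
        · rw [hti]; linarith
        · have := hmax (σ t) ⟨h5, hti⟩
          linarith
  -- If i alone is affordable, M = 0 whenever i is outside the sample, so no element has to be
  -- inside.
  · refine ⟨∅, 0, by norm_num, by simp, by simp, ?_⟩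
    push Not at he
    rintro σ ξ T h1 h2 ⟨M, hM, h3, -⟩
    rw [hpos, not_lt] at h1
    have hd : dynkinFactor 0 = 1 := by simp [dynkinFactor]
    rw [hd] at h3
    rcases h3 (by norm_num) with ⟨rfl, h4⟩ | ⟨t, -, h5, h6, rfl⟩
    · have h7 := h4 (σ.symm i) h1
      rw [hc1, hv1, hB1, Equiv.apply_symm_apply] at h7
      have h7 := h7 hi
      rw [Finset.map_empty, I.v_empty]
      rcases hM.2 with rfl | ⟨t, h8, h9, rfl⟩
      · linarith
      · exfalso
        have hti := he (σ t) h9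
        rw [← hti] at h1
        simp at h1
        omega
    · rw [Finset.map_singleton]
      change _ ≤ I.v {σ t}
      rw [he (σ t) h5]
      linarith

end

theorem sixteenth_mul_ofReal (a : ℝ) :
    4⁻¹ * (4⁻¹ * ENNReal.ofReal a) = ENNReal.ofReal (1 / 16 * a) := by
  rw [← mul_assoc, ← ENNReal.mul_inv (by simp) (by simp),
    show ((4 : ℝ≥0∞) * 4)⁻¹ = ENNReal.ofReal (1 / 16) by
      rw [one_div, ENNReal.ofReal_inv_of_pos (by norm_num)]; norm_num,
    ← ENNReal.ofReal_mul (by norm_num)]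

-- The factor 1/16 is 1/4 for the event on the sample times 1/4 for the mode. The sweep modes
-- together yield 1/16 · 1/3200 of opt; the suitable threshold mode yields 1/16 · 1/2 · 1/3200.
open Classical in
theorem isSecretaryApprox_algorithm :
    IsSecretaryApprox (1 / (1 / 102400) + 1 / (1 / 51200)) algorithm.outcome := by
  intro n I
  refine ⟨fun σ S hS => ?_, I.opt_le_of_ofReal_le _ (by norm_num) (by norm_num) ?_⟩
  · obtain ⟨ξ, k, T, hT, rfl⟩ := accepts_of_mem_support I σ hS
    exact (feasible_firstArrivals_self I σ).1 hT.feasible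
  rw [PMF.lexp_bind]
  by_cases h : ∀ i, I.c i ≤ I.B → I.v {i} < 1 / 3200 * I.opt
  · right
    have h4 := I.quarter_le_goodSample (δ := 1 / 3200) (by norm_num)
      (fun i hi => (h i hi).le) (4⁻¹ * ENNReal.ofReal (1 / 3200 * I.opt))
    rw [← lexp_sample, sixteenth_mul_ofReal] at h4
    rw [show 1 / 16 * (1 / 3200 * I.opt) = 1 / 51200 * I.opt by ring] at h4
    refine h4.trans (PMF.lexp_mono _ fun σ => ?_)
    -- The worst value among the sets that `Accepts` allows. A bound for the sum over every pair of
    -- such sets passes to the sum of the two infima.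
    set W : ℕ → ℕ → ℝ≥0∞ := fun ξ k =>
      ⨅ T : {T // Accepts (I.firstArrivals σ le_rfl) ξ k T},
        ENNReal.ofReal (I.v (T.1.map σ.toEmbedding)) with hW
    refine le_trans (PMF.lexp_mono _ fun H => ?_) (le_lexp_outcome I σ (G := W)
      fun ξ _ k _ T hT => iInf_le (fun T : {T // Accepts (I.firstArrivals σ le_rfl) ξ k T} =>
        ENNReal.ofReal (I.v (T.1.map σ.toEmbedding))) ⟨T, hT⟩)
    split_ifs with hA
    · refine le_trans ?_ (GenSm.lexp_uniform_fin_two_le (m := 3) (by decide : (2 : Fin 4) ≠ 3) _)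
      refine mul_le_mul' (by norm_num) ?_
      change _ ≤ W H.card 2 + W H.card 3
      rw [hW]
      refine ENNReal.le_iInf_add_iInf fun T T' => ?_
      rw [← ENNReal.ofReal_add (I.v_nonneg _) (I.v_nonneg _)]
      exact ENNReal.ofReal_le_ofReal (sweep_value I σ h hA T.2 T'.2)
    · exact zero_le
  · left
    push Not at h
    obtain ⟨i₀, hi₀, hv⟩ := h
    obtain ⟨i, hi, hbest⟩ := GenSm.exists_best I (s := Finset.univ.filter fun i => I.c i ≤ I.B)
      ⟨i₀, by simpa using hi₀⟩
    simp only [Finset.mem_filter, Finset.mem_univ, true_and] at hi hbest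
    obtain ⟨P, k, hk, hP, hiP, hval⟩ := dynkin_mode_value I hi fun l hl => (hbest l hl).le
    have : Nonempty (Fin n) := ⟨i⟩
    -- P has at most one element, and it is not i. So exchanging P, {i}, both or neither reaches the
    -- event from any set.
    have h4 := quarter_le_lexp (fun A => i ∉ A ∧ P ⊆ A) P {i} (by
        intro H
        rcases Finset.card_le_one_iff_subset_singleton.1 hP with ⟨j, hj⟩
        rcases Finset.subset_singleton_iff.1 hj with rfl | rfl
        · by_cases hH : i ∈ H <;> simp [Finset.mem_symmDiff, hH]
        · have hij : i ≠ j := by simpa using hiP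
          by_cases hH : i ∈ H <;> by_cases hH' : j ∈ H <;>
            simp [Finset.mem_symmDiff, hH, hH', hij, hij.symm])
      (4⁻¹ * ENNReal.ofReal (I.v {i} / 2))
    rw [← lexp_sample, sixteenth_mul_ofReal] at h4
    have hle : 1 / 102400 * I.opt ≤ 1 / 16 * (I.v {i} / 2) := by
      have := (hbest i₀ hi₀).le
      linarith
    refine ((ENNReal.ofReal_le_ofReal hle).trans h4).trans (PMF.lexp_mono _ fun σ => ?_)
    refine le_trans (PMF.lexp_mono _ fun H => ?_) (le_lexp_outcome I σ (G := fun ξ k' =>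
      if k' = k ∧ i ∉ (firstTimes n ξ).map σ.toEmbedding ∧
        P ⊆ (firstTimes n ξ).map σ.toEmbedding then ENNReal.ofReal (I.v {i} / 2) else 0)
      fun ξ _ k' _ T hT => ?_)
    · split_ifs with hA
      · refine le_trans ?_ (PMF.le_lexp_uniform_single _ ⟨k, by omega⟩)
        rw [if_pos ⟨rfl, hA⟩]
        simp
      · exact zero_le
    · split_ifs with hA
      · obtain ⟨rfl, h1, h2⟩ := hA
        exact ENNReal.ofReal_le_ofReal (hval σ ξ T h1 h2 hT)
      · exact zero_le

end Secretary

theorem mainTheorem6 :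
    (∃ (C : ℝ) (P : OnlineAlgorithm), P.PolynomialTime ∧ IsSecretaryApprox C P.outcome) ∧
    (∀ α : ℝ, 1 ≤ α → ∃ C : ℝ, ∀ alg : OfflineProcedure, alg.IsApprox α →
      IsSecretaryApprox C (GenSm.online alg)) :=
  ⟨⟨_, Secretary.algorithm, Secretary.polynomialTime_algorithm,
      Secretary.isSecretaryApprox_algorithm⟩,
    fun _ hα => ⟨_, fun _ halg => GenSm.isSecretaryApprox_online hα halg⟩⟩
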